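/- **Setting.** Let $\ell\ge 0$, $1\le n\le 4$, and put $d_\parallel=n-1$, $\kappa=4-d_\parallel$. Consider $\ell$-loop integrals with $n$ external legs, $$I_n^{d(\ell)}[\mathcal N]=\int\Big(\prod_{i=1}^{\ell}\frac{d^dq_i}{\pi^{d/2}}\Big)\frac{\mathcal N(q_i)}{\prod_{j=1}^r D_j(q_i)},\qquad D_j=\Big(\sum_i\alpha_{ij}q_i+\sum_i\beta_{ij}p_i\Big)^2+m_j^2,\quad \alpha_{ij},\beta_{ij}\in\{0,\pm1\},\ m_j\in\mathbb R,$$ in $d$-dimensional Euclidean space. The external momenta $p_1,\dots,p_{n-1}$ are linearly independent vectors of a four-dimensional physical subspace. Write $q_i=q_{[4]i}+\mu_i$ with $q_{[4]i}$ physical and $\mu_i$ orthogonal to the physical subspace, and $\mu_{ij}=\mu_i\cdot\mu_j$; $\mathcal N$ is an arbitrary polynomial (complex coefficients) in the components of the $q_{[4]i}$ and in the $\mu_{ij}$. Let $e_1,\dots,e_4$ be a basis of the physical space with $e_1,\dots,e_{d_\parallel}\in\mathrm{span}(p_1,\dots,p_{n-1})$ and $e_{d_\parallel+1},\dots,e_4$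 orthonormal and orthogonal to all $p_i$. Write $q_i=q_{\parallel i}+\lambda_i$ with $q_{\parallel i}=\sum_{j\le d_\parallel}x_{ji}e_j$ the orthogonal projection of $q_i$ to $\mathrm{span}(p_1,\dots,p_{n-1})$, put $\lambda_{ij}=\lambda_i\cdot\lambda_j$, $x_{ji}=e_j\cdot\lambda_i$ for $j>d_\parallel$, $d_\perp=d-d_\parallel=d-n+1$. The dimension $d$ is an integer $\ge \ell+4$, or a complex number with $\mathrm{Re}\,d>\ell+3$; for complex $d$ the integral is understood through the usual $d=4-2\epsilon$ parametrization $$I_n^{d(\ell)}[\mathcal N]=\Omega_d^{(\ell)}\int\prod_{i}d^4q_{[4]i}\int\prod_{i\le j}d\mu_{ij}\,[\det(\mu_{ij})]^{\frac{d-5-\ell}2}\,\frac{\mathcal N(q_{[4]i},\mu_{ij})}{\prod_j D_j(q_{[4]i},\mu_{ij})}$$ over positive semidefinite symmetric $(\mu_{ij})$, where $$\Omega_d^{(\ell)}=\prod_{i=1}^{\ell}\frac{\Omega_{d-4-i}}{2\pi^{d/2}},\qquad \Omega_z=\frac{2\pi^{(z+1)/2}}{\Gamma(\frac{z+1}2)}.$$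 **Angles.** $\boldsymbol\Theta_\Lambda=\{\theta_{ij}:1\le i<j\le\ell\}$, $\boldsymbol\Theta_\perp=\{\theta_{i+j-1\,j}:1\le i\le\kappa,\ 1\le j\le \ell\}$ and $\boldsymbol\Lambda=\{\lambda_{ii},\boldsymbol\Theta_\Lambda\}$. For vectors $\lambda_1,\dots,\lambda_\ell\in\mathbb R^m$ and an orthonormal basis $\mathcal B^{0}=(v_1,\dots,v_m)$, let $\mathcal B^{j}$ be the Gram–Schmidt orthonormalization of $\lambda_j$ followed by the first $m-1$ vectors of $\mathcal B^{j-1}$; the nested angles $\theta_{1j},\dots,\theta_{m-1\,j}$ are spherical angles of $\lambda_j$ with respect to $\mathcal B^{j-1}$, that is, its components are $|\lambda_j|\cos\theta_{kj}\prod_{i<k}\sin\theta_{ij}$ for $k<m$ and $|\lambda_j|\prod_{i<m}\sin\theta_{ij}$ for $k=m$, with $\theta_{ij}\in[0,\pi]$ for $i<m-1$ and $\theta_{m-1\,j}\in[0,2\pi)$. **Theorem.** There are polynomials, depending only on $\ell$ and $n$, $$\lambda_{ij}=P_{ij}\big[\sqrt{\lambda_{kk}},\sin\boldsymbol\Theta_\Lambda,\cos\boldsymbol\Theta_\Lambda\big]\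 (i<j),\qquad x_{ji}=P'_{ji}\big[\sqrt{\lambda_{kk}},\sin\boldsymbol\Theta_{\perp,\Lambda},\cos\boldsymbol\Theta_{\perp,\Lambda}\big]\ (j>d_\parallel),$$ with the following properties. 1. They are given by iterated Gram–Schmidt and nested spherical coordinates: for every $m\ge\ell+\kappa$, every orthonormal basis $v$ of $\mathbb R^m$ and all $\lambda_1,\dots,\lambda_\ell\in\mathbb R^m$ for which the lists entering the $\ell-1$ Gram–Schmidt processes that define $\mathcal B^1,\dots,\mathcal B^{\ell-1}$ are bases, nested angles exist, and for all nested angles $\lambda_i\cdot\lambda_j=P_{ij}$ for $i<j$ and $v_k\cdot\lambda_i=P'_{d_\parallel+k\,i}$ for $k\le\kappa$. 2. For every $D\in\mathbb C$ with $\mathrm{Re}\,D>\ell-1$ (in particular $D=d_\perp$), the integral over $\boldsymbol\Lambda$ is $$\int d^{\frac{\ell(\ell+1)}2}\boldsymbol\Lambda=\int\prod_{i\le j}d\lambda_{ij}\,[G(\lambda_{ij})]^{\frac{D-1-\ell}{2}}=\int_0^\infty\prod_{i=1}^\ell d\lambda_{ii}\,\lambda_{ii}^{\frac{D-2}2}\int_{-1}^1\prod_{1\le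 i<j\le\ell}d\cos\theta_{ij}\,(\sin\theta_{ij})^{D-2-i},$$ where $G=\det(\lambda_{ij})$ and the first integral is over positive semidefinite symmetric matrices: for every measurable function of the $\lambda_{ij}$, absolute convergence of the two integrals is equivalent, and then they agree. 3. The denominators depend only on the $q_{\parallel i}$ and the $\lambda_{ij}$, hence not on $\boldsymbol\Theta_\perp$: $$D_j=\Big(\sum_i\alpha_{ij}q_{\parallel i}+\sum_i\beta_{ij}p_i\Big)^2+\sum_{i,k}\alpha_{ij}\alpha_{kj}\lambda_{ik}+m_j^2 .$$ 4. After the substitution, $\mathcal N(q_\parallel,\boldsymbol\Lambda,\boldsymbol\Theta_\perp)$ is a polynomial in the $x_{ji}$ with $j\le d_\parallel$, the $\sqrt{\lambda_{ii}}$, and the sines and cosines of $\boldsymbol\Theta_\Lambda$ and $\boldsymbol\Theta_\perp$. 5. For every $d$ as above, $$I_n^{d(\ell)}[\mathcal N]=\Omega_d^{(\ell)}\int\prod_{i=1}^\ell d^{n-1}q_{\parallel i}\int d^{\frac{\ell(\ell+1)}2}\boldsymbol\Lambda\int d^{\kappa\ell}\boldsymbol\Theta_\perp\,\frac{\mathcal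 N(q_\parallel,\boldsymbol\Lambda,\boldsymbol\Theta_\perp)}{\prod_jD_j(q_\parallel,\boldsymbol\Lambda)},$$ $$\int d^{\kappa\ell}\boldsymbol\Theta_\perp=\int_{-1}^1\prod_{i=1}^{\kappa}\prod_{j=1}^{\ell}d\cos\theta_{i+j-1\,j}\,(\sin\theta_{i+j-1\,j})^{d_\perp-i-j-1},$$ with $\int d\boldsymbol\Lambda$ in the radial–angular form of part 2 with $D=d_\perp$: the left side converges absolutely if and only if the right side does, and then they are equal. -/

import Mathlib

open MeasureTheory
open scoped RealInnerProductSpace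

noncomputable section

namespace FeynmanPar

/-! ### Angular variables -/

/-- Index pairs `i < j` of loop momenta: labels of the angles `Θ_Λ` and of the off-diagonal
scalar products `λ_ij`. -/
abbrev LamIdx (l : ℕ) : Type := {p : Fin l × Fin l // p.1 < p.2}

/-- Index pairs `i ≤ j`: labels of the independent entries of a symmetric matrix. -/
abbrev SymIdx (l : ℕ) : Type := {p : Fin l × Fin l // p.1 ≤ p.2}

/-- Labels of the angles `Θ_⊥`. Counting from `0`, the pair `(k, j)` stands for the angle
`θ_{k+j, j}` in row `k + j` of column `j`, that is, for `θ_{i+j-1, j}` when counting from `1`. -/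
abbrev PerpIdx (l κ : ℕ) : Type := Fin κ × Fin l

/-- Variables `√λ_kk`, `cos Θ_Λ`, `sin Θ_Λ`. -/
abbrev LamVar (l : ℕ) : Type := Fin l ⊕ (LamIdx l ⊕ LamIdx l)

/-- Variables `√λ_kk`, `cos Θ_Λ`, `sin Θ_Λ`, `cos Θ_⊥`, `sin Θ_⊥`. -/
abbrev PerpVar (l κ : ℕ) : Type := LamVar l ⊕ (PerpIdx l κ ⊕ PerpIdx l κ)

def lamPoint {l : ℕ} (rad : Fin l → ℝ) (θL : LamIdx l → ℝ) : LamVar l → ℝ :=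
  Sum.elim rad (Sum.elim (fun p => Real.cos (θL p)) (fun p => Real.sin (θL p)))

def perpPoint {l κ : ℕ} (rad : Fin l → ℝ) (θL : LamIdx l → ℝ) (θP : PerpIdx l κ → ℝ) :
    PerpVar l κ → ℝ :=
  Sum.elim (lamPoint rad θL)
    (Sum.elim (fun p => Real.cos (θP p)) (fun p => Real.sin (θP p)))

/-- A polynomial substitution: the off-diagonal scalar products `λ_ij`, `i < j`, as polynomials in
`√λ_kk` and the sines and cosines of `Θ_Λ`, and the components `a_kj`, `k < κ`, of the vectors
`λ_j` as polynomials in `√λ_kk` and the sines and cosines of `Θ_Λ` and `Θ_⊥`. -/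
structure PolyMap (l κ : ℕ) where
  offDiag : LamIdx l → MvPolynomial (LamVar l) ℝ
  comp : PerpIdx l κ → MvPolynomial (PerpVar l κ) ℝ

/-! ### Iterated Gram–Schmidt and nested spherical coordinates -/

section Nested

variable {m l : ℕ}

/-- The list `u, b_1, …, b_{m-1}`. -/
def prepend (u : EuclideanSpace ℝ (Fin m)) (b : Fin m → EuclideanSpace ℝ (Fin m)) :
    Fin m → EuclideanSpace ℝ (Fin m) :=
  fun k => if (k : ℕ) = 0 then u else b ⟨(k : ℕ) - 1, by omega⟩

/-- The iterated Gram–Schmidt frames of the vectors `lam`: frame `0` is `v`, and frame `j + 1` is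
obtained by the normalised Gram–Schmidt process from `λ_j` followed by the first `m - 1` vectors of
frame `j` (`j` counts from `0`). -/
def frame (v : Fin m → EuclideanSpace ℝ (Fin m)) (lam : Fin l → EuclideanSpace ℝ (Fin m)) :
    ℕ → Fin m → EuclideanSpace ℝ (Fin m)
  | 0 => v
  | j + 1 => InnerProductSpace.gramSchmidtNormed ℝ
      (prepend (if h : j < l then lam ⟨j, h⟩ else 0) (frame v lam j))

/-- The `k`-th cartesian component, `k = 0, …, m - 1`, of the vector of `ℝ^m` with radius `rad` and
spherical angles `φ 0, …, φ (m - 2)`. -/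
def sphComp (m : ℕ) (rad : ℝ) (φ : ℕ → ℝ) (k : ℕ) : ℝ :=
  rad * (if k + 1 < m then Real.cos (φ k) else 1) * ∏ i ∈ Finset.range k, Real.sin (φ i)

/-- `θ i j` (row `i`, column `j`, both counted from `0`) are nested spherical coordinates of the
vectors `lam`: column `j` consists of spherical angles of `λ_j` with respect to frame `j`. -/
def IsNestedAngles (v : Fin m → EuclideanSpace ℝ (Fin m))
    (lam : Fin l → EuclideanSpace ℝ (Fin m)) (θ : ℕ → Fin l → ℝ) : Prop :=
  ∀ j : Fin l,
    (∀ i : ℕ, i + 2 < m → θ i j ∈ Set.Icc 0 Real.pi) ∧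
    (∀ i : ℕ, i + 2 = m → θ i j ∈ Set.Ico 0 (2 * Real.pi)) ∧
    ∀ k : Fin m, ⟪frame v lam j k, lam j⟫ = sphComp m ‖lam j‖ (fun i => θ i j) k

end Nested

/-- The polynomial map `T` is the change of variables given by iterated Gram–Schmidt followed by
spherical coordinates: in every dimension `m ≥ l + κ`, for every orthonormal basis `v` and all
vectors `λ_1, …, λ_l` for which the lists that enter the Gram–Schmidt processes are bases, nested
angles exist, and `T` expresses the `λ_i · λ_j` and the first `κ` components of every `λ_j` with
respect to `v` through the norms and the nested angles. -/
def PolyMap.IsNestedSpherical {l κ : ℕ} (T : PolyMap l κ) : Prop :=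
  ∀ (m : ℕ) (hm : l + κ ≤ m)
    (v : OrthonormalBasis (Fin m) ℝ (EuclideanSpace ℝ (Fin m)))
    (lam : Fin l → EuclideanSpace ℝ (Fin m)),
    (∀ j : Fin l, (j : ℕ) + 1 < l → LinearIndependent ℝ (prepend (lam j) (frame v lam j))) →
    (∃ θ : ℕ → Fin l → ℝ, IsNestedAngles v lam θ) ∧
    ∀ θ : ℕ → Fin l → ℝ, IsNestedAngles v lam θ →
      (∀ p : LamIdx l, ⟪lam p.1.1, lam p.1.2⟫ =
        MvPolynomial.eval
          (lamPoint (fun i => ‖lam i‖) (fun q : LamIdx l => θ q.1.1 q.1.2)) (T.offDiag p)) ∧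
      (∀ (k : Fin κ) (j : Fin l), ⟪v ⟨k, by omega⟩, lam j⟫ =
        MvPolynomial.eval
          (perpPoint (fun i => ‖lam i‖) (fun q : LamIdx l => θ q.1.1 q.1.2)
            (fun q : PerpIdx l κ => θ (q.1 + q.2) q.2)) (T.comp (k, j)))

/-! ### The new variables as functions of radii and angles -/

/-- The symmetric matrix with given entries on and above the diagonal. -/
def symMatrix {l : ℕ} (u : SymIdx l → ℝ) : Matrix (Fin l) (Fin l) ℝ :=
  fun i j => u ⟨(min i j, max i j), min_le_max⟩

/-- The scalar products `λ_ij`, `i ≤ j`, as functions of `t_i = λ_ii` and of `Θ_Λ`. -/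
def PolyMap.lamUpper {l κ : ℕ} (T : PolyMap l κ) (t : Fin l → ℝ) (θL : LamIdx l → ℝ) :
    SymIdx l → ℝ :=
  fun p => if h : p.1.1 < p.1.2 then
      MvPolynomial.eval (lamPoint (fun i => Real.sqrt (t i)) θL) (T.offDiag ⟨p.1, h⟩)
    else t p.1.1

/-- The matrix `(λ_ij)` as a function of `Λ = (λ_ii, Θ_Λ)`. -/
def PolyMap.lamMatrix {l κ : ℕ} (T : PolyMap l κ) (t : Fin l → ℝ) (θL : LamIdx l → ℝ) :
    Matrix (Fin l) (Fin l) ℝ :=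
  symMatrix (T.lamUpper t θL)

/-- The transverse component number `k` of `λ_j`, as a function of `λ_ii`, `Θ_Λ` and `Θ_⊥`. -/
def PolyMap.perpComp {l κ : ℕ} (T : PolyMap l κ) (t : Fin l → ℝ) (θL : LamIdx l → ℝ)
    (θP : PerpIdx l κ → ℝ) (k : Fin κ) (j : Fin l) : ℝ :=
  MvPolynomial.eval (perpPoint (fun i => Real.sqrt (t i)) θL θP) (T.comp (k, j))

/-! ### Measures and weights -/

/-- The angles with given cosines. -/
def angles {ι : Type} (c : ι → ℝ) : ι → ℝ := fun i => Real.arccos (c i)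

/-- `∏ dλ_ii` over `(0, ∞)`. -/
def radialMeasure (l : ℕ) : Measure (Fin l → ℝ) :=
  volume.restrict {t | ∀ i, 0 < t i}

/-- `∏ d cos θ_i` over `[-1, 1]`. -/
def cosMeasure (ι : Type) [Fintype ι] : Measure (ι → ℝ) :=
  volume.restrict {c | ∀ i, c i ∈ Set.Icc (-1 : ℝ) 1}

/-- `∏_{i ≤ j} dλ_ij` over the Gram (that is, positive semidefinite symmetric) matrices. -/
def gramMeasure (l : ℕ) : Measure (SymIdx l → ℝ) :=
  volume.restrict {u | (symMatrix u).PosSemidef}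

/-- `∏_i λ_ii^{(D-2)/2} ∏_{1≤i<j≤l} (sin θ_ij)^{D-2-i}`. -/
def lamWeight {l : ℕ} (D : ℂ) (t : Fin l → ℝ) (θL : LamIdx l → ℝ) : ℂ :=
  (∏ i, ((t i : ℝ) : ℂ) ^ ((D - 2) / 2)) *
    ∏ p : LamIdx l, ((Real.sin (θL p) : ℝ) : ℂ) ^ (D - 2 - (((p.1.1 : ℕ) : ℂ) + 1))

/-- `∏_{i=1}^{κ} ∏_{j=1}^{l} (sin θ_{i+j-1,j})^{D-i-j-1}`. -/
def perpWeight {l κ : ℕ} (D : ℂ) (θP : PerpIdx l κ → ℝ) : ℂ :=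
  ∏ p : PerpIdx l κ,
    ((Real.sin (θP p) : ℝ) : ℂ) ^ (D - (((p.1 : ℕ) : ℂ) + 1) - (((p.2 : ℕ) : ℂ) + 1) - 1)

/-- `[G(λ_ij)]^{(D-1-l)/2}`. -/
def gramWeight {l : ℕ} (D : ℂ) (u : SymIdx l → ℝ) : ℂ :=
  (((symMatrix u).det : ℝ) : ℂ) ^ ((D - 1 - (l : ℂ)) / 2)

/-- `Ω_z = 2 π^{(z+1)/2} / Γ((z+1)/2)`. -/
def solidAngle (z : ℂ) : ℂ :=
  2 * (Real.pi : ℂ) ^ ((z + 1) / 2) / Complex.Gamma ((z + 1) / 2)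

/-- `Ω_d^{(l)} = ∏_{i=1}^{l} Ω_{d-4-i} / (2 π^{d/2})`. -/
def prefactor (l : ℕ) (d : ℂ) : ℂ :=
  ∏ i : Fin l, solidAngle (d - 4 - (((i : ℕ) : ℂ) + 1)) / (2 * (Real.pi : ℂ) ^ (d / 2))

/-- Lebesgue measure of a subspace of a Euclidean space. -/
def subspaceVolume {N : ℕ} (S : Submodule ℝ (EuclideanSpace ℝ (Fin N))) : Measure S :=
  (stdOrthonormalBasis ℝ S).toBasis.addHaar

/-! ### Feynman integrals -/

/-- The four-dimensional physical space. -/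
abbrev Phys : Type := EuclideanSpace ℝ (Fin 4)

/-- The data of an `l`-loop integral with `dp` independent external momenta `p_i` in the physical
space and `r` denominators `D_j = (∑ α_ij q_i + ∑ β_ij p_i)² + m_j²`, `α_ij, β_ij ∈ {0, ±1}`, with a
numerator that is a polynomial in the components of the `q_[4]i` and in the `μ_ij`. -/
structure LoopIntegral (dp l r : ℕ) where
  p : Fin dp → Phys
  indep : LinearIndependent ℝ p
  α : Fin l → Fin r → SignType
  β : Fin dp → Fin r → SignType
  mass : Fin r → ℝ
  num : MvPolynomial ((Fin 4 × Fin l) ⊕ (Fin l × Fin l)) ℂ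

namespace LoopIntegral

variable {dp l r : ℕ} (I : LoopIntegral dp l r)

/-- The parallel space, spanned by the external momenta. -/
abbrev par : Submodule ℝ Phys := Submodule.span ℝ (Set.range I.p)

/-- The numerator, for given physical components `Q_i` and given scalar products `M_ij` of the
components orthogonal to the physical space. -/
def numAt (Q : Fin l → Phys) (M : Matrix (Fin l) (Fin l) ℝ) : ℂ :=
  MvPolynomial.eval
    (Sum.elim (fun x : Fin 4 × Fin l => ((Q x.2 x.1 : ℝ) : ℂ))
      (fun x : Fin l × Fin l => ((M x.1 x.2 : ℝ) : ℂ))) I.num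

/-- `(∑_i α_ij Q_i + ∑_i β_ij p_i)² + ∑_{i,k} α_ij α_kj G_ik + m_j²`. -/
def den (Q : Fin l → Phys) (G : Matrix (Fin l) (Fin l) ℝ) (j : Fin r) : ℝ :=
  ‖∑ i, ((I.α i j : SignType) : ℝ) • Q i + ∑ i, ((I.β i j : SignType) : ℝ) • I.p i‖ ^ 2
    + ∑ i, ∑ k, ((I.α i j : SignType) : ℝ) * ((I.α k j : SignType) : ℝ) * G i k
    + I.mass j ^ 2

/-- A basis `e_1, …, e_4` of the physical space with `e_1, …, e_dp` in the parallel space and the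
other vectors orthonormal and orthogonal to the external momenta. -/
def IsAdapted (e : Module.Basis (Fin 4) ℝ Phys) : Prop :=
  (∀ j : Fin 4, (j : ℕ) < dp → e j ∈ I.par) ∧
  (∀ j : Fin 4, dp ≤ (j : ℕ) → ∀ i, ⟪e j, I.p i⟫ = 0) ∧
  (∀ i j : Fin 4, dp ≤ (i : ℕ) → dp ≤ (j : ℕ) → ⟪e i, e j⟫ = if i = j then 1 else 0)

/-! #### The integral in an integer number of dimensions -/

section Integer

variable {d : ℕ} (ι : Phys →ₗᵢ[ℝ] EuclideanSpace ℝ (Fin d))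
  (q : Fin l → EuclideanSpace ℝ (Fin d))

/-- `D_j(q_1, …, q_l)`. The physical space sits in `ℝ^d` through the isometry `ι`. -/
def denD (j : Fin r) : ℝ :=
  ‖∑ i, ((I.α i j : SignType) : ℝ) • q i + ∑ i, ((I.β i j : SignType) : ℝ) • ι (I.p i)‖ ^ 2
    + I.mass j ^ 2

/-- The physical part `q_[4]` of a vector of `ℝ^d`. -/
def physPart (x : EuclideanSpace ℝ (Fin d)) : Phys :=
  ContinuousLinearMap.adjoint ι.toContinuousLinearMap x

/-- The scalar products `μ_ij` of the `μ_i = q_i - q_[4]i`. -/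
def muGram : Matrix (Fin l) (Fin l) ℝ :=
  fun i j => ⟪q i - ι (physPart ι (q i)), q j - ι (physPart ι (q j))⟫

/-- `q_∥`, the component of a vector of `ℝ^d` in the parallel space. -/
def parPart (x : EuclideanSpace ℝ (Fin d)) : I.par :=
  I.par.orthogonalProjectionOnto (physPart ι x)

/-- The scalar products `λ_ij` of the `λ_i = q_i - q_∥i`. -/
def lamGram : Matrix (Fin l) (Fin l) ℝ :=
  fun i j => ⟪q i - ι (I.parPart ι (q i)), q j - ι (I.parPart ι (q j))⟫

/-- `π^{-l d/2} N(q) / ∏_j D_j(q)`. -/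
def integrandD : ℂ :=
  (∏ _i : Fin l, 1 / (Real.pi : ℂ) ^ ((d : ℂ) / 2)) *
    (I.numAt (fun i => physPart ι (q i)) (muGram ι q) / ∏ j, ((I.denD ι q j : ℝ) : ℂ))

/-- The Feynman integral in `d` dimensions. -/
def integralD : ℂ :=
  ∫ q : Fin l → EuclideanSpace ℝ (Fin d), I.integrandD ι q

end Integer

/-! #### The integral in a complex number of dimensions -/

/-- The integrand of the `d = 4 - 2ε` parametrization, in the variables `q_[4]i` and `μ_ij`. -/
def integrandDimReg (d : ℂ) (z : (Fin l → Phys) × (SymIdx l → ℝ)) : ℂ :=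
  gramWeight (d - 4) z.2 *
    (I.numAt z.1 (symMatrix z.2) / ∏ j, ((I.den z.1 (symMatrix z.2) j : ℝ) : ℂ))

def measureDimReg (l : ℕ) : Measure ((Fin l → Phys) × (SymIdx l → ℝ)) :=
  (volume : Measure (Fin l → Phys)).prod (gramMeasure l)

/-- The dimensionally regularized integral in `d ∈ ℂ` dimensions. -/
def integralDimReg (d : ℂ) : ℂ :=
  prefactor l d * ∫ z, I.integrandDimReg d z ∂(measureDimReg l)

/-! #### The parametrization by parallel, radial and angular variables -/

/-- The numerator as a function of `q_∥i`, `Λ = (λ_ii, Θ_Λ)` and `Θ_⊥`. -/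
def numPar (T : PolyMap l (4 - dp)) (e : Module.Basis (Fin 4) ℝ Phys) (Q : Fin l → I.par)
    (t : Fin l → ℝ) (θL : LamIdx l → ℝ) (θP : PerpIdx l (4 - dp) → ℝ) : ℂ :=
  I.numAt
    (fun i => (Q i : Phys) + ∑ k : Fin (4 - dp), T.perpComp t θL θP k i • e ⟨dp + k, by omega⟩)
    (fun i j => T.lamMatrix t θL i j - ∑ k, T.perpComp t θL θP k i * T.perpComp t θL θP k j)

/-- The denominators as functions of `q_∥i` and `Λ = (λ_ii, Θ_Λ)` alone. -/
def denPar (T : PolyMap l (4 - dp)) (Q : Fin l → I.par) (t : Fin l → ℝ) (θL : LamIdx l → ℝ)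
    (j : Fin r) : ℝ :=
  I.den (fun i => (Q i : Phys)) (T.lamMatrix t θL) j

/-- The integrand with its weights, as a function of `q_∥i`, `λ_ii` and the cosines of `Θ_Λ` and
`Θ_⊥`, in transverse dimension `d_⊥ = d - dp`. -/
def integrandPar (T : PolyMap l (4 - dp)) (e : Module.Basis (Fin 4) ℝ Phys) (d : ℂ)
    (Q : Fin l → I.par) (t : Fin l → ℝ) (cL : LamIdx l → ℝ) (cP : PerpIdx l (4 - dp) → ℝ) : ℂ :=
  lamWeight (d - dp) t (angles cL) * perpWeight (d - dp) (angles cP) *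
    (I.numPar T e Q t (angles cL) (angles cP) /
      ∏ j, ((I.denPar T Q t (angles cL) j : ℝ) : ℂ))

/-- `∏_i d^{dp} q_∥i`. -/
def parMeasure : Measure (Fin l → I.par) := Measure.pi fun _ => subspaceVolume I.par

def measurePar : Measure ((Fin l → I.par) × (Fin l → ℝ) × (LamIdx l → ℝ) ×
    (PerpIdx l (4 - dp) → ℝ)) :=
  I.parMeasure.prod ((radialMeasure l).prod
    ((cosMeasure (LamIdx l)).prod (cosMeasure (PerpIdx l (4 - dp)))))

/-- Absolute convergence of the parametrized integral. -/
def IntegrablePar (T : PolyMap l (4 - dp)) (e : Module.Basis (Fin 4) ℝ Phys) (d : ℂ) : Prop :=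
  Integrable (fun z : (Fin l → I.par) × (Fin l → ℝ) × (LamIdx l → ℝ) ×
    (PerpIdx l (4 - dp) → ℝ) => I.integrandPar T e d z.1 z.2.1 z.2.2.1 z.2.2.2) I.measurePar

/-- `Ω_d^{(l)} ∫ ∏ d^{dp} q_∥i ∫ dΛ ∫ dΘ_⊥ N(q_∥, Λ, Θ_⊥) / ∏ D_j(q_∥, Λ)`. -/
def integralPar (T : PolyMap l (4 - dp)) (e : Module.Basis (Fin 4) ℝ Phys) (d : ℂ) : ℂ :=
  prefactor l d *
    ∫ Q, ∫ t, ∫ cL, ∫ cP, I.integrandPar T e d Q t cL cP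
      ∂(cosMeasure (PerpIdx l (4 - dp))) ∂(cosMeasure (LamIdx l)) ∂(radialMeasure l) ∂I.parMeasure

end LoopIntegral

end FeynmanPar

end

/-!
Fix orthonormal vectors `v_0, …, v_{κ-1}` transverse to the external momenta and let
`λ_0, …, λ_{l-1}` be the transverse parts of the loop momenta. In the frame obtained from the first
`j` Gram–Schmidt processes, `λ_j` is given by spherical coordinates, and the transition from one
frame to the next has coefficients which are polynomial in the sines and cosines of the angles in
column `j`. Iterating the transition gives the polynomial map `nestedMap`; that it computes scalar
products and components of actual vectors is `nestedMap_isNestedSpherical`.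

The analytic part rests on one square matrix, `coordMatrix`: its rows are the coordinates of
`v_0, …, v_{κ-1}, λ_0, …, λ_{l-1}` in the last frame. It is a rearranged triangular matrix, so its
determinant is a product of radii and sines (`abs_det_coordMatrix`), and its product with its
transpose is the Gram matrix of these vectors (`coordMatrix_mul_transpose`). If one more vector is
added, its scalar products `w` with the earlier vectors are a linear image under `coordMatrix` of
its first coordinates, and its square `t` completes a positive definite Gram matrix exactly when
those coordinates lie in the open ball of radius `√t`; spherical coordinates in this ball are the
angles of the new column. Induction on the number of vectors yields the change of variables
`lintegral_bigMap`. Shearing away `∑_k a_ki a_kj`, it says that the map from `λ_ii`, `cos Θ_Λ`,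
`cos Θ_⊥` to the transverse components `a_kj` and the remaining `μ_ij` carries an explicit density
with integer exponents to Lebesgue measure times the measure on Gram matrices
(`map_perpMap_withDensity`). As `det (μ_ij)` is a product of powers of the same factors, complex
powers of it only change the exponents (`lamWeight_mul_perpWeight`), so absolute convergence and
values of integrals can be compared for every complex dimension. The case `κ = 0` is the statement
on the integral over `Λ` (`integral_gram_eq`). For `κ = 4 - dp`, together with the orthogonal
decomposition of the physical space into parallel and transverse part, it is the parametrization in
a complex number of dimensions (`LoopIntegral.IsAdapted.dimReg`); the denominators do not see the
angles `Θ_⊥` because the transverse components can be moved into the Gram matrix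
(`LoopIntegral.den_add`).

In an integer number of dimensions, the scalar products of `l` vectors of `ℝ^M`, `M = d - 4 ≥ l`,
are distributed with density proportional to `det^{(M-1-l)/2}` (`lintegral_gramPoint`). This is
again an induction on the number of vectors: a new vector is split into its component in the span
of the earlier ones and an orthogonal remainder, to which polar coordinates apply
(`lintegral_inner_norm_sq`); the areas of the spheres multiply up to the prefactor `Ω_d^{(l)}`.
Hence the integral over `ℝ^d` is the dimensionally regularized one
(`LoopIntegral.integrable_and_integral_integer`).
-/

open MeasureTheory
open scoped RealInnerProductSpace

noncomputable section

namespace FeynmanPar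

/-! ### Coordinates in the nested frames -/

section Coordinates

variable {R : Type*} [CommRing R]

/-- The scalar product `∑_{k ≤ i < k + n} w_i c_i ∏_{k ≤ p < i} s_p` of the coordinate sequence `w`
with the unit vector whose spherical angles, starting in direction `k`, have cosines `c` and
sines `s`. -/
def tailDot (c s w : ℕ → R) : ℕ → ℕ → R
  | _, 0 => 0
  | k, n + 1 => c k * w k + s k * tailDot c s w (k + 1) n

/-- The coordinates, with respect to the next frame, of a vector with coordinates `w` (vanishing
from `N` on) in the current frame, when the current column of angles has cosines `c` and
sines `s`. -/
def nextCoord (c s w : ℕ → R) (N : ℕ) : ℕ → R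
  | 0 => tailDot c s w 0 N
  | k + 1 => s k * w k - c k * tailDot c s w (k + 1) (N - (k + 1))

/-- `frameCoord c s r l a b` is coordinate `b` in frame `l` of vector number `a`, where the vectors
known at stage `l` are listed as `λ_{l-1}, …, λ_0, v_0, v_1, …`; `c` and `s` are the cosines and
sines of the nested angles (row, column) and `r` the norms of the `λ_j`. With this order the
coordinates form a lower triangular array. -/
def frameCoord (c s : ℕ → ℕ → R) (r : ℕ → R) : ℕ → ℕ → ℕ → R
  | 0, a => fun b => if b = a then 1 else 0
  | l + 1, 0 => fun b => if b = 0 then r l else 0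
  | l + 1, a + 1 => nextCoord (fun p => c p l) (fun p => s p l) (frameCoord c s r l a) (a + 1)

theorem tailDot_eq_sum (c s w : ℕ → R) (k n : ℕ) :
    tailDot c s w k n =
      ∑ i ∈ Finset.range n, w (k + i) * (c (k + i) * ∏ p ∈ Finset.range i, s (k + p)) := by
  induction n generalizing k with
  | zero => simp [tailDot]
  | succ n ih =>
    rw [tailDot, ih, Finset.sum_range_succ', Finset.mul_sum, add_comm]
    congr 1
    · refine Finset.sum_congr rfl fun i _ => ?_
      rw [Finset.prod_range_succ']
      simp only [show ∀ x, k + 1 + x = k + (x + 1) by intro x; ring, add_zero]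
      ring
    · simp [mul_comm]

theorem tailDot_of_support {c s w : ℕ → R} {k n : ℕ} (h : ∀ i, k + n ≤ i → w i = 0)
    {n' : ℕ} (hn : n ≤ n') : tailDot c s w k n' = tailDot c s w k n := by
  rw [tailDot_eq_sum, tailDot_eq_sum]
  symm
  refine Finset.sum_subset (by simpa using hn) fun i _ hi => ?_
  rw [h (k + i) (by simp at hi; omega), zero_mul]

theorem nextCoord_of_support {c s w : ℕ → R} {N : ℕ} (h : ∀ i, N ≤ i → w i = 0)
    {N' : ℕ} (hn : N ≤ N') : nextCoord c s w N' = nextCoord c s w N := by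
  funext k
  cases k with
  | zero => exact tailDot_of_support (by simpa using h) hn
  | succ k =>
    simp only [nextCoord]
    rw [tailDot_of_support (n := N - (k + 1)) (fun i hi => h i (by omega)) (by omega)]

theorem nextCoord_support {c s w : ℕ → R} {N : ℕ} (h : ∀ i, N ≤ i → w i = 0) (i : ℕ)
    (hi : N < i) : nextCoord c s w N i = 0 := by
  obtain ⟨i, rfl⟩ : ∃ j, i = j + 1 := ⟨i - 1, by omega⟩
  simp [nextCoord, h i (by omega), show N - (i + 1) = 0 by omega, tailDot]

theorem frameCoord_support (c s : ℕ → ℕ → R) (r : ℕ → R) (l a b : ℕ) (h : a < b) :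
    frameCoord c s r l a b = 0 := by
  induction l generalizing a b with
  | zero => simp [frameCoord, h.ne']
  | succ l ih =>
    cases a with
    | zero => simp [frameCoord, (show b ≠ 0 by omega)]
    | succ a =>
      exact nextCoord_support (fun i hi => ih a i (by omega)) b h

theorem frameCoord_succ_succ (c s : ℕ → ℕ → R) (r : ℕ → R) (l a : ℕ) {N : ℕ} (h : a < N) :
    frameCoord c s r (l + 1) (a + 1) =
      nextCoord (fun p => c p l) (fun p => s p l) (frameCoord c s r l a) N :=
  (nextCoord_of_support (fun i hi => frameCoord_support c s r l a i (by omega)) (by omega)).symm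

/-- Passing to the next frame is an orthogonal transformation. -/
theorem sum_nextCoord_mul {c s : ℕ → R} {N : ℕ} (hcs : ∀ p < N, c p ^ 2 + s p ^ 2 = 1)
    (w w' : ℕ → R) :
    ∑ b ∈ Finset.range (N + 1), nextCoord c s w N b * nextCoord c s w' N b =
      ∑ b ∈ Finset.range N, w b * w' b := by
  have key : ∀ n k, k + n ≤ N → (∑ i ∈ Finset.range n,
        (s (k + i) * w (k + i) - c (k + i) * tailDot c s w (k + i + 1) (n - (i + 1))) *
          (s (k + i) * w' (k + i) - c (k + i) * tailDot c s w' (k + i + 1) (n - (i + 1)))) +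
        tailDot c s w k n * tailDot c s w' k n =
      ∑ i ∈ Finset.range n, w (k + i) * w' (k + i) := by
    intro n
    induction n with
    | zero => simp [tailDot]
    | succ n ih =>
      intro k hk
      have h1 := ih (k + 1) (by omega)
      rw [Finset.sum_range_succ', Finset.sum_range_succ']
      simp only [show ∀ x, k + 1 + x = k + (x + 1) by intro x; ring] at h1
      simp only [Nat.reduceSubDiff, Nat.add_sub_cancel, add_zero, zero_add, tailDot]
      rw [← h1]
      linear_combination (w k * w' k +
        tailDot c s w (k + 1) n * tailDot c s w' (k + 1) n) * hcs k (by omega)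
  have := key N 0 (by omega)
  simp only [zero_add] at this
  rw [Finset.sum_range_succ', ← this]
  rfl

theorem sum_frameCoord_succ_mul {c s : ℕ → ℕ → R} {l N : ℕ}
    (hcs : ∀ p < N, c p l ^ 2 + s p l ^ 2 = 1) (r : ℕ → R) (a a' : ℕ) (ha : a < N) (ha' : a' < N) :
    ∑ b ∈ Finset.range (N + 1),
        frameCoord c s r (l + 1) (a + 1) b * frameCoord c s r (l + 1) (a' + 1) b =
      ∑ b ∈ Finset.range N, frameCoord c s r l a b * frameCoord c s r l a' b := by
  rw [frameCoord_succ_succ c s r l a ha, frameCoord_succ_succ c s r l a' ha']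
  exact sum_nextCoord_mul hcs _ _

theorem frameCoord_diag (c s : ℕ → ℕ → R) (r : ℕ → R) (l a : ℕ) :
    frameCoord c s r (l + 1) (a + 1) (a + 1) = s a l * frameCoord c s r l a a := by
  simp [frameCoord, nextCoord, tailDot]

theorem prod_frameCoord_diag (c s : ℕ → ℕ → R) (r : ℕ → R) (κ l : ℕ) :
    ∏ a ∈ Finset.range (l + κ), frameCoord c s r l a a =
      ∏ j ∈ Finset.range l, (r j * ∏ p ∈ Finset.range (j + κ), s p j) := by
  induction l with
  | zero => simp [frameCoord]
  | succ l ih =>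
    rw [add_right_comm, Finset.prod_range_succ', Finset.prod_range_succ, ← ih]
    simp only [frameCoord_diag, Finset.prod_mul_distrib]
    simp [frameCoord]
    ring

theorem tailDot_congr {c s w c' s' w' : ℕ → R} {k n : ℕ}
    (hc : ∀ p, p < k + n → c p = c' p) (hs : ∀ p, p < k + n → s p = s' p)
    (hw : ∀ p, w p = w' p) : tailDot c s w k n = tailDot c' s' w' k n := by
  induction n generalizing k with
  | zero => rfl
  | succ n ih =>
    rw [tailDot, tailDot, hc k (by omega), hs k (by omega), hw k,
      ih (fun p hp => hc p (by omega)) (fun p hp => hs p (by omega))]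

/-- The coordinates of vector number `a` at stage `l` depend only on the first rows of angles:
in column `j` the rows `p` with `p + l ≤ a + j`. -/
theorem frameCoord_congr {c s c' s' : ℕ → ℕ → R} {r r' : ℕ → R} {l a : ℕ}
    (hc : ∀ p j, j < l → p + l ≤ a + j → c p j = c' p j)
    (hs : ∀ p j, j < l → p + l ≤ a + j → s p j = s' p j) (hr : ∀ j, j < l → r j = r' j) :
    frameCoord c s r l a = frameCoord c' s' r' l a := by
  induction l generalizing a with
  | zero => rfl
  | succ l ih =>
    cases a with
    | zero => simp [frameCoord, hr l (by omega)]
    | succ a =>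
      have hih := ih (a := a) (fun p j hj hp => hc p j (by omega) (by omega))
        (fun p j hj hp => hs p j (by omega) (by omega)) (fun j hj => hr j (by omega))
      have hc' : ∀ p, p < a + 1 → c p l = c' p l := fun p hp => hc p l (by omega) (by omega)
      have hs' : ∀ p, p < a + 1 → s p l = s' p l := fun p hp => hs p l (by omega) (by omega)
      funext b
      simp only [frameCoord]
      rw [hih]
      cases b with
      | zero =>
        simp only [nextCoord]
        exact tailDot_congr (fun p hp => hc' p (by omega)) (fun p hp => hs' p (by omega))
          (fun _ => rfl)
      | succ b =>
        simp only [nextCoord]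
        by_cases hb : b < a + 1
        · rw [hc' b hb, hs' b hb]
          congr 2
          exact tailDot_congr (fun p hp => hc' p (by omega)) (fun p hp => hs' p (by omega))
            (fun _ => rfl)
        · rw [frameCoord_support c' s' r' l a b (by omega), show a + 1 - (b + 1) = 0 by omega]
          simp [tailDot]

theorem map_tailDot {S : Type*} [CommRing S] (φ : R →+* S) (c s w : ℕ → R) (k n : ℕ) :
    φ (tailDot c s w k n) =
      tailDot (fun p => φ (c p)) (fun p => φ (s p)) (fun p => φ (w p)) k n := by
  induction n generalizing k with
  | zero => simp [tailDot]
  | succ n ih => simp [tailDot, ih]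

theorem map_frameCoord {S : Type*} [CommRing S] (φ : R →+* S) (c s : ℕ → ℕ → R) (r : ℕ → R)
    (l a b : ℕ) :
    φ (frameCoord c s r l a b) =
      frameCoord (fun p q => φ (c p q)) (fun p q => φ (s p q)) (fun p => φ (r p)) l a b := by
  induction l generalizing a b with
  | zero => simp only [frameCoord]; split_ifs <;> simp
  | succ l ih =>
    cases a with
    | zero => simp only [frameCoord]; split_ifs <;> simp
    | succ a =>
      cases b with
      | zero => simp only [frameCoord, nextCoord, map_tailDot, ih]
      | succ b => simp only [frameCoord, nextCoord, map_sub, map_mul, map_tailDot, ih]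

end Coordinates

/-! ### The polynomial substitution -/

/-- The function of row and column given by `F` on `Θ_Λ` and by `0` elsewhere. -/
def lamEntry {l : ℕ} {R : Type*} [Zero R] (F : LamIdx l → R) (p q : ℕ) : R :=
  if h : p < q ∧ q < l then F ⟨(⟨p, h.1.trans h.2⟩, ⟨q, h.2⟩), h.1⟩ else 0

/-- The function of row and column given by `F` on `Θ_Λ`, by `H` on `Θ_⊥` and by `0` elsewhere. -/
def allEntry {l κ : ℕ} {R : Type*} [Zero R] (F : LamIdx l → R) (H : PerpIdx l κ → R) (p q : ℕ) : R :=
  if p < q then lamEntry F p q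
  else if h : p - q < κ ∧ q < l then H (⟨p - q, h.1⟩, ⟨q, h.2⟩) else 0

/-- The sequence of norms, extended by `0`. -/
def radEntry {l : ℕ} {R : Type*} [Zero R] (F : Fin l → R) (q : ℕ) : R :=
  if h : q < l then F ⟨q, h⟩ else 0

/-- The change of variables by iterated Gram–Schmidt and nested spherical coordinates: the scalar
product of `λ_j` with an earlier vector is `|λ_j|` times coordinate `0` of that vector in the next
frame, whose first vector is the direction of `λ_j`. -/
def nestedMap (l κ : ℕ) : PolyMap l κ where
  offDiag p := MvPolynomial.X (Sum.inl p.1.2) *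
    frameCoord (lamEntry fun q => MvPolynomial.X (Sum.inr (Sum.inl q)))
      (lamEntry fun q => MvPolynomial.X (Sum.inr (Sum.inr q)))
      (radEntry fun j => MvPolynomial.X (Sum.inl j)) (p.1.2 + 1) (p.1.2 - p.1.1) 0
  comp p := MvPolynomial.X (Sum.inl (Sum.inl p.2)) *
    frameCoord
      (allEntry (fun q => MvPolynomial.X (Sum.inl (Sum.inr (Sum.inl q))))
        fun q => MvPolynomial.X (Sum.inr (Sum.inl q)))
      (allEntry (fun q => MvPolynomial.X (Sum.inl (Sum.inr (Sum.inr q))))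
        fun q => MvPolynomial.X (Sum.inr (Sum.inr q)))
      (radEntry fun j => MvPolynomial.X (Sum.inl (Sum.inl j))) (p.2 + 1) (p.1 + p.2 + 1) 0

theorem map_lamEntry {l : ℕ} {R S : Type*} [CommRing R] [CommRing S] (φ : R →+* S)
    (F : LamIdx l → R) (p q : ℕ) : φ (lamEntry F p q) = lamEntry (fun x => φ (F x)) p q := by
  unfold lamEntry; split_ifs <;> simp

theorem map_allEntry {l κ : ℕ} {R S : Type*} [CommRing R] [CommRing S] (φ : R →+* S)
    (F : LamIdx l → R) (H : PerpIdx l κ → R) (p q : ℕ) :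
    φ (allEntry F H p q) = allEntry (fun x => φ (F x)) (fun x => φ (H x)) p q := by
  unfold allEntry; split_ifs <;> simp [map_lamEntry]

theorem map_radEntry {l : ℕ} {R S : Type*} [CommRing R] [CommRing S] (φ : R →+* S)
    (F : Fin l → R) (q : ℕ) : φ (radEntry F q) = radEntry (fun x => φ (F x)) q := by
  unfold radEntry; split_ifs <;> simp

theorem allEntry_eq_lamEntry {l κ : ℕ} {R : Type*} [Zero R] (F : LamIdx l → R)
    (H : PerpIdx l κ → R) {p q : ℕ} (h : p < q) : allEntry F H p q = lamEntry F p q := by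
  simp [allEntry, h]

theorem lamEntry_mk {l : ℕ} {R : Type*} [Zero R] (F : LamIdx l → R) (p : LamIdx l) :
    lamEntry F p.1.1 p.1.2 = F p := by
  have h : ((p.1.1 : ℕ) < p.1.2) ∧ (p.1.2 : ℕ) < l := ⟨p.2, p.1.2.2⟩
  rw [lamEntry, dif_pos h]

theorem allEntry_lam {l κ : ℕ} {R : Type*} [Zero R] (F : LamIdx l → R) (H : PerpIdx l κ → R)
    (p : LamIdx l) : allEntry F H p.1.1 p.1.2 = F p := by
  rw [allEntry_eq_lamEntry _ _ p.2, lamEntry_mk]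

theorem allEntry_perp {l κ : ℕ} {R : Type*} [Zero R] (F : LamIdx l → R) (H : PerpIdx l κ → R)
    (p : PerpIdx l κ) : allEntry F H (p.1 + p.2) p.2 = H p := by
  simp [allEntry]

theorem radEntry_val {l : ℕ} {R : Type*} [Zero R] (F : Fin l → R) (q : Fin l) :
    radEntry F q = F q := by
  simp [radEntry]

theorem eval_offDiag {l κ : ℕ} (rad : Fin l → ℝ) (θL : LamIdx l → ℝ) (p : LamIdx l) :
    MvPolynomial.eval (lamPoint rad θL) ((nestedMap l κ).offDiag p) =
      rad p.1.2 * frameCoord (lamEntry fun q => Real.cos (θL q))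
        (lamEntry fun q => Real.sin (θL q)) (radEntry rad) (p.1.2 + 1) (p.1.2 - p.1.1) 0 := by
  simp only [nestedMap, map_mul, MvPolynomial.eval_X, map_frameCoord, map_lamEntry, map_radEntry,
    lamPoint, Sum.elim_inl, Sum.elim_inr]

theorem eval_comp {l κ : ℕ} (rad : Fin l → ℝ) (θL : LamIdx l → ℝ) (θP : PerpIdx l κ → ℝ)
    (p : PerpIdx l κ) :
    MvPolynomial.eval (perpPoint rad θL θP) ((nestedMap l κ).comp p) =
      rad p.2 * frameCoord (allEntry (fun q => Real.cos (θL q)) fun q => Real.cos (θP q))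
        (allEntry (fun q => Real.sin (θL q)) fun q => Real.sin (θP q))
        (radEntry rad) (p.2 + 1) (p.1 + p.2 + 1) 0 := by
  simp only [nestedMap, map_mul, MvPolynomial.eval_X, map_frameCoord, map_allEntry, map_radEntry,
    perpPoint, lamPoint, Sum.elim_inl, Sum.elim_inr]

/-! ### Gram–Schmidt and spherical coordinates -/

section Geometry

open InnerProductSpace

/-- A Gram–Schmidt vector is the only vector that is orthogonal to the earlier vectors of the list and
differs from the given one by an element of their span. -/
theorem gramSchmidt_eq_of_residual {E : Type*} [NormedAddCommGroup E] [InnerProductSpace ℝ E]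
    {m : ℕ} (f : Fin m → E) (n : Fin m) (x : E)
    (h1 : f n - x ∈ Submodule.span ℝ (f '' Set.Iio n)) (h2 : ∀ i < n, ⟪f i, x⟫ = 0) :
    gramSchmidt ℝ f n = x := by
  set S := Submodule.span ℝ (f '' Set.Iio n) with hS
  have h3 : f n - gramSchmidt ℝ f n ∈ S := by
    rw [hS, ← span_gramSchmidt_Iio ℝ f n]
    rw [show f n - gramSchmidt ℝ f n = _ from sub_eq_of_eq_add' (gramSchmidt_def' ℝ f n)]
    refine Submodule.sum_mem _ fun i hi => ?_
    have : ((ℝ ∙ gramSchmidt ℝ f i).starProjection (f n)) ∈ (ℝ ∙ gramSchmidt ℝ f i) :=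
      Submodule.starProjection_apply_mem _ _
    refine Submodule.span_mono ?_ this
    rintro _ rfl
    exact ⟨i, by simpa using hi, rfl⟩
  have hd : gramSchmidt ℝ f n - x ∈ S := by
    have := S.sub_mem h1 h3
    simpa using this
  have ho : gramSchmidt ℝ f n - x ∈ Sᗮ := by
    refine Submodule.sub_mem _ ?_ ?_
    · rw [hS, ← span_gramSchmidt_Iio ℝ f n, Submodule.mem_orthogonal]
      intro u hu
      induction hu using Submodule.span_induction with
      | mem y hy =>
        obtain ⟨i, hi, rfl⟩ := hy
        exact gramSchmidt_orthogonal ℝ f (ne_of_lt hi)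
      | zero => simp
      | add y z _ _ hy hz => rw [inner_add_left, hy, hz, add_zero]
      | smul a y _ hy => rw [inner_smul_left, hy, mul_zero]
    · rw [hS, Submodule.mem_orthogonal]
      intro u hu
      induction hu using Submodule.span_induction with
      | mem y hy =>
        obtain ⟨i, hi, rfl⟩ := hy
        exact h2 i hi
      | zero => simp
      | add y z _ _ hy hz => rw [inner_add_left, hy, hz, add_zero]
      | smul a y _ hy => rw [inner_smul_left, hy, mul_zero]
  have := Submodule.inner_right_of_mem_orthogonal hd ho
  rw [inner_self_eq_zero] at this
  exact sub_eq_zero.1 this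

/-- Every vector has spherical coordinates. -/
theorem exists_spherical (m : ℕ) (x : ℕ → ℝ) (R : ℝ) (hR : 0 ≤ R)
    (hx : R ^ 2 = ∑ k ∈ Finset.range (m + 2), x k ^ 2) :
    ∃ θ : ℕ → ℝ, (∀ i, i + 2 < m + 2 → θ i ∈ Set.Icc 0 Real.pi) ∧
      (∀ i, i + 2 = m + 2 → θ i ∈ Set.Ico 0 (2 * Real.pi)) ∧
      ∀ k < m + 2, x k = sphComp (m + 2) R θ k := by
  induction m generalizing x R with
  | zero =>
    have hx' : R ^ 2 = x 0 ^ 2 + x 1 ^ 2 := by simpa [Finset.sum_range_succ] using hx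
    set z : ℂ := ⟨x 0, x 1⟩
    have hz : ‖z‖ = R := by
      rw [← Real.sqrt_sq hR, hx', Complex.norm_eq_sqrt_sq_add_sq]
    have hp : 0 < 2 * Real.pi := by positivity
    obtain ⟨n, hn⟩ : ∃ n : ℤ, toIcoMod hp 0 z.arg = z.arg - n * (2 * Real.pi) :=
      ⟨toIcoDiv hp 0 z.arg, by rw [toIcoMod]; simp⟩
    refine ⟨fun _ => toIcoMod hp 0 z.arg, by intro i hi; omega, ?_, ?_⟩
    · intro i _
      have := toIcoMod_mem_Ico hp 0 z.arg
      simpa using this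
    · intro k hk
      interval_cases k
      · simp only [sphComp, hn, Real.cos_sub_int_mul_two_pi]
        rw [← hz]
        simp [z]
      · simp only [sphComp, hn, Finset.prod_range_one, Real.sin_sub_int_mul_two_pi]
        simp only [← hz]
        have := Complex.norm_mul_sin_arg z
        simp only [z] at this ⊢
        simp [this]
  | succ m ih =>
    rw [Finset.sum_range_succ'] at hx
    have hle : x 0 ^ 2 ≤ R ^ 2 := by
      rw [hx]
      have : 0 ≤ ∑ k ∈ Finset.range (m + 2), x (k + 1) ^ 2 :=
        Finset.sum_nonneg fun _ _ => sq_nonneg _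
      linarith
    have hcos : R * Real.cos (Real.arccos (x 0 / R)) = x 0 := by
      rcases hR.eq_or_lt with h0 | h0
      · have : x 0 = 0 := by
          rw [← h0] at hle
          have := sq_nonneg (x 0)
          exact pow_eq_zero_iff two_ne_zero |>.1 (by linarith)
        rw [this, ← h0]; simp
      · have habs := abs_le_of_sq_le_sq' hle hR
        rw [Real.cos_arccos]
        · field_simp
        · rw [le_div_iff₀ h0]; linarith
        · rw [div_le_iff₀ h0]; linarith
    set φ := Real.arccos (x 0 / R) with hφ
    have hs : 0 ≤ Real.sin φ := Real.sin_nonneg_of_nonneg_of_le_pi (Real.arccos_nonneg _)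
      (Real.arccos_le_pi _)
    obtain ⟨θ, h1, h2, h3⟩ := ih (fun k => x (k + 1)) (R * Real.sin φ) (mul_nonneg hR hs) (by
      have : (R * Real.sin φ) ^ 2 = R ^ 2 - (R * Real.cos φ) ^ 2 := by
        rw [mul_pow, mul_pow, Real.sin_sq]; ring
      rw [this, hcos, hx]; ring)
    obtain ⟨ψ, hψ0, hψ⟩ : ∃ ψ : ℕ → ℝ, ψ 0 = φ ∧ ∀ k, ψ (k + 1) = θ k :=
      ⟨fun k => Nat.casesOn k φ θ, rfl, fun _ => rfl⟩
    refine ⟨ψ, ?_, ?_, ?_⟩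
    · intro i hi
      cases i with
      | zero => exact hψ0 ▸ ⟨Real.arccos_nonneg _, Real.arccos_le_pi _⟩
      | succ i => exact hψ i ▸ h1 i (by omega)
    · intro i hi
      cases i with
      | zero => omega
      | succ i => exact hψ i ▸ h2 i (by omega)
    · intro k hk
      cases k with
      | zero => simp [sphComp, hψ0, hcos]
      | succ k =>
        rw [h3 k (by omega)]
        simp only [sphComp]
        rw [Finset.prod_range_succ']
        simp only [show (k + 1 + 1 < m + 1 + 2) = (k + 1 < m + 2) by simp, hψ0, hψ]
        ring

theorem tailDot_zero_add {R : Type*} [CommRing R] (c s w : ℕ → R) (a n : ℕ) :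
    tailDot c s w 0 (a + n) =
      tailDot c s w 0 a + (∏ i ∈ Finset.range a, s i) * tailDot c s w a n := by
  rw [tailDot_eq_sum, tailDot_eq_sum, tailDot_eq_sum, Finset.sum_range_add, Finset.mul_sum]
  congr 1
  refine Finset.sum_congr rfl fun i _ => ?_
  simp only [zero_add, Finset.prod_range_add]
  ring

variable {m : ℕ}

theorem exists_orthonormalBasis_eq {f : Fin m → EuclideanSpace ℝ (Fin m)}
    (hf : Orthonormal ℝ f) :
    ∃ B : OrthonormalBasis (Fin m) ℝ (EuclideanSpace ℝ (Fin m)), ∀ k, B k = f k :=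
  ⟨OrthonormalBasis.mk hf (hf.linearIndependent.span_eq_top_of_card_eq_finrank' (by simp)).ge,
    fun k => by simp⟩

/-- The coordinates of a vector with respect to a finite family, extended by `0`. -/
def coordSeq (f : Fin m → EuclideanSpace ℝ (Fin m)) (w : EuclideanSpace ℝ (Fin m)) (k : ℕ) : ℝ :=
  if h : k < m then ⟪f ⟨k, h⟩, w⟫ else 0

/-- A scalar product with a vector given by spherical coordinates, when the other vector has no
component in the last direction. -/
theorem inner_eq_tailDot {f : Fin m → EuclideanSpace ℝ (Fin m)} (hf : Orthonormal ℝ f)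
    {u w : EuclideanSpace ℝ (Fin m)} {φ : ℕ → ℝ} {R : ℝ}
    (hu : ∀ k : Fin m, ⟪f k, u⟫ = sphComp m R φ k) {n : ℕ} (hn : n < m)
    (hw : ∀ k, n ≤ k → coordSeq f w k = 0) :
    ⟪u, w⟫ = R * tailDot (fun p => Real.cos (φ p)) (fun p => Real.sin (φ p)) (coordSeq f w) 0 n := by
  obtain ⟨B, hB⟩ := exists_orthonormalBasis_eq hf
  rw [← B.sum_inner_mul_inner u w]
  have : ∀ k : Fin m, ⟪u, B k⟫ * ⟪B k, w⟫ =
      (fun k : ℕ => sphComp m R φ k * coordSeq f w k) k := by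
    intro k
    rw [hB, real_inner_comm, hu k]
    simp [coordSeq]
  rw [Finset.sum_congr rfl fun k _ => this k,
    Fin.sum_univ_eq_sum_range (fun k : ℕ => sphComp m R φ k * coordSeq f w k) m, tailDot_eq_sum,
    Finset.mul_sum]
  symm
  refine Finset.sum_subset_zero_on_sdiff (by simpa using hn.le) ?_ ?_
  · intro k hk
    simp only [Finset.mem_sdiff, Finset.mem_range, not_lt] at hk
    rw [hw k hk.2, mul_zero]
  · intro k hk
    have hk' : k + 1 < m := by have := Finset.mem_range.1 hk; omega
    simp only [sphComp, hk', if_true, zero_add]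
    ring

set_option maxHeartbeats 1000000 in
/-- One Gram–Schmidt step in coordinates. -/
theorem inner_gramSchmidtNormed_prepend {f : Fin m → EuclideanSpace ℝ (Fin m)}
    (hf : Orthonormal ℝ f) {u : EuclideanSpace ℝ (Fin m)} {φ : ℕ → ℝ}
    (hu : ∀ k : Fin m, ⟪f k, u⟫ = sphComp m ‖u‖ φ k)
    (hφ : ∀ i, i + 2 < m → φ i ∈ Set.Icc 0 Real.pi)
    (hli : LinearIndependent ℝ (prepend u f)) {w : EuclideanSpace ℝ (Fin m)} {n : ℕ}
    (hn : n + 1 < m) (hw : ∀ k, n ≤ k → coordSeq f w k = 0) (b : Fin m) :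
    ⟪gramSchmidtNormed ℝ (prepend u f) b, w⟫ =
      nextCoord (fun p => Real.cos (φ p)) (fun p => Real.sin (φ p)) (coordSeq f w) n b := by
  set c : ℕ → ℝ := fun p => Real.cos (φ p) with hc
  set s : ℕ → ℝ := fun p => Real.sin (φ p) with hs
  have hcs : ∀ p, c p ^ 2 + s p ^ 2 = 1 := fun p => Real.cos_sq_add_sin_sq (φ p)
  have h0m : 0 < m := by omega
  have huw := inner_eq_tailDot hf hu (by omega : n < m) hw
  have hp0 : prepend u f ⟨0, h0m⟩ = u := by simp [prepend]
  have hu0 : ‖u‖ ≠ 0 := by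
    have := hli.ne_zero ⟨0, h0m⟩
    rw [hp0] at this
    exact norm_ne_zero_iff.2 this
  obtain ⟨b, hb⟩ := b
  cases b with
  | zero =>
    have h1 : gramSchmidt ℝ (prepend u f) ⟨0, h0m⟩ = u := by
      refine gramSchmidt_eq_of_residual _ _ _ (by simp [hp0]) ?_
      intro i hi
      exact absurd hi (by simp [Fin.lt_def])
    simp only [gramSchmidtNormed, h1, nextCoord, RCLike.ofReal_real_eq_id, id_eq,
      real_inner_smul_left, huw]
    rw [← mul_assoc, inv_mul_cancel₀ hu0, one_mul]
  | succ a =>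
    let F : ℕ → EuclideanSpace ℝ (Fin m) := fun k => if h : k < m then f ⟨k, h⟩ else 0
    have hF : ∀ k (h : k < m), F k = f ⟨k, h⟩ := fun k h => by simp [F, h]
    have hFF : ∀ i < m, ∀ k < m, ⟪F i, F k⟫ = if i = k then (1 : ℝ) else 0 := by
      intro i hi k hk
      rw [hF i hi, hF k hk, orthonormal_iff_ite.1 hf]
      simp [Fin.ext_iff]
    have hFw : ∀ k, ⟪F k, w⟫ = coordSeq f w k := by
      intro k
      by_cases h : k < m <;> simp [F, coordSeq, h]
    let P : ℕ → ℝ := fun k => ∏ i ∈ Finset.range k, s i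
    have hFu : ∀ k, k + 1 < m → ⟪F k, u⟫ = ‖u‖ * (c k * P k) := by
      intro k hk
      rw [hF k (by omega), hu ⟨k, by omega⟩]
      simp only [sphComp, hk, if_true, mul_assoc]
      rfl
    -- the component of `u` orthogonal to the first `a` vectors of the family
    let res : EuclideanSpace ℝ (Fin m) :=
      u - ∑ k ∈ Finset.range a, (‖u‖ * (c k * P k)) • F k
    have hFres : ∀ k < m, ⟪F k, res⟫ = if k < a then 0 else ⟪F k, u⟫ := by
      intro k hk
      simp only [res, inner_sub_right, inner_sum, real_inner_smul_right]
      rw [Finset.sum_congr rfl fun i hi => by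
        rw [hFF k hk i (by have := Finset.mem_range.1 hi; omega)]]
      simp only [mul_ite, mul_one, mul_zero, Finset.sum_ite_eq, Finset.mem_range]
      split_ifs with h
      · rw [hFu k (by omega), sub_self]
      · simp
    have hPs : ∀ N, ∑ k ∈ Finset.range N, (c k * P k) ^ 2 = 1 - P N ^ 2 := by
      intro N
      induction N with
      | zero => simp [P]
      | succ N ih =>
        rw [Finset.sum_range_succ, ih]
        have : P (N + 1) = P N * s N := Finset.prod_range_succ _ _
        rw [this]
        linear_combination P N ^ 2 * hcs N
    have hures : ⟪u, res⟫ = (‖u‖ * P a) ^ 2 := by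
      simp only [res, inner_sub_right, inner_sum, real_inner_smul_right]
      rw [real_inner_self_eq_norm_sq, Finset.sum_congr rfl fun i hi => by
        rw [real_inner_comm, hFu i (by have := Finset.mem_range.1 hi; omega)]]
      have : ∑ i ∈ Finset.range a, ‖u‖ * (c i * P i) * (‖u‖ * (c i * P i)) =
          ‖u‖ ^ 2 * ∑ i ∈ Finset.range a, (c i * P i) ^ 2 := by
        rw [Finset.mul_sum]; exact Finset.sum_congr rfl fun i _ => by ring
      rw [this, hPs]; ring
    have hrr : ⟪res, res⟫ = (‖u‖ * P a) ^ 2 := by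
      conv_lhs => rw [show res = u - ∑ k ∈ Finset.range a, (‖u‖ * (c k * P k)) • F k from rfl]
      rw [inner_sub_left, sum_inner]
      rw [show u - ∑ k ∈ Finset.range a, (‖u‖ * (c k * P k)) • F k = res from rfl, hures]
      rw [Finset.sum_eq_zero, sub_zero]
      intro k hk
      have hk := Finset.mem_range.1 hk
      rw [real_inner_smul_left, hFres k (by omega), if_pos hk, mul_zero]
    have hps : ∀ k (h : k + 1 < m), prepend u f ⟨k + 1, h⟩ = F k := by
      intro k h
      rw [hF k (by omega)]
      simp [prepend]
    have hFspan : ∀ k < a, F k ∈ Submodule.span ℝ (prepend u f '' Set.Iio ⟨a + 1, hb⟩) := by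
      intro k hk
      rw [← hps k (by omega)]
      exact Submodule.subset_span ⟨_, by simp [hk], rfl⟩
    have hresspan : res ∈ Submodule.span ℝ (prepend u f '' Set.Iio ⟨a + 1, hb⟩) := by
      refine Submodule.sub_mem _ ?_ (Submodule.sum_mem _ fun k hk => Submodule.smul_mem _ _
        (hFspan k (Finset.mem_range.1 hk)))
      rw [← hp0]
      exact Submodule.subset_span ⟨_, by simp, rfl⟩
    have hPa : P a ≠ 0 := by
      intro h
      rw [h, mul_zero, zero_pow two_ne_zero, inner_self_eq_zero] at hrr
      have hmem : prepend u f ⟨0, h0m⟩ ∈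
          Submodule.span ℝ (prepend u f '' {i | i ≠ ⟨0, h0m⟩}) := by
        rw [hp0, show u = ∑ k ∈ Finset.range a, (‖u‖ * (c k * P k)) • F k from sub_eq_zero.1 hrr]
        refine Submodule.sum_mem _ fun k hk => Submodule.smul_mem _ _ ?_
        have hk := Finset.mem_range.1 hk
        rw [← hps k (by omega)]
        exact Submodule.subset_span ⟨⟨k + 1, by omega⟩, by simp [Fin.ext_iff], rfl⟩
      exact hli.notMem_span_image (s := {i | i ≠ ⟨0, h0m⟩}) (x := ⟨0, h0m⟩) (by simp) hmem
    let x : EuclideanSpace ℝ (Fin m) := F a - (c a / (‖u‖ * P a)) • res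
    have hgs : gramSchmidt ℝ (prepend u f) ⟨a + 1, hb⟩ = x := by
      refine gramSchmidt_eq_of_residual _ _ _ ?_ ?_
      · rw [hps a hb]
        simp only [x, sub_sub_cancel]
        exact Submodule.smul_mem _ _ hresspan
      · rintro ⟨i, hi⟩ hlt
        have hlt : i < a + 1 := hlt
        cases i with
        | zero =>
          rw [hp0]
          simp only [x, inner_sub_right, real_inner_smul_right, hures]
          rw [real_inner_comm, hFu a hb]
          field_simp
          ring
        | succ i =>
          rw [hps i hi]
          simp only [x, inner_sub_right, real_inner_smul_right]
          rw [hFres i (by omega), if_pos (by omega), hFF i (by omega) a (by omega),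
            if_neg (by omega)]
          simp
    have hFares : ⟪F a, res⟫ = ‖u‖ * (c a * P a) := by
      rw [hFres a (by omega), if_neg (lt_irrefl a), hFu a hb]
    have hxx : ‖x‖ = |s a| := by
      rw [← Real.sqrt_sq_eq_abs, ← Real.sqrt_sq (norm_nonneg x), ← real_inner_self_eq_norm_sq]
      congr 1
      simp only [x, inner_sub_left, inner_sub_right, real_inner_smul_left, real_inner_smul_right,
        hrr, hFF a (by omega) a (by omega), if_true, real_inner_comm (F a) res, hFares]
      field_simp
      linear_combination -(hcs a)
    have hresw : ⟪res, w⟫ = ‖u‖ * P a * tailDot c s (coordSeq f w) a (n - a) := by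
      simp only [res, inner_sub_left, sum_inner, real_inner_smul_left, hFw, huw]
      have h1 := tailDot_zero_add c s (coordSeq f w) a (n - a)
      have h2 : tailDot c s (coordSeq f w) 0 (a + (n - a)) = tailDot c s (coordSeq f w) 0 n :=
        tailDot_of_support (by simpa using hw) (by omega)
      have h3 : ∑ k ∈ Finset.range a, ‖u‖ * (c k * P k) * coordSeq f w k =
          ‖u‖ * tailDot c s (coordSeq f w) 0 a := by
        rw [tailDot_eq_sum, Finset.mul_sum]
        refine Finset.sum_congr rfl fun k _ => ?_
        simp only [zero_add, P]
        ring
      rw [h3, ← h2, h1]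
      simp only [P]
      ring
    simp only [gramSchmidtNormed, hgs, hxx, nextCoord, RCLike.ofReal_real_eq_id, id_eq,
      real_inner_smul_left]
    simp only [x, inner_sub_left, real_inner_smul_left, hresw, hFw]
    by_cases han : n ≤ a
    · rw [hw a han, show n - a = 0 by omega, show n - (a + 1) = 0 by omega]
      simp [tailDot]
    · obtain ⟨k, hk⟩ : ∃ k, n - a = k + 1 := ⟨n - a - 1, by omega⟩
      have hk' : n - (a + 1) = k := by omega
      have hsa : s a ≠ 0 := by
        have hxne := gramSchmidt_ne_zero (𝕜 := ℝ) ⟨a + 1, hb⟩ hli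
        rw [hgs, ← norm_ne_zero_iff, hxx] at hxne
        exact fun h => hxne (by simp [h])
      have hsa' : 0 ≤ s a := Real.sin_nonneg_of_mem_Icc (hφ a (by omega))
      rw [hk, hk', abs_of_nonneg hsa', tailDot]
      field_simp
      linear_combination -(coordSeq f w a) * hcs a

/-- The vectors known at stage `j`, listed as `λ_{j-1}, …, λ_0, v_0, v_1, …`. -/
def knownVec {l : ℕ} (v : Fin m → EuclideanSpace ℝ (Fin m))
    (lam : Fin l → EuclideanSpace ℝ (Fin m)) : ℕ → ℕ → EuclideanSpace ℝ (Fin m)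
  | 0, a => if h : a < m then v ⟨a, h⟩ else 0
  | j + 1, 0 => if h : j < l then lam ⟨j, h⟩ else 0
  | j + 1, a + 1 => knownVec v lam j a

theorem knownVec_lam {l : ℕ} (v : Fin m → EuclideanSpace ℝ (Fin m))
    (lam : Fin l → EuclideanSpace ℝ (Fin m)) (i : Fin l) (n : ℕ) :
    knownVec v lam (i + 1 + n) n = lam i := by
  induction n with
  | zero => simp [knownVec]
  | succ n ih => exact ih

theorem knownVec_basis {l : ℕ} (v : Fin m → EuclideanSpace ℝ (Fin m))
    (lam : Fin l → EuclideanSpace ℝ (Fin m)) (k : Fin m) (n : ℕ) :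
    knownVec v lam n (k + n) = v k := by
  induction n with
  | zero => simp [knownVec]
  | succ n ih => exact ih

theorem frame_orthonormal {l : ℕ} (v : OrthonormalBasis (Fin m) ℝ (EuclideanSpace ℝ (Fin m)))
    (lam : Fin l → EuclideanSpace ℝ (Fin m))
    (h : ∀ j : Fin l, (j : ℕ) + 1 < l → LinearIndependent ℝ (prepend (lam j) (frame v lam j)))
    (j : ℕ) (hj : j < l) : Orthonormal ℝ (frame v lam j) := by
  cases j with
  | zero => exact v.orthonormal
  | succ j =>
    have hlt : j < l := by omega
    have := gramSchmidtNormed_orthonormal (h ⟨j, hlt⟩ hj)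
    simpa [frame, hlt] using this

/-- The cosines or sines of nested angles as a function of row and column. -/
def trigEntry {l : ℕ} (F : ℝ → ℝ) (θ : ℕ → Fin l → ℝ) (p q : ℕ) : ℝ :=
  if h : q < l then F (θ p ⟨q, h⟩) else 0

/-- `frameCoord` does give the coordinates in the iterated Gram–Schmidt frames. -/
theorem inner_frame_knownVec {l : ℕ}
    (v : OrthonormalBasis (Fin m) ℝ (EuclideanSpace ℝ (Fin m)))
    (lam : Fin l → EuclideanSpace ℝ (Fin m))
    (h : ∀ j : Fin l, (j : ℕ) + 1 < l → LinearIndependent ℝ (prepend (lam j) (frame v lam j)))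
    (θ : ℕ → Fin l → ℝ) (hθ : IsNestedAngles v lam θ) (j : ℕ) (hj : j < l) (a : ℕ)
    (ha : a + 1 < m) (b : Fin m) :
    ⟪frame v lam j b, knownVec v lam j a⟫ =
      frameCoord (trigEntry Real.cos θ) (trigEntry Real.sin θ) (radEntry fun i => ‖lam i‖) j a b := by
  induction j generalizing a b with
  | zero =>
    have ha' : a < m := by omega
    simp only [frame, knownVec, frameCoord, dif_pos ha', orthonormal_iff_ite.1 v.orthonormal,
      Fin.ext_iff]
  | succ j ih =>
    have hlt : j < l := by omega
    have hli := h ⟨j, hlt⟩ hj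
    have hfr : frame v lam (j + 1) =
        gramSchmidtNormed ℝ (prepend (lam ⟨j, hlt⟩) (frame v lam j)) := by
      simp [frame, hlt]
    have hon := frame_orthonormal v lam h j hlt
    cases a with
    | zero =>
      have hon' := frame_orthonormal v lam h (j + 1) hj
      have h0m : 0 < m := by omega
      have hp0 : prepend (lam ⟨j, hlt⟩) (frame v lam j) ⟨0, h0m⟩ = lam ⟨j, hlt⟩ := by
        simp [prepend]
      have h1 : gramSchmidt ℝ (prepend (lam ⟨j, hlt⟩) (frame v lam j)) ⟨0, h0m⟩ =
          lam ⟨j, hlt⟩ := by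
        refine gramSchmidt_eq_of_residual _ _ _ (by simp [hp0]) ?_
        intro i hi
        exact absurd hi (by simp [Fin.lt_def])
      have hne : ‖lam ⟨j, hlt⟩‖ ≠ 0 := by
        have := hli.ne_zero ⟨0, h0m⟩
        rw [hp0] at this
        exact norm_ne_zero_iff.2 this
      have h2 : lam ⟨j, hlt⟩ = ‖lam ⟨j, hlt⟩‖ • frame v lam (j + 1) ⟨0, h0m⟩ := by
        rw [hfr, gramSchmidtNormed, h1]
        simp [smul_smul, hne]
      have h3 : knownVec v lam (j + 1) 0 = lam ⟨j, hlt⟩ := by simp [knownVec, hlt]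
      rw [h3, h2, real_inner_smul_right, orthonormal_iff_ite.1 hon']
      simp [frameCoord, radEntry, hlt, Fin.ext_iff]
    | succ a =>
      have hcoord : coordSeq (frame v lam j) (knownVec v lam j a) =
          frameCoord (trigEntry Real.cos θ) (trigEntry Real.sin θ)
            (radEntry fun i => ‖lam i‖) j a := by
        funext k
        by_cases hk : k < m
        · simp only [coordSeq, hk, dif_pos]
          exact ih hlt a (by omega) ⟨k, hk⟩
        · simp only [coordSeq, hk]
          rw [frameCoord_support _ _ _ _ _ _ (by omega)]
          simp
      have hstep := inner_gramSchmidtNormed_prepend (n := a + 1) hon (hθ ⟨j, hlt⟩).2.2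
        (hθ ⟨j, hlt⟩).1 hli (w := knownVec v lam j a) (by omega) (by
          intro k hk
          rw [hcoord]
          exact frameCoord_support _ _ _ _ _ _ (by omega)) b
      rw [hfr]
      show ⟪_, knownVec v lam j a⟫ = _
      rw [hstep, hcoord]
      simp only [frameCoord, trigEntry, hlt, dif_pos]

theorem inner_lam_knownVec {l : ℕ}
    (v : OrthonormalBasis (Fin m) ℝ (EuclideanSpace ℝ (Fin m)))
    (lam : Fin l → EuclideanSpace ℝ (Fin m))
    (h : ∀ j : Fin l, (j : ℕ) + 1 < l → LinearIndependent ℝ (prepend (lam j) (frame v lam j)))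
    (θ : ℕ → Fin l → ℝ) (hθ : IsNestedAngles v lam θ) (j : Fin l) (a : ℕ)
    (ha : a + 1 < m) :
    ⟪lam j, knownVec v lam j a⟫ = ‖lam j‖ *
      frameCoord (trigEntry Real.cos θ) (trigEntry Real.sin θ) (radEntry fun i => ‖lam i‖)
        (j + 1) (a + 1) 0 := by
  have hcoord : coordSeq (frame v lam j) (knownVec v lam j a) =
      frameCoord (trigEntry Real.cos θ) (trigEntry Real.sin θ)
        (radEntry fun i => ‖lam i‖) j a := by
    funext k
    by_cases hk : k < m
    · simp only [coordSeq, hk, dif_pos]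
      exact inner_frame_knownVec v lam h θ hθ j j.2 a ha ⟨k, hk⟩
    · simp only [coordSeq, hk]
      rw [frameCoord_support _ _ _ _ _ _ (by omega)]
      simp
  rw [inner_eq_tailDot (n := a + 1) (frame_orthonormal v lam h j j.2) (hθ j).2.2 (by omega) (by
    intro k hk
    rw [hcoord]
    exact frameCoord_support _ _ _ _ _ _ (by omega)), hcoord]
  simp [frameCoord, trigEntry, nextCoord]

/-- The polynomials in the sines and cosines of the angles compute scalar products and components of
actual vectors with given nested angles. -/
theorem nestedMap_isNestedSpherical (l κ : ℕ) (hκ : 1 ≤ κ) :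
    (nestedMap l κ).IsNestedSpherical := by
  intro m hm v lam h
  constructor
  · have : ∀ j : Fin l, ∃ φ : ℕ → ℝ, (∀ i, i + 2 < m → φ i ∈ Set.Icc 0 Real.pi) ∧
        (∀ i, i + 2 = m → φ i ∈ Set.Ico 0 (2 * Real.pi)) ∧
        ∀ k : Fin m, ⟪frame v lam j k, lam j⟫ = sphComp m ‖lam j‖ φ k := by
      intro j
      obtain ⟨m', rfl⟩ : ∃ m', m = m' + 2 := ⟨m - 2, by have := j.2; omega⟩
      have hon := frame_orthonormal v lam h j j.2
      obtain ⟨B, hB⟩ := exists_orthonormalBasis_eq hon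
      obtain ⟨φ, h1, h2, h3⟩ := exists_spherical m' (coordSeq (frame v lam j) (lam j)) ‖lam j‖
        (norm_nonneg _) (by
          rw [← real_inner_self_eq_norm_sq, ← B.sum_inner_mul_inner (lam j) (lam j),
            ← Fin.sum_univ_eq_sum_range]
          refine Finset.sum_congr rfl fun k _ => ?_
          rw [hB, real_inner_comm]
          simp [coordSeq, pow_two])
      refine ⟨φ, h1, h2, fun k => ?_⟩
      rw [← h3 k k.2]
      simp [coordSeq]
    choose φ h1 h2 h3 using this
    exact ⟨fun i j => φ j i, fun j => ⟨h1 j, h2 j, h3 j⟩⟩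
  · intro θ hθ
    constructor
    · rintro ⟨⟨i, j⟩, hij⟩
      have hij : i < j := hij
      have hij' : (i : ℕ) < j := hij
      rw [eval_offDiag]
      simp only
      obtain ⟨a, ha⟩ : ∃ a, (j : ℕ) = i + 1 + a := ⟨j - (i + 1), by omega⟩
      have hk := inner_lam_knownVec v lam h θ hθ j a (by have := j.2; omega)
      rw [show knownVec v lam j a = lam i by rw [ha]; exact knownVec_lam _ _ i a,
        real_inner_comm] at hk
      rw [hk, show (j : ℕ) - i = a + 1 by omega]
      congr 1
      refine congrFun (frameCoord_congr ?_ ?_ fun _ _ => rfl) 0 <;>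
      · intro p q hq hpq
        have hpq' : p < q ∧ q < l := ⟨by omega, by have := j.2; omega⟩
        simp [trigEntry, lamEntry, hpq']
    · intro k j
      rw [eval_comp]
      simp only
      have hk := inner_lam_knownVec v lam h θ hθ j (k + j) (by have := j.2; have := k.2; omega)
      rw [show knownVec v lam j (k + j) = v ⟨k, by omega⟩ from
        knownVec_basis v lam ⟨k, by omega⟩ j, real_inner_comm] at hk
      rw [hk]
      congr 1
      refine congrFun (frameCoord_congr ?_ ?_ fun _ _ => rfl) 0 <;>
      · intro p q hq hpq
        have hql : q < l := by have := j.2; omega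
        by_cases h1 : p < q
        · simp [trigEntry, allEntry, lamEntry, hql, h1]
        · have h2 : p - q < κ := by have := k.2; omega
          simp [trigEntry, allEntry, hql, h1, h2, show p - q + q = p by omega]

end Geometry

/-! ### Integration in spherical coordinates -/

section Spherical

open scoped ENNReal

/-- The density `(sin θ)^e` on `(-1, 1)` as a function of `c = cos θ`, extended by `0`. -/
def sinWeight (e : ℕ) (c : ℝ) : ℝ≥0∞ :=
  if c ∈ Set.Ioo (-1 : ℝ) 1 then ENNReal.ofReal (Real.sin (Real.arccos c) ^ e) else 0

/-- The density `t^{e/2}` on `(0, ∞)`, extended by `0`. -/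
def radWeight (e : ℕ) (t : ℝ) : ℝ≥0∞ :=
  if 0 < t then ENNReal.ofReal (Real.sqrt t ^ e) else 0

theorem sin_arccos_nonneg (c : ℝ) : 0 ≤ Real.sin (Real.arccos c) := by
  rw [Real.sin_arccos]; exact Real.sqrt_nonneg _

theorem sin_arccos_pos {c : ℝ} (hc : c ∈ Set.Ioo (-1 : ℝ) 1) : 0 < Real.sin (Real.arccos c) := by
  rw [Real.sin_arccos]
  exact Real.sqrt_pos.2 (by nlinarith [hc.1, hc.2])

theorem sinWeight_succ (e : ℕ) (c : ℝ) :
    sinWeight (e + 1) c = sinWeight e c * ENNReal.ofReal (Real.sin (Real.arccos c)) := by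
  unfold sinWeight
  split_ifs
  · rw [pow_succ, ENNReal.ofReal_mul (pow_nonneg (sin_arccos_nonneg c) _)]
  · simp

theorem radWeight_succ (e : ℕ) (t : ℝ) :
    radWeight (e + 1) t = radWeight e t * ENNReal.ofReal (Real.sqrt t) := by
  unfold radWeight
  split_ifs
  · rw [pow_succ, ENNReal.ofReal_mul (pow_nonneg (Real.sqrt_nonneg t) _)]
  · simp

theorem measurable_sinWeight (e : ℕ) : Measurable (sinWeight e) := by
  unfold sinWeight
  refine Measurable.ite measurableSet_Ioo ?_ measurable_const
  have := Real.continuous_arccos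
  fun_prop

theorem measurable_radWeight (e : ℕ) : Measurable (radWeight e) := by
  unfold radWeight
  refine Measurable.ite measurableSet_Ioi ?_ measurable_const
  fun_prop

/-- The vector of norm at most `ρ` whose spherical angles have cosines `c`. -/
def ballPoint {N : ℕ} (ρ : ℝ) (c : Fin N → ℝ) (i : Fin N) : ℝ :=
  ρ * (Real.cos (Real.arccos (c i)) *
    ∏ p ∈ Finset.range i, Real.sin (Real.arccos (radEntry c p)))

theorem measurable_radEntry {N : ℕ} (p : ℕ) : Measurable fun c : Fin N → ℝ => radEntry c p := by
  unfold radEntry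
  split_ifs
  · exact measurable_pi_apply _
  · exact measurable_const

theorem measurable_ballPoint {N : ℕ} (ρ : ℝ) :
    Measurable (ballPoint ρ : (Fin N → ℝ) → Fin N → ℝ) := by
  refine measurable_pi_lambda _ fun i => ?_
  unfold ballPoint
  have h := Real.continuous_arccos.measurable
  refine measurable_const.mul (Measurable.mul ?_ ?_)
  · exact Real.continuous_cos.measurable.comp (h.comp (measurable_pi_apply i))
  · exact Finset.measurable_prod _ fun p _ =>
      Real.continuous_sin.measurable.comp (h.comp (measurable_radEntry p))

theorem ballPoint_cons_zero {N : ℕ} (ρ a : ℝ) (c : Fin N → ℝ) :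
    ballPoint ρ (Fin.cons a c : Fin (N + 1) → ℝ) 0 = ρ * Real.cos (Real.arccos a) := by
  simp [ballPoint]

theorem ballPoint_cons_succ {N : ℕ} (ρ a : ℝ) (c : Fin N → ℝ) (i : Fin N) :
    ballPoint ρ (Fin.cons a c : Fin (N + 1) → ℝ) i.succ =
      ballPoint (ρ * Real.sin (Real.arccos a)) c i := by
  have h0 : radEntry (Fin.cons a c : Fin (N + 1) → ℝ) 0 = a := by simp [radEntry]
  have h1 : ∀ p, radEntry (Fin.cons a c : Fin (N + 1) → ℝ) (p + 1) = radEntry c p := by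
    intro p
    by_cases hp : p < N
    · simp only [radEntry, hp, add_lt_add_iff_right, dif_pos]
      exact Fin.cons_succ (α := fun _ => ℝ) a c ⟨p, hp⟩
    · simp [radEntry, hp]
  simp only [ballPoint, Fin.cons_succ, Fin.val_succ, Finset.prod_range_succ', h0, h1]
  ring

theorem lintegral_fin_cons {N : ℕ} {F : (Fin (N + 1) → ℝ) → ℝ≥0∞} (hF : Measurable F) :
    ∫⁻ x, F x = ∫⁻ a : ℝ, ∫⁻ y : Fin N → ℝ, F (Fin.cons a y) := by
  have h := (volume_preserving_piFinSuccAbove (fun _ : Fin (N + 1) => ℝ) 0).symm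
  rw [← h.lintegral_comp_emb (MeasurableEquiv.measurableEmbedding _), Measure.volume_eq_prod,
    lintegral_prod _ (by
      exact (hF.comp (MeasurableEquiv.measurable _)).aemeasurable)]
  simp [MeasurableEquiv.piFinSuccAbove, Fin.insertNthEquiv]

/-- Integration over the open ball of radius `ρ` in the cosines of the spherical angles. -/
theorem lintegral_ball_eq {N : ℕ} {F : (Fin N → ℝ) → ℝ≥0∞} (hF : Measurable F) {ρ : ℝ}
    (hρ : 0 < ρ) :
    ∫⁻ x, {x : Fin N → ℝ | ∑ i, x i ^ 2 < ρ ^ 2}.indicator F x =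
      ∫⁻ c : Fin N → ℝ, ENNReal.ofReal (ρ ^ N) * (∏ i : Fin N, sinWeight (N - 1 - i) (c i)) *
        F (ballPoint ρ c) := by
  induction N generalizing ρ with
  | zero =>
    refine lintegral_congr fun x => ?_
    rw [Set.indicator_of_mem (by simp [hρ])]
    simp only [pow_zero, ENNReal.ofReal_one, Finset.univ_eq_empty, Finset.prod_empty, one_mul]
    congr 1
    exact Subsingleton.elim _ _
  | succ N ih =>
    have hms : MeasurableSet {x : Fin (N + 1) → ℝ | ∑ i, x i ^ 2 < ρ ^ 2} :=
      measurableSet_lt (by fun_prop) (by fun_prop)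
    have hcons : Measurable fun z : ℝ × (Fin N → ℝ) => (Fin.cons z.1 z.2 : Fin (N + 1) → ℝ) := by
      refine measurable_pi_lambda _ fun i => ?_
      refine Fin.cases ?_ (fun i => ?_) i
      · simpa using measurable_fst
      · simp only [Fin.cons_succ]
        exact (measurable_pi_apply i).comp measurable_snd
    have hmR : Measurable fun c : Fin (N + 1) → ℝ => ENNReal.ofReal (ρ ^ (N + 1)) *
        (∏ i : Fin (N + 1), sinWeight (N + 1 - 1 - i) (c i)) * F (ballPoint ρ c) := by
      refine Measurable.mul (measurable_const.mul ?_) (hF.comp (measurable_ballPoint ρ))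
      exact Finset.measurable_prod _ fun i _ =>
        (measurable_sinWeight _).comp (measurable_pi_apply i)
    rw [lintegral_fin_cons (hF.indicator hms), lintegral_fin_cons hmR]
    -- the substitution `x_0 = ρ c_0`
    have hsub : ∀ g : ℝ → ℝ≥0∞, Measurable g →
        ∫⁻ a, g a = ∫⁻ a, ENNReal.ofReal ρ * g (ρ * a) := by
      intro g hg
      have h1 := Real.map_volume_mul_left hρ.ne'
      have h2 : ∫⁻ a, g (ρ * a) = ∫⁻ a, g a ∂(Measure.map (fun x => ρ * x) volume) :=
        (lintegral_map hg (by fun_prop)).symm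
      rw [lintegral_const_mul' _ _ ENNReal.ofReal_ne_top, h2, h1, lintegral_smul_measure,
        smul_eq_mul, ← mul_assoc, ← ENNReal.ofReal_mul hρ.le, abs_of_pos (inv_pos.2 hρ),
        mul_inv_cancel₀ hρ.ne', ENNReal.ofReal_one, one_mul]
    rw [hsub (fun a => ∫⁻ y : Fin N → ℝ, {x : Fin (N + 1) → ℝ | ∑ i, x i ^ 2 < ρ ^ 2}.indicator F
      (Fin.cons a y)) (((hF.indicator hms).comp hcons).lintegral_prod_right')]
    refine lintegral_congr fun a => ?_
    -- the slice of the ball at `x_0 = ρ a` is a ball of radius `ρ √(1 - a²)`, empty for `|a| ≥ 1`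
    by_cases ha : a ∈ Set.Ioo (-1 : ℝ) 1
    · have hs := sin_arccos_pos ha
      have hca : Real.cos (Real.arccos a) = a := Real.cos_arccos ha.1.le ha.2.le
      have hρ' : 0 < ρ * Real.sin (Real.arccos a) := mul_pos hρ hs
      have hsq : (ρ * Real.sin (Real.arccos a)) ^ 2 = ρ ^ 2 - (ρ * a) ^ 2 := by
        rw [mul_pow, Real.sin_sq, hca]; ring
      have h1 : ∀ y : Fin N → ℝ, {x : Fin (N + 1) → ℝ | ∑ i, x i ^ 2 < ρ ^ 2}.indicator F
          (Fin.cons (ρ * a) y) = {x : Fin N → ℝ | ∑ i, x i ^ 2 <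
            (ρ * Real.sin (Real.arccos a)) ^ 2}.indicator (fun y => F (Fin.cons (ρ * a) y)) y := by
        intro y
        simp only [Set.indicator_apply, Set.mem_ofPred_eq, Fin.sum_univ_succ, Fin.cons_zero,
          Fin.cons_succ, hsq]
        congr 1
        exact propext ⟨fun h => by linarith, fun h => by linarith⟩
      have hFa : Measurable fun y : Fin N → ℝ => F (Fin.cons (ρ * a) y) :=
        hF.comp (hcons.comp (measurable_const.prodMk measurable_id))
      simp only [h1]
      rw [ih hFa hρ', ← lintegral_const_mul']
      · refine lintegral_congr fun c => ?_
        have h2 : (Fin.cons (ρ * a) (ballPoint (ρ * Real.sin (Real.arccos a)) c) :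
            Fin (N + 1) → ℝ) = ballPoint ρ (Fin.cons a c : Fin (N + 1) → ℝ) := by
          funext i
          refine Fin.cases ?_ (fun i => ?_) i
          · rw [ballPoint_cons_zero, hca, Fin.cons_zero]
          · rw [ballPoint_cons_succ, Fin.cons_succ]
        rw [h2, Fin.prod_univ_succ]
        simp only [Fin.cons_zero, Fin.cons_succ, Fin.val_zero, Fin.val_succ]
        have h3 : sinWeight (N + 1 - 1 - 0) a =
            ENNReal.ofReal (Real.sin (Real.arccos a) ^ N) := by
          simp [sinWeight, ha.1, ha.2]
        have h4 : ∀ i : Fin N, N + 1 - 1 - ((i : ℕ) + 1) = N - 1 - i := fun i => by omega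
        simp only [h3, h4]
        rw [mul_pow, ENNReal.ofReal_mul (pow_nonneg hρ.le _), pow_succ,
          ENNReal.ofReal_mul (pow_nonneg hρ.le _)]
        ring
      · exact ENNReal.ofReal_ne_top
    · have h1 : ∀ y : Fin N → ℝ, {x : Fin (N + 1) → ℝ | ∑ i, x i ^ 2 < ρ ^ 2}.indicator F
          (Fin.cons (ρ * a) y) = 0 := by
        intro y
        refine Set.indicator_of_notMem ?_ _
        simp only [Set.mem_ofPred_eq, Fin.sum_univ_succ, Fin.cons_zero, Fin.cons_succ, not_lt]
        have h2 : 1 ≤ a ^ 2 := by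
          by_contra h
          exact ha (abs_lt.1 ((sq_lt_one_iff_abs_lt_one a).1 (not_le.1 h)))
        have h3 : 0 ≤ ∑ i, y i ^ 2 := Finset.sum_nonneg fun _ _ => sq_nonneg _
        nlinarith [sq_nonneg ρ]
      have h2 : ∀ y : Fin N → ℝ,
          ∏ i : Fin (N + 1), sinWeight (N + 1 - 1 - i) ((Fin.cons a y : Fin (N + 1) → ℝ) i) = 0 := by
        intro y
        rw [Fin.prod_univ_succ, Fin.cons_zero, sinWeight, if_neg ha, zero_mul]
      simp only [h1, h2, lintegral_zero, mul_zero, zero_mul]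

end Spherical

/-! ### Bordered positive definite matrices -/

section Bordered

open Matrix
open scoped ENNReal

theorem posDef_iff_posSemidef_and_det {V : Type*} [Fintype V] [DecidableEq V] (M : Matrix V V ℝ) :
    M.PosDef ↔ M.PosSemidef ∧ M.det ≠ 0 :=
  ⟨fun h => ⟨h.posSemidef, h.posSemidef.posDef_iff_det_ne_zero.1 h⟩,
    fun h => h.1.posDef_iff_det_ne_zero.2 h.2⟩

theorem posDef_fromBlocks_one_iff {V W : Type*} [Fintype V] [DecidableEq V] [Fintype W]
    [DecidableEq W] (B : Matrix V W ℝ) (D : Matrix W W ℝ) :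
    (fromBlocks 1 B Bᵀ D).PosDef ↔ (D - Bᵀ * B).PosDef := by
  rw [posDef_iff_posSemidef_and_det, posDef_iff_posSemidef_and_det, det_fromBlocks_one₁₁]
  have : Invertible (1 : Matrix V V ℝ) := invertibleOne
  have h := PosDef.fromBlocks₁₁ (R' := ℝ) B D (A := 1) PosDef.one
  rw [conjTranspose_eq_transpose_of_trivial] at h
  rw [h]
  simp

/-- The matrix `H` bordered by the vector `w` and the number `t`. -/
def bordered {V : Type*} (H : Matrix V V ℝ) (w : V → ℝ) (t : ℝ) : Matrix (V ⊕ Unit) (V ⊕ Unit) ℝ :=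
  fromBlocks H (replicateCol Unit w) (replicateRow Unit w) (of fun _ _ => t)

variable {V : Type*} [Fintype V] [DecidableEq V]

theorem bordered_mul_transpose (A : Matrix V V ℝ) (x : V → ℝ) (t : ℝ) :
    bordered (A * Aᵀ) (A *ᵥ x) t =
      fromBlocks A 0 0 1 * bordered 1 x t * star (fromBlocks A 0 0 (1 : Matrix Unit Unit ℝ)) := by
  rw [star_eq_conjTranspose, fromBlocks_conjTranspose, bordered, bordered, fromBlocks_multiply,
    fromBlocks_multiply]
  simp only [conjTranspose_eq_transpose_of_trivial, transpose_zero, transpose_one, Matrix.mul_one,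
    Matrix.zero_mul, Matrix.mul_zero, add_zero, zero_add, Matrix.one_mul]
  congr 1
  ext i j
  simp [Matrix.mul_apply, mulVec, dotProduct, mul_comm]

theorem det_bordered_mul_transpose (A : Matrix V V ℝ) (x : V → ℝ) (t : ℝ) :
    (bordered (A * Aᵀ) (A *ᵥ x) t).det = A.det ^ 2 * (t - ∑ i, x i ^ 2) := by
  rw [bordered_mul_transpose, det_mul, det_mul, star_eq_conjTranspose,
    conjTranspose_eq_transpose_of_trivial, det_transpose, det_fromBlocks_zero₂₁, det_one,
    bordered, det_fromBlocks_one₁₁]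
  simp only [det_unique, Matrix.sub_apply, of_apply, mul_apply, replicateRow_apply, replicateCol_apply]
  simp only [← pow_two, mul_one]
  ring

/-- The numbers which complete the positive definite matrix `A Aᵀ` to a positive definite one are the
linear image of a ball. This makes the domain of the scalar products of a new vector accessible to
spherical coordinates. -/
theorem posDef_bordered_mul_transpose {A : Matrix V V ℝ} (hA : A.det ≠ 0) (x : V → ℝ) (t : ℝ) :
    (bordered (A * Aᵀ) (A *ᵥ x) t).PosDef ↔ ∑ i, x i ^ 2 < t := by
  have hU : IsUnit (fromBlocks A 0 0 (1 : Matrix Unit Unit ℝ)) := by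
    rw [isUnit_iff_isUnit_det, det_fromBlocks_zero₂₁, det_one, mul_one]
    exact hA.isUnit
  rw [bordered_mul_transpose, hU.posDef_star_right_conjugate_iff, bordered,
    show replicateRow Unit x = (replicateCol Unit x)ᵀ from rfl, posDef_fromBlocks_one_iff]
  have h : (of fun _ _ => t) - (replicateCol Unit x)ᵀ * replicateCol Unit x =
      diagonal fun _ : Unit => t - ∑ i, x i ^ 2 := by
    ext i j
    simp [Matrix.mul_apply, pow_two]
  rw [h, posDef_diagonal_iff]
  simp

/-- Linear change of variables, in the form without the inverse determinant. -/
theorem lintegral_mulVec {A : Matrix V V ℝ} (hA : A.det ≠ 0) {G : (V → ℝ) → ℝ≥0∞}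
    (hG : Measurable G) :
    ∫⁻ w, G w = ENNReal.ofReal |A.det| * ∫⁻ x, G (A *ᵥ x) := by
  have h1 := Real.map_matrix_volume_pi_eq_smul_volume_pi hA
  have hm : Measurable (toLin' A) := (LinearMap.continuous_on_pi _).measurable
  have h2 : ∫⁻ x, G (A *ᵥ x) = ∫⁻ w, G w ∂(Measure.map (toLin' A) volume) := by
    rw [lintegral_map hG hm]
    simp [toLin'_apply]
  rw [h2, h1, lintegral_smul_measure, smul_eq_mul, ← mul_assoc,
    ← ENNReal.ofReal_mul (abs_nonneg _), abs_inv, mul_inv_cancel₀ (abs_ne_zero.2 hA),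
    ENNReal.ofReal_one, one_mul]

theorem measurableSet_posDef {X : Type*} [MeasurableSpace X] {M : X → Matrix V V ℝ}
    (hM : ∀ i j, Measurable fun x => M x i j) : MeasurableSet {x | (M x).PosDef} := by
  have hcl : IsClosed {N : V → V → ℝ | (of N).PosSemidef} := by
    have : {N : V → V → ℝ | (of N).PosSemidef} =
        {N | ∀ i j, N j i = N i j} ∩ ⋂ y : V → ℝ, {N | 0 ≤ ∑ i, y i * ∑ j, N i j * y j} := by
      ext N
      simp only [Set.mem_ofPred_eq, posSemidef_iff_dotProduct_mulVec, Set.mem_inter_iff,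
        Set.mem_iInter, IsHermitian.ext_iff, star_trivial, of_apply]
      rfl
    rw [this]
    refine IsClosed.inter ?_ (isClosed_iInter fun y => isClosed_le (by fun_prop) (by fun_prop))
    simp only [Set.ofPred_forall]
    exact isClosed_iInter fun i => isClosed_iInter fun j => isClosed_eq (by fun_prop) (by fun_prop)
  have hm : Measurable fun x => (fun i j => M x i j : V → V → ℝ) :=
    measurable_pi_lambda _ fun i => measurable_pi_lambda _ fun j => hM i j
  have hdet : Measurable fun x => (M x).det := by
    simp only [det_apply]
    exact Finset.measurable_sum _ fun σ _ =>
      (Finset.measurable_prod _ fun i _ => hM _ _).const_smul (Equiv.Perm.sign σ : ℤˣ)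
  have : {x | (M x).PosDef} =
      ((fun x => (fun i j => M x i j : V → V → ℝ)) ⁻¹' {N : V → V → ℝ | (of N).PosSemidef}) ∩
        {x | (M x).det ≠ 0} := by
    ext x
    exact posDef_iff_posSemidef_and_det _
  rw [this]
  exact (hcl.measurableSet.preimage hm).inter (hdet (measurableSet_singleton 0).compl)

/-- Up to a null set, positive semidefinite symmetric matrices are positive definite: they form a
convex set, and those that are not positive definite lie on its frontier. -/
theorem posSemidef_ae_eq_posDef (l : ℕ) :
    ({u | (symMatrix u).PosSemidef} : Set (SymIdx l → ℝ)) =ᵐ[volume]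
      {u | (symMatrix u).PosDef} := by
  set K : Set (SymIdx l → ℝ) := {u | (symMatrix u).PosSemidef} with hK
  have hsymm : ∀ u : SymIdx l → ℝ, ∀ i j, symMatrix u i j = symMatrix u j i := by
    intro u i j
    simp only [symMatrix, min_comm i j, max_comm i j]
  have hconv : Convex ℝ K := by
    intro u hu v hv a b ha hb _
    have : symMatrix (a • u + b • v) = a • symMatrix u + b • symMatrix v := rfl
    rw [hK, Set.mem_ofPred_eq, this]
    exact (PosSemidef.smul hu ha).add (PosSemidef.smul hv hb)
  have hint : interior K ⊆ {u | (symMatrix u).PosDef} := by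
    intro u hu
    let e : SymIdx l → ℝ := fun p => if p.1.1 = p.1.2 then 1 else 0
    have he : symMatrix e = 1 := by
      ext i j
      simp only [symMatrix, e, Matrix.one_apply]
      congr 1
      exact propext ⟨fun h => by
        rcases le_total i j with hij | hij <;> simp [hij] at h <;> simp [h], fun h => by simp [h]⟩
    have hc : Filter.Tendsto (fun ε : ℝ => u - ε • e) (nhdsWithin 0 (Set.Ioi 0)) (nhds u) := by
      have : Continuous fun ε : ℝ => u - ε • e := by fun_prop
      simpa using (this.tendsto 0).mono_left nhdsWithin_le_nhds
    obtain ⟨ε, hε, hε0⟩ := ((hc.eventually (mem_interior_iff_mem_nhds.1 hu)).and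
      self_mem_nhdsWithin).exists
    have hsplit : symMatrix u = symMatrix (u - ε • e) + ε • (1 : Matrix (Fin l) (Fin l) ℝ) := by
      rw [← he]
      ext i j
      simp [symMatrix]
    rw [Set.mem_ofPred_eq, hsplit]
    exact PosDef.posSemidef_add hε (PosDef.one.smul hε0)
  have hPK : {u : SymIdx l → ℝ | (symMatrix u).PosDef} ⊆ K := fun u hu => hu.posSemidef
  have hnull : volume (K \ {u | (symMatrix u).PosDef}) = 0 :=
    measure_mono_null (t := frontier K)
      (fun u hu => ⟨subset_closure hu.1, fun h => hu.2 (hint h)⟩) (hconv.addHaar_frontier volume)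
  exact (ae_le_set.2 hnull).antisymm hPK.eventuallyLE

end Bordered

/-! ### Adding one more loop momentum -/

section Stage

open Matrix
open scoped ENNReal

/-- Labels of the source variables: `cos Θ_⊥`, `cos Θ_Λ` and the `λ_ii`. -/
abbrev SrcIdx (l κ : ℕ) : Type := PerpIdx l κ ⊕ (LamIdx l ⊕ Fin l)

/-- Labels of the target variables: the components `a_kj` and the `λ_ij`, `i ≤ j`. -/
abbrev TgtIdx (l κ : ℕ) : Type := PerpIdx l κ ⊕ SymIdx l

/-- Labels of the vectors `v_0, …, v_{κ-1}, λ_0, …, λ_{l-1}`. -/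
abbrev VecIdx (l κ : ℕ) : Type := Fin κ ⊕ Fin l

/-- The row of the angle of the new column that is attached to a vector label. -/
def rowEquiv (l κ : ℕ) : VecIdx l κ ≃ Fin (l + κ) := (Equiv.sumComm _ _).trans finSumFinEquiv

/-- The position of a vector in the list `λ_{l-1}, …, λ_0, v_0, …, v_{κ-1}`. -/
def posEquiv (l κ : ℕ) : VecIdx l κ ≃ Fin (l + κ) :=
  (Equiv.sumCongr (Equiv.refl _) Fin.revPerm).trans (rowEquiv l κ)

@[simp] theorem rowEquiv_inl (l κ : ℕ) (k : Fin κ) : (rowEquiv l κ (Sum.inl k) : ℕ) = l + k := by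
  simp [rowEquiv]

@[simp] theorem rowEquiv_inr (l κ : ℕ) (i : Fin l) : (rowEquiv l κ (Sum.inr i) : ℕ) = i := by
  simp [rowEquiv]

@[simp] theorem posEquiv_inl (l κ : ℕ) (k : Fin κ) : (posEquiv l κ (Sum.inl k) : ℕ) = l + k := by
  simp [posEquiv]

@[simp] theorem posEquiv_inr (l κ : ℕ) (i : Fin l) :
    (posEquiv l κ (Sum.inr i) : ℕ) = l - (i + 1) := by
  simp [posEquiv, Fin.val_rev]

/-- The inclusion of the pairs `i < j < l` into the pairs `i < j < l + 1`. -/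
def lamCast {l : ℕ} (p : LamIdx l) : LamIdx (l + 1) :=
  ⟨(p.1.1.castSucc, p.1.2.castSucc), Fin.castSucc_lt_castSucc_iff.2 p.2⟩

/-- The inclusion of the pairs `i ≤ j < l` into the pairs `i ≤ j < l + 1`. -/
def symCast {l : ℕ} (p : SymIdx l) : SymIdx (l + 1) :=
  ⟨(p.1.1.castSucc, p.1.2.castSucc), Fin.castSucc_le_castSucc_iff.2 p.2⟩

/-- The source variables of the first `l + 1` vectors: those of the first `l` vectors, the cosines
of a new column of angles, and the new norm. -/
def srcSplit (l κ : ℕ) : SrcIdx l κ ⊕ (VecIdx l κ ⊕ Unit) ≃ SrcIdx (l + 1) κ :=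
  Equiv.ofBijective
    (Sum.elim
      (Sum.elim (fun p => Sum.inl (p.1, p.2.castSucc))
        (Sum.elim (fun p => Sum.inr (Sum.inl (lamCast p))) fun i => Sum.inr (Sum.inr i.castSucc)))
      (Sum.elim
        (Sum.elim (fun k => Sum.inl (k, Fin.last l))
          fun i => Sum.inr (Sum.inl ⟨(i.castSucc, Fin.last l), Fin.castSucc_lt_last i⟩))
        fun _ => Sum.inr (Sum.inr (Fin.last l))))
    (by
      constructor
      · rintro ((⟨k, j⟩ | ⟨⟨i, j⟩, hij⟩ | i) | (k | i) | u) ((⟨k', j'⟩ | ⟨⟨i', j'⟩, hij'⟩ | i') |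
          (k' | i') | u') h <;>
        simp [lamCast, Fin.castSucc_ne_last, (Fin.castSucc_ne_last _).symm] at h ⊢ <;>
        simp_all
      · rintro (⟨k, j⟩ | ⟨⟨i, j⟩, hij⟩ | i)
        · refine Fin.lastCases ?_ (fun j => ?_) j
          · exact ⟨Sum.inr (Sum.inl (Sum.inl k)), rfl⟩
          · exact ⟨Sum.inl (Sum.inl (k, j)), rfl⟩
        · have hij' : i < j := hij
          induction j using Fin.lastCases with
          | last =>
            induction i using Fin.lastCases with
            | last => exact absurd hij' (lt_irrefl _)
            | cast i => exact ⟨Sum.inr (Sum.inl (Sum.inr i)), rfl⟩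
          | cast j =>
            induction i using Fin.lastCases with
            | last => exact absurd hij' (not_lt.2 (Fin.le_last _))
            | cast i =>
              exact ⟨Sum.inl (Sum.inr (Sum.inl ⟨(i, j), Fin.castSucc_lt_castSucc_iff.1 hij'⟩)), rfl⟩
        · refine Fin.lastCases ?_ (fun i => ?_) i
          · exact ⟨Sum.inr (Sum.inr ()), rfl⟩
          · exact ⟨Sum.inl (Sum.inr (Sum.inr i)), rfl⟩)

/-- The target variables of the first `l + 1` vectors: those of the first `l` vectors, the scalar
products of the new vector with the earlier ones, and its square. -/
def tgtSplit (l κ : ℕ) : TgtIdx l κ ⊕ (VecIdx l κ ⊕ Unit) ≃ TgtIdx (l + 1) κ :=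
  Equiv.ofBijective
    (Sum.elim
      (Sum.elim (fun p => Sum.inl (p.1, p.2.castSucc)) fun p => Sum.inr (symCast p))
      (Sum.elim
        (Sum.elim (fun k => Sum.inl (k, Fin.last l))
          fun i => Sum.inr ⟨(i.castSucc, Fin.last l), Fin.le_last _⟩)
        fun _ => Sum.inr ⟨(Fin.last l, Fin.last l), le_rfl⟩))
    (by
      constructor
      · rintro ((⟨k, j⟩ | ⟨⟨i, j⟩, hij⟩) | (k | i) | u) ((⟨k', j'⟩ | ⟨⟨i', j'⟩, hij'⟩) |
          (k' | i') | u') h <;>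
        simp [symCast, Fin.castSucc_ne_last, (Fin.castSucc_ne_last _).symm] at h ⊢ <;>
        simp_all
      · rintro (⟨k, j⟩ | ⟨⟨i, j⟩, hij⟩)
        · refine Fin.lastCases ?_ (fun j => ?_) j
          · exact ⟨Sum.inr (Sum.inl (Sum.inl k)), rfl⟩
          · exact ⟨Sum.inl (Sum.inl (k, j)), rfl⟩
        · have hij' : i ≤ j := hij
          induction j using Fin.lastCases with
          | last =>
            induction i using Fin.lastCases with
            | last => exact ⟨Sum.inr (Sum.inr ()), rfl⟩
            | cast i => exact ⟨Sum.inr (Sum.inl (Sum.inr i)), rfl⟩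
          | cast j =>
            induction i using Fin.lastCases with
            | last => exact absurd hij' (not_le.2 (Fin.castSucc_lt_last _))
            | cast i =>
              exact ⟨Sum.inl (Sum.inr ⟨(i, j), Fin.castSucc_le_castSucc_iff.1 hij'⟩), rfl⟩)

/-- The point with given coordinates of the three kinds distinguished by `e`. -/
def glue {ι₁ V ι : Type} (e : ι₁ ⊕ (V ⊕ Unit) ≃ ι) (y : ι₁ → ℝ) (w : V → ℝ) (t : ℝ) : ι → ℝ :=
  fun i => Sum.elim y (Sum.elim w fun _ => t) (e.symm i)

@[simp] theorem glue_inl {ι₁ V ι : Type} (e : ι₁ ⊕ (V ⊕ Unit) ≃ ι) (y : ι₁ → ℝ) (w : V → ℝ)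
    (t : ℝ) (i : ι₁) : glue e y w t (e (Sum.inl i)) = y i := by
  simp [glue]

@[simp] theorem glue_inr_inl {ι₁ V ι : Type} (e : ι₁ ⊕ (V ⊕ Unit) ≃ ι) (y : ι₁ → ℝ) (w : V → ℝ)
    (t : ℝ) (i : V) : glue e y w t (e (Sum.inr (Sum.inl i))) = w i := by
  simp [glue]

@[simp] theorem glue_inr_inr {ι₁ V ι : Type} (e : ι₁ ⊕ (V ⊕ Unit) ≃ ι) (y : ι₁ → ℝ) (w : V → ℝ)
    (t : ℝ) (i : Unit) : glue e y w t (e (Sum.inr (Sum.inr i))) = t := by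
  simp [glue]

theorem measurable_glue {ι₁ V ι : Type} (e : ι₁ ⊕ (V ⊕ Unit) ≃ ι) :
    Measurable fun z : (ι₁ → ℝ) × (V → ℝ) × ℝ => glue e z.1 z.2.1 z.2.2 := by
  refine measurable_pi_lambda _ fun i => ?_
  obtain ⟨j, rfl⟩ := e.surjective i
  rcases j with j | j | j
  · simp only [glue_inl]; fun_prop
  · simp only [glue_inr_inl]; fun_prop
  · simp only [glue_inr_inr]; fun_prop

theorem lintegral_glue {ι₁ V ι : Type} [Fintype ι₁] [Fintype V] [Fintype ι]
    (e : ι₁ ⊕ (V ⊕ Unit) ≃ ι) {f : (ι → ℝ) → ℝ≥0∞} (hf : Measurable f) :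
    ∫⁻ x, f x = ∫⁻ y : ι₁ → ℝ, ∫⁻ w : V → ℝ, ∫⁻ t : ℝ, f (glue e y w t) := by
  have h1 := volume_measurePreserving_piCongrLeft (fun _ : ι => ℝ) e
  have h2 := volume_measurePreserving_sumPiEquivProdPi_symm (fun _ : ι₁ ⊕ (V ⊕ Unit) => ℝ)
  have h3 := volume_measurePreserving_sumPiEquivProdPi_symm (fun _ : V ⊕ Unit => ℝ)
  have h4 := (volume_preserving_funUnique Unit ℝ).symm
  rw [← h1.lintegral_comp_emb (MeasurableEquiv.measurableEmbedding _),
    ← h2.lintegral_comp_emb (MeasurableEquiv.measurableEmbedding _), Measure.volume_eq_prod,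
    lintegral_prod _ (by
      exact ((hf.comp (MeasurableEquiv.measurable _)).comp
        (MeasurableEquiv.measurable _)).aemeasurable)]
  refine lintegral_congr fun y => ?_
  have hg : ∀ z : V ⊕ Unit → ℝ, f (MeasurableEquiv.piCongrLeft (fun _ : ι => ℝ) e
      ((MeasurableEquiv.sumPiEquivProdPi fun _ : ι₁ ⊕ (V ⊕ Unit) => ℝ).symm (y, z))) =
      f (glue e y (fun v => z (Sum.inl v)) (z (Sum.inr ()))) := by
    intro z
    congr 1
    funext i
    obtain ⟨j, rfl⟩ := e.surjective i
    rw [MeasurableEquiv.piCongrLeft_apply_apply]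
    rcases j with j | j | j
    · rw [glue_inl]; rfl
    · rw [glue_inr_inl]; rfl
    · rw [glue_inr_inr]; rfl
  simp only [hg]
  have hm := measurable_glue e
  have hfm : Measurable fun z : V ⊕ Unit → ℝ =>
      f (glue e y (fun v => z (Sum.inl v)) (z (Sum.inr ()))) :=
    hf.comp (hm.comp (measurable_const.prodMk (by fun_prop :
      Measurable fun z : V ⊕ Unit → ℝ => ((fun v => z (Sum.inl v) : V → ℝ), z (Sum.inr ())))))
  rw [← h3.lintegral_comp_emb (MeasurableEquiv.measurableEmbedding _), Measure.volume_eq_prod,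
    lintegral_prod _ (by exact (hfm.comp (MeasurableEquiv.measurable _)).aemeasurable)]
  refine lintegral_congr fun w => ?_
  rw [← h4.lintegral_comp_emb (MeasurableEquiv.measurableEmbedding _)]
  rfl

variable {l κ : ℕ}

/-- Cosines of the nested angles, as a function of row and column. -/
def cosEntry (x : SrcIdx l κ → ℝ) : ℕ → ℕ → ℝ :=
  allEntry (fun i => Real.cos (Real.arccos (x (Sum.inr (Sum.inl i)))))
    fun i => Real.cos (Real.arccos (x (Sum.inl i)))

/-- Sines of the nested angles, as a function of row and column. -/
def sinEntry (x : SrcIdx l κ → ℝ) : ℕ → ℕ → ℝ :=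
  allEntry (fun i => Real.sin (Real.arccos (x (Sum.inr (Sum.inl i)))))
    fun i => Real.sin (Real.arccos (x (Sum.inl i)))

/-- The norms of the vectors. -/
def normEntry (x : SrcIdx l κ → ℝ) : ℕ → ℝ :=
  radEntry fun i => Real.sqrt (x (Sum.inr (Sum.inr i)))

/-- The coordinates of the known vectors in the current frame. -/
def srcCoord (x : SrcIdx l κ → ℝ) : ℕ → ℕ → ℕ → ℝ :=
  frameCoord (cosEntry x) (sinEntry x) (normEntry x)

theorem cos_sq_add_sin_sq_entry (x : SrcIdx l κ → ℝ) {p q : ℕ} (hq : q < l) (hp : p < q + κ) :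
    cosEntry x p q ^ 2 + sinEntry x p q ^ 2 = 1 := by
  simp only [cosEntry, sinEntry, allEntry, lamEntry]
  by_cases h : p < q
  · have : p < q ∧ q < l := ⟨h, hq⟩
    simp only [h, if_true, this, true_and, dif_pos, Real.cos_sq_add_sin_sq]
  · have : p - q < κ ∧ q < l := ⟨by omega, hq⟩
    simp only [h, if_false, this, dif_pos, Real.cos_sq_add_sin_sq, and_self]

/-- The components `a_kj` and the scalar products `λ_ij` as functions of the new variables. -/
def bigMap (x : SrcIdx l κ → ℝ) : TgtIdx l κ → ℝ :=
  Sum.elim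
    (fun p => (nestedMap l κ).perpComp (fun i => x (Sum.inr (Sum.inr i)))
      (angles fun i => x (Sum.inr (Sum.inl i))) (angles fun i => x (Sum.inl i)) p.1 p.2)
    ((nestedMap l κ).lamUpper (fun i => x (Sum.inr (Sum.inr i)))
      (angles fun i => x (Sum.inr (Sum.inl i))))

theorem bigMap_inl (x : SrcIdx l κ → ℝ) (p : PerpIdx l κ) :
    bigMap x (Sum.inl p) = normEntry x p.2 * srcCoord x (p.2 + 1) (p.1 + p.2 + 1) 0 := by
  simp only [bigMap, Sum.elim_inl, PolyMap.perpComp, eval_comp, normEntry, radEntry_val]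
  rfl

theorem bigMap_inr_lt (x : SrcIdx l κ → ℝ) (p : SymIdx l) (h : p.1.1 < p.1.2) :
    bigMap x (Sum.inr p) = normEntry x p.1.2 * srcCoord x (p.1.2 + 1) (p.1.2 - p.1.1) 0 := by
  simp only [bigMap, Sum.elim_inr, PolyMap.lamUpper, h, dif_pos, eval_offDiag, normEntry,
    radEntry_val]
  congr 1
  have h' : (p.1.1 : ℕ) < p.1.2 := h
  refine congrFun (frameCoord_congr ?_ ?_ fun _ _ => rfl) 0 <;>
  · intro a b _ hab
    exact (allEntry_eq_lamEntry _ _ (by omega)).symm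

theorem bigMap_inr_diag (x : SrcIdx l κ → ℝ) (p : SymIdx l) (h : ¬p.1.1 < p.1.2) :
    bigMap x (Sum.inr p) = x (Sum.inr (Sum.inr p.1.1)) := by
  simp only [bigMap, Sum.elim_inr, PolyMap.lamUpper, h, dif_neg, not_false_iff]

/-- The Gram matrix of the vectors `v_0, …, v_{κ-1}, λ_0, …, λ_{l-1}`. -/
def bigGram (y : TgtIdx l κ → ℝ) : Matrix (VecIdx l κ) (VecIdx l κ) ℝ :=
  fromBlocks 1 (of fun k j => y (Sum.inl (k, j))) (of fun k j => y (Sum.inl (k, j)))ᵀ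
    (symMatrix fun p => y (Sum.inr p))

/-- The square matrix of coordinates of all known vectors. -/
def coordMatrix (x : SrcIdx l κ → ℝ) : Matrix (VecIdx l κ) (VecIdx l κ) ℝ :=
  of fun v q => srcCoord x l (posEquiv l κ v) (rowEquiv l κ q)

/-- The scalar product of two vectors can be computed in any later frame. -/
theorem sum_frameCoord_add_mul {c s : ℕ → ℕ → ℝ} (r : ℕ → ℝ) (j n a a' κ : ℕ)
    (hcs : ∀ q < j + n, ∀ p < q + κ, c p q ^ 2 + s p q ^ 2 = 1) (ha : a < j + κ)
    (ha' : a' < j + κ) :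
    ∑ b ∈ Finset.range (j + n + κ),
        frameCoord c s r (j + n) (a + n) b * frameCoord c s r (j + n) (a' + n) b =
      ∑ b ∈ Finset.range (j + κ), frameCoord c s r j a b * frameCoord c s r j a' b := by
  induction n with
  | zero => rfl
  | succ n ih =>
    rw [← ih fun q hq p hp => hcs q (by omega) p hp]
    have := sum_frameCoord_succ_mul (c := c) (s := s) (l := j + n) (N := j + n + κ)
      (fun p hp => hcs (j + n) (by omega) p hp) r (a + n) (a' + n) (by omega) (by omega)
    rw [← this, show j + (n + 1) + κ = j + n + κ + 1 by ring]
    rfl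

theorem sum_frameCoord_zero_mul (c s : ℕ → ℕ → ℝ) (r : ℕ → ℝ) (j a N : ℕ) (hN : 0 < N) :
    ∑ b ∈ Finset.range N, frameCoord c s r (j + 1) 0 b * frameCoord c s r (j + 1) a b =
      r j * frameCoord c s r (j + 1) a 0 := by
  rw [Finset.sum_eq_single 0]
  · simp [frameCoord]
  · intro b _ hb
    simp [frameCoord, hb]
  · intro h
    exact absurd (Finset.mem_range.2 hN) h

theorem coordMatrix_mul_apply (x : SrcIdx l κ → ℝ) (v v' : VecIdx l κ) :
    (coordMatrix x * (coordMatrix x)ᵀ) v v' = ∑ b ∈ Finset.range (l + κ),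
      srcCoord x l (posEquiv l κ v) b * srcCoord x l (posEquiv l κ v') b := by
  rw [Matrix.mul_apply, ← Fin.sum_univ_eq_sum_range
    (fun b => srcCoord x l (posEquiv l κ v) b * srcCoord x l (posEquiv l κ v') b)]
  exact (rowEquiv l κ).sum_comp
    (fun b : Fin (l + κ) => srcCoord x l (posEquiv l κ v) b * srcCoord x l (posEquiv l κ v') b)

/-- The Gram matrix of all known vectors is computed from their coordinates in the last frame. -/
theorem coordMatrix_mul_transpose (x : SrcIdx l κ → ℝ) (hx : ∀ i, 0 ≤ x (Sum.inr (Sum.inr i))) :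
    coordMatrix x * (coordMatrix x)ᵀ = bigGram (bigMap x) := by
  have hcs : ∀ q < l, ∀ p < q + κ, cosEntry x p q ^ 2 + sinEntry x p q ^ 2 = 1 :=
    fun q hq p hp => cos_sq_add_sin_sq_entry x hq hp
  have hll : ∀ (i j : Fin l) (hij : i < j), (coordMatrix x * (coordMatrix x)ᵀ) (Sum.inr j) (Sum.inr i) =
      bigMap x (Sum.inr ⟨(i, j), le_of_lt hij⟩) := by
    intro i j hij
    have hij' : (i : ℕ) < j := hij
    have hj := j.2
    rw [coordMatrix_mul_apply, bigMap_inr_lt x _ hij]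
    have h := sum_frameCoord_add_mul (c := cosEntry x) (s := sinEntry x) (normEntry x) (j + 1)
      (l - (j + 1)) 0 (j - i) κ (fun q hq => hcs q (by omega)) (by omega) (by omega)
    simp only [show (j : ℕ) + 1 + (l - (j + 1)) = l by omega, zero_add,
      show (j : ℕ) - i + (l - (j + 1)) = l - (i + 1) by omega] at h
    simp only [posEquiv_inr]
    rw [srcCoord, h, sum_frameCoord_zero_mul _ _ _ _ _ _ (by omega)]
  have hvl : ∀ (k : Fin κ) (j : Fin l),
      (coordMatrix x * (coordMatrix x)ᵀ) (Sum.inr j) (Sum.inl k) = bigMap x (Sum.inl (k, j)) := by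
    intro k j
    have hj := j.2
    have hk := k.2
    rw [coordMatrix_mul_apply, bigMap_inl]
    have h := sum_frameCoord_add_mul (c := cosEntry x) (s := sinEntry x) (normEntry x) (j + 1)
      (l - (j + 1)) 0 (k + j + 1) κ (fun q hq => hcs q (by omega)) (by omega) (by omega)
    simp only [show (j : ℕ) + 1 + (l - (j + 1)) = l by omega, zero_add,
      show (k : ℕ) + j + 1 + (l - (j + 1)) = l + k by omega] at h
    simp only [posEquiv_inr, posEquiv_inl]
    rw [srcCoord, h, sum_frameCoord_zero_mul _ _ _ _ _ _ (by omega)]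
  have hsymm : ∀ v v', (coordMatrix x * (coordMatrix x)ᵀ) v v' =
      (coordMatrix x * (coordMatrix x)ᵀ) v' v := by
    intro v v'
    rw [coordMatrix_mul_apply, coordMatrix_mul_apply]
    exact Finset.sum_congr rfl fun _ _ => mul_comm _ _
  ext v v'
  rcases v with k | i <;> rcases v' with k' | j
  · have h := sum_frameCoord_add_mul (c := cosEntry x) (s := sinEntry x) (normEntry x) 0
      l k k' κ (fun q hq => hcs q (by omega)) (by simp) (by simp)
    simp only [zero_add] at h
    rw [coordMatrix_mul_apply]
    simp only [posEquiv_inl, add_comm l, srcCoord] at h ⊢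
    rw [h]
    simp only [frameCoord, mul_ite, mul_one, mul_zero, Finset.sum_ite_eq', Finset.mem_range,
      bigGram, fromBlocks_apply₁₁, one_apply, Fin.ext_iff, k'.2, if_true]
    simp [eq_comm]
  · rw [hsymm, hvl]
    rfl
  · rw [hvl]
    rfl
  · simp only [bigGram, fromBlocks_apply₂₂, symMatrix]
    rcases lt_trichotomy i j with h | h | h
    · rw [hsymm, hll i j h]
      congr 3
      exact Prod.ext (min_eq_left h.le).symm (max_eq_right h.le).symm
    · subst h
      have hi := i.2
      rw [coordMatrix_mul_apply, bigMap_inr_diag x _ (by simp)]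
      have h := sum_frameCoord_add_mul (c := cosEntry x) (s := sinEntry x) (normEntry x) (i + 1)
        (l - (i + 1)) 0 0 κ (fun q hq => hcs q (by omega)) (by omega) (by omega)
      simp only [show (i : ℕ) + 1 + (l - (i + 1)) = l by omega, zero_add] at h
      simp only [posEquiv_inr]
      rw [srcCoord, h, sum_frameCoord_zero_mul _ _ _ _ _ _ (by omega)]
      simp only [frameCoord, if_true, normEntry, radEntry_val, min_self]
      exact Real.mul_self_sqrt (hx i)
    · rw [hll j i h]
      congr 3
      exact Prod.ext (min_eq_right h.le).symm (max_eq_left h.le).symm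

theorem abs_det_coordMatrix (x : SrcIdx l κ → ℝ) :
    |(coordMatrix x).det| =
      |∏ j ∈ Finset.range l, (normEntry x j * ∏ p ∈ Finset.range (j + κ), sinEntry x p j)| := by
  let B : Matrix (Fin (l + κ)) (Fin (l + κ)) ℝ := of fun a b => srcCoord x l a b
  have h1 : coordMatrix x = B.submatrix (posEquiv l κ) (rowEquiv l κ) := rfl
  have h2 : B.det = ∏ a : Fin (l + κ), srcCoord x l a a :=
    det_of_isLowerTriangular B fun i j hij => frameCoord_support _ _ _ _ _ _ hij
  rw [h1, abs_det_submatrix_equiv_equiv, h2,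
    Fin.prod_univ_eq_prod_range (fun a => srcCoord x l a a), srcCoord, prod_frameCoord_diag]

/-- A product over all norms and angles, column by column. -/
theorem prod_srcIdx {M : Type*} [CommMonoid M] (l κ : ℕ) (f : ℕ → ℕ → M) (r : ℕ → M) :
    ∏ j ∈ Finset.range l, (r j * ∏ p ∈ Finset.range (j + κ), f p j) =
      ∏ i : SrcIdx l κ, Sum.elim (fun p : PerpIdx l κ => f (p.1 + p.2) p.2)
        (Sum.elim (fun p : LamIdx l => f p.1.1 p.1.2) fun i : Fin l => r i) i := by
  induction l with
  | zero =>
    have : IsEmpty (LamIdx 0) := ⟨fun p => p.1.1.elim0⟩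
    simp
  | succ l ih =>
    rw [Finset.prod_range_succ, ih, ← (srcSplit l κ).prod_comp]
    conv_rhs => rw [Fintype.prod_sum_type, Fintype.prod_sum_type (α₁ := VecIdx l κ)]
    congr 1
    · refine Finset.prod_congr rfl fun i _ => ?_
      rcases i with p | p | p <;> rfl
    · rw [mul_comm]
      congr 1
      · rw [← Fin.prod_univ_eq_prod_range (fun p => f p l),
          ← (rowEquiv l κ).prod_comp (fun p : Fin (l + κ) => f p l)]
        refine Finset.prod_congr rfl fun i _ => ?_
        rcases i with p | p
        · rw [rowEquiv_inl, add_comm]; rfl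
        · rw [rowEquiv_inr]; rfl
      · rw [Fintype.prod_unique]; rfl

section Glue

variable (x : SrcIdx l κ → ℝ) (z : VecIdx l κ → ℝ) (t : ℝ)

theorem glue_src_inl (k : Fin κ) (j : Fin l) :
    glue (srcSplit l κ) x z t (Sum.inl (k, j.castSucc)) = x (Sum.inl (k, j)) :=
  glue_inl (srcSplit l κ) x z t (Sum.inl (k, j))

theorem glue_src_inl_last (k : Fin κ) :
    glue (srcSplit l κ) x z t (Sum.inl (k, Fin.last l)) = z (Sum.inl k) :=
  glue_inr_inl (srcSplit l κ) x z t (Sum.inl k)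

theorem glue_src_lam (p : LamIdx l) :
    glue (srcSplit l κ) x z t (Sum.inr (Sum.inl (lamCast p))) = x (Sum.inr (Sum.inl p)) :=
  glue_inl (srcSplit l κ) x z t (Sum.inr (Sum.inl p))

theorem glue_src_lam_last (i : Fin l) :
    glue (srcSplit l κ) x z t
      (Sum.inr (Sum.inl ⟨(i.castSucc, Fin.last l), Fin.castSucc_lt_last i⟩)) = z (Sum.inr i) :=
  glue_inr_inl (srcSplit l κ) x z t (Sum.inr i)

theorem glue_src_rad (i : Fin l) :
    glue (srcSplit l κ) x z t (Sum.inr (Sum.inr i.castSucc)) = x (Sum.inr (Sum.inr i)) :=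
  glue_inl (srcSplit l κ) x z t (Sum.inr (Sum.inr i))

theorem glue_src_rad_last :
    glue (srcSplit l κ) x z t (Sum.inr (Sum.inr (Fin.last l))) = t :=
  glue_inr_inr (srcSplit l κ) x z t ()

theorem normEntry_glue {q : ℕ} (hq : q < l) :
    normEntry (glue (srcSplit l κ) x z t) q = normEntry x q := by
  have h := radEntry_val (fun i => Real.sqrt (glue (srcSplit l κ) x z t (Sum.inr (Sum.inr i))))
    (Fin.castSucc ⟨q, hq⟩)
  rw [glue_src_rad] at h
  have h' := radEntry_val (fun i => Real.sqrt (x (Sum.inr (Sum.inr i)))) ⟨q, hq⟩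
  exact h.trans h'.symm

theorem normEntry_glue_last :
    normEntry (glue (srcSplit l κ) x z t) l = Real.sqrt t := by
  have h := radEntry_val (fun i => Real.sqrt (glue (srcSplit l κ) x z t (Sum.inr (Sum.inr i))))
    (Fin.last l)
  rw [glue_src_rad_last] at h
  exact h

theorem allEntry_glue (F : ℝ → ℝ) {p q : ℕ} (hq : q < l) :
    allEntry (fun i => F (glue (srcSplit l κ) x z t (Sum.inr (Sum.inl i))))
        (fun i => F (glue (srcSplit l κ) x z t (Sum.inl i))) p q =
      allEntry (fun i => F (x (Sum.inr (Sum.inl i)))) (fun i => F (x (Sum.inl i))) p q := by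
  by_cases h : p < q
  · have h1 := allEntry_lam (κ := κ)
      (fun i => F (glue (srcSplit l κ) x z t (Sum.inr (Sum.inl i))))
      (fun i => F (glue (srcSplit l κ) x z t (Sum.inl i)))
      (lamCast ⟨(⟨p, h.trans hq⟩, ⟨q, hq⟩), h⟩)
    rw [glue_src_lam] at h1
    have h2 := allEntry_lam (κ := κ) (fun i => F (x (Sum.inr (Sum.inl i))))
      (fun i => F (x (Sum.inl i))) ⟨(⟨p, h.trans hq⟩, ⟨q, hq⟩), h⟩
    exact h1.trans h2.symm
  · by_cases h' : p - q < κ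
    · have hpq : p - q + q = p := by omega
      have h1 := allEntry_perp (κ := κ)
        (fun i => F (glue (srcSplit l κ) x z t (Sum.inr (Sum.inl i))))
        (fun i => F (glue (srcSplit l κ) x z t (Sum.inl i))) (⟨p - q, h'⟩, Fin.castSucc ⟨q, hq⟩)
      rw [glue_src_inl] at h1
      have h2 := allEntry_perp (κ := κ) (fun i => F (x (Sum.inr (Sum.inl i))))
        (fun i => F (x (Sum.inl i))) (⟨p - q, h'⟩, ⟨q, hq⟩)
      simp only [Fin.val_castSucc, hpq] at h1 h2
      exact h1.trans h2.symm
    · simp [allEntry, h, h']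

theorem allEntry_glue_last (F : ℝ → ℝ) (v : VecIdx l κ) :
    allEntry (fun i => F (glue (srcSplit l κ) x z t (Sum.inr (Sum.inl i))))
        (fun i => F (glue (srcSplit l κ) x z t (Sum.inl i))) (rowEquiv l κ v) l = F (z v) := by
  rcases v with k | i
  · have h1 := allEntry_perp (κ := κ)
      (fun i => F (glue (srcSplit l κ) x z t (Sum.inr (Sum.inl i))))
      (fun i => F (glue (srcSplit l κ) x z t (Sum.inl i))) (k, Fin.last l)
    rw [glue_src_inl_last] at h1
    simpa [add_comm] using h1
  · have h1 := allEntry_lam (κ := κ)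
      (fun i => F (glue (srcSplit l κ) x z t (Sum.inr (Sum.inl i))))
      (fun i => F (glue (srcSplit l κ) x z t (Sum.inl i)))
      ⟨(i.castSucc, Fin.last l), Fin.castSucc_lt_last i⟩
    rw [glue_src_lam_last] at h1
    simpa using h1

theorem srcCoord_glue {j a : ℕ} (hj : j ≤ l) :
    srcCoord (glue (srcSplit l κ) x z t) j a = srcCoord x j a :=
  frameCoord_congr (fun _ _ hq _ => allEntry_glue x z t (fun y => Real.cos (Real.arccos y))
      (by omega))
    (fun _ _ hq _ => allEntry_glue x z t (fun y => Real.sin (Real.arccos y)) (by omega))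
    fun _ hq => normEntry_glue x z t (by omega)

/-- The coordinates of the new vector in the last frame. -/
def newCoord (z : VecIdx l κ → ℝ) (t : ℝ) (v : VecIdx l κ) : ℝ :=
  ballPoint (Real.sqrt t) (z ∘ (rowEquiv l κ).symm) (rowEquiv l κ v)

theorem coordMatrix_mulVec (v : VecIdx l κ) :
    (coordMatrix x *ᵥ newCoord z t) v =
      Real.sqrt t * srcCoord (glue (srcSplit l κ) x z t) (l + 1) (posEquiv l κ v + 1) 0 := by
  set y := glue (srcSplit l κ) x z t with hy
  have hrow : ∀ b : Fin (l + κ), radEntry (z ∘ (rowEquiv l κ).symm) b = z ((rowEquiv l κ).symm b) :=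
    fun b => radEntry_val _ b
  have hc : ∀ b : Fin (l + κ), cosEntry y b l = Real.cos (Real.arccos (z ((rowEquiv l κ).symm b))) := by
    intro b
    have := allEntry_glue_last x z t (fun y => Real.cos (Real.arccos y)) ((rowEquiv l κ).symm b)
    rwa [Equiv.apply_symm_apply] at this
  have hs : ∀ b : Fin (l + κ), sinEntry y b l = Real.sin (Real.arccos (z ((rowEquiv l κ).symm b))) := by
    intro b
    have := allEntry_glue_last x z t (fun y => Real.sin (Real.arccos y)) ((rowEquiv l κ).symm b)
    rwa [Equiv.apply_symm_apply] at this
  have h1 : srcCoord y (l + 1) (posEquiv l κ v + 1) 0 =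
      tailDot (fun p => cosEntry y p l) (fun p => sinEntry y p l)
        (srcCoord x l (posEquiv l κ v)) 0 (l + κ) := by
    rw [srcCoord, frameCoord_succ_succ _ _ _ _ _ (posEquiv l κ v).2, ← srcCoord_glue x z t le_rfl]
    rfl
  rw [h1, tailDot_eq_sum, Finset.mul_sum,
    ← Fin.sum_univ_eq_sum_range (fun b => Real.sqrt t * (srcCoord x l (posEquiv l κ v) (0 + b) *
      (cosEntry y (0 + b) l * ∏ p ∈ Finset.range b, sinEntry y (0 + p) l))),
    ← (rowEquiv l κ).sum_comp]
  simp only [mulVec, dotProduct, coordMatrix, of_apply, newCoord, ballPoint, zero_add]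
  refine Finset.sum_congr rfl fun q _ => ?_
  rw [hc]
  have h2 : ∏ p ∈ Finset.range (rowEquiv l κ q), Real.sin (Real.arccos
      (radEntry (z ∘ (rowEquiv l κ).symm) p)) =
      ∏ p ∈ Finset.range (rowEquiv l κ q), sinEntry y p l := by
    refine Finset.prod_congr rfl fun p hp => ?_
    have hp : p < l + κ := (Finset.mem_range.1 hp).trans (rowEquiv l κ q).2
    rw [hs ⟨p, hp⟩, hrow ⟨p, hp⟩]
  rw [h2, Function.comp_apply]
  ring

theorem bigMap_glue :
    bigMap (glue (srcSplit l κ) x z t) =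
      glue (tgtSplit l κ) (bigMap x) (coordMatrix x *ᵥ newCoord z t) t := by
  funext i
  obtain ⟨i, rfl⟩ := (tgtSplit l κ).surjective i
  rcases i with (⟨k, j⟩ | p) | (k | i) | u
  · rw [glue_inl, bigMap_inl]
    show bigMap _ (Sum.inl (k, j.castSucc)) = _
    rw [bigMap_inl]
    simp only [Fin.val_castSucc]
    rw [normEntry_glue _ _ _ j.2, srcCoord_glue _ _ _ (by omega)]
  · rw [glue_inl]
    show bigMap _ (Sum.inr (symCast p)) = _
    by_cases h : p.1.1 < p.1.2
    · rw [bigMap_inr_lt _ _ h, bigMap_inr_lt _ _ (Fin.castSucc_lt_castSucc_iff.2 h)]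
      simp only [symCast, Fin.val_castSucc]
      rw [normEntry_glue _ _ _ p.1.2.2, srcCoord_glue _ _ _ (by have := p.1.2.2; omega)]
    · rw [bigMap_inr_diag _ _ h, bigMap_inr_diag _ _ (fun h' => h (Fin.castSucc_lt_castSucc_iff.1 h'))]
      exact glue_src_rad x z t p.1.1
  · rw [glue_inr_inl, coordMatrix_mulVec]
    show bigMap _ (Sum.inl (k, Fin.last l)) = _
    rw [bigMap_inl]
    simp only [Fin.val_last, normEntry_glue_last, posEquiv_inl, add_comm l]
  · rw [glue_inr_inl, coordMatrix_mulVec]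
    show bigMap _ (Sum.inr ⟨(i.castSucc, Fin.last l), Fin.le_last _⟩) = _
    rw [bigMap_inr_lt _ _ (Fin.castSucc_lt_last i)]
    simp only [Fin.val_last, normEntry_glue_last, posEquiv_inr, Fin.val_castSucc]
    rw [show l - ((i : ℕ) + 1) + 1 = l - i by have := i.2; omega]
  · rw [glue_inr_inr]
    show bigMap _ (Sum.inr ⟨(Fin.last l, Fin.last l), le_rfl⟩) = _
    rw [bigMap_inr_diag _ _ (by simp)]
    exact glue_src_rad_last x z t

end Glue

/-- The labels of the vectors with one more vector. -/
def vecSplit (l κ : ℕ) : VecIdx l κ ⊕ Unit ≃ VecIdx (l + 1) κ :=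
  (Equiv.sumAssoc _ _ _).trans (Equiv.sumCongr (Equiv.refl _)
    ((Equiv.sumCongr (Equiv.refl _) (Equiv.ofUnique Unit (Fin 1))).trans finSumFinEquiv))

theorem vecSplit_inl_inl (k : Fin κ) : vecSplit l κ (Sum.inl (Sum.inl k)) = Sum.inl k := rfl

theorem vecSplit_inl_inr (i : Fin l) :
    vecSplit l κ (Sum.inl (Sum.inr i)) = Sum.inr i.castSucc := rfl

theorem vecSplit_inr (u : Unit) : vecSplit l κ (Sum.inr u) = Sum.inr (Fin.last l) := rfl

theorem bigGram_glue (y : TgtIdx l κ → ℝ) (w : VecIdx l κ → ℝ) (t : ℝ) :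
    (bigGram (glue (tgtSplit l κ) y w t)).submatrix (vecSplit l κ) (vecSplit l κ) =
      bordered (bigGram y) w t := by
  set g := glue (tgtSplit l κ) y w t with hg
  have h1 : ∀ (k : Fin κ) (j : Fin l), g (Sum.inl (k, j.castSucc)) = y (Sum.inl (k, j)) :=
    fun k j => glue_inl (tgtSplit l κ) y w t (Sum.inl (k, j))
  have h2 : ∀ p : SymIdx l, g (Sum.inr (symCast p)) = y (Sum.inr p) :=
    fun p => glue_inl (tgtSplit l κ) y w t (Sum.inr p)
  have h3 : ∀ k : Fin κ, g (Sum.inl (k, Fin.last l)) = w (Sum.inl k) :=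
    fun k => glue_inr_inl (tgtSplit l κ) y w t (Sum.inl k)
  have h4 : ∀ i : Fin l, g (Sum.inr ⟨(i.castSucc, Fin.last l), Fin.le_last _⟩) = w (Sum.inr i) :=
    fun i => glue_inr_inl (tgtSplit l κ) y w t (Sum.inr i)
  have h5 : g (Sum.inr ⟨(Fin.last l, Fin.last l), le_rfl⟩) = t :=
    glue_inr_inr (tgtSplit l κ) y w t ()
  have hmm : ∀ i j : Fin l, symMatrix (fun p => g (Sum.inr p)) i.castSucc j.castSucc =
      symMatrix (fun p => y (Sum.inr p)) i j := by
    intro i j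
    simp only [symMatrix]
    rw [← h2]
    congr 2
  have hml : ∀ i : Fin l, symMatrix (fun p => g (Sum.inr p)) i.castSucc (Fin.last l) =
      w (Sum.inr i) := by
    intro i
    rw [← h4]
    simp only [symMatrix]
    congr 3
    exact Prod.ext (min_eq_left (Fin.le_last _)) (max_eq_right (Fin.le_last _))
  have hlm : ∀ i : Fin l, symMatrix (fun p => g (Sum.inr p)) (Fin.last l) i.castSucc =
      w (Sum.inr i) := by
    intro i
    rw [← hml]
    simp only [symMatrix, min_comm, max_comm]
  have hll : symMatrix (fun p => g (Sum.inr p)) (Fin.last l) (Fin.last l) = t := by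
    rw [← h5]
    simp only [symMatrix, min_self, max_self]
  ext v v'
  rcases v with (k | i) | u <;> rcases v' with (k' | i') | u' <;>
    simp only [submatrix_apply, vecSplit_inl_inl, vecSplit_inl_inr, vecSplit_inr, bigGram, bordered,
      fromBlocks_apply₁₁, fromBlocks_apply₁₂, fromBlocks_apply₂₁, fromBlocks_apply₂₂, of_apply,
      transpose_apply, h1, h3, hmm, hml, hlm, hll, replicateCol_apply, replicateRow_apply]

end Stage

/-! ### The change of variables for Gram matrices -/

section ChangeOfVariables

open Matrix
open scoped ENNReal

theorem sinWeight_ne_top (e : ℕ) (c : ℝ) : sinWeight e c ≠ ⊤ := by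
  unfold sinWeight; split_ifs <;> simp

theorem radWeight_ne_top (e : ℕ) (t : ℝ) : radWeight e t ≠ ⊤ := by
  unfold radWeight; split_ifs <;> simp

/-- The factors of the Jacobian, variable by variable. -/
def srcWeight (l κ : ℕ) : SrcIdx l κ → ℝ → ℝ≥0∞ :=
  Sum.elim (fun p => sinWeight (l + κ - 2 - (p.1 + p.2)))
    (Sum.elim (fun p => sinWeight (l + κ - 2 - p.1.1)) fun _ => radWeight (l + κ - 1))

/-- The Jacobian of `bigMap`, extended by `0` outside the domain of the variables. -/
def srcDensity {l κ : ℕ} (x : SrcIdx l κ → ℝ) : ℝ≥0∞ := ∏ i, srcWeight l κ i (x i)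

/-- The factors of the determinant of `coordMatrix`, variable by variable. -/
def srcFactor (l κ : ℕ) : SrcIdx l κ → ℝ → ℝ :=
  Sum.elim (fun _ c => Real.sin (Real.arccos c))
    (Sum.elim (fun _ c => Real.sin (Real.arccos c)) fun _ t => Real.sqrt t)

variable {l κ : ℕ}

theorem srcFactor_nonneg (i : SrcIdx l κ) (a : ℝ) : 0 ≤ srcFactor l κ i a := by
  rcases i with p | p | p
  · exact sin_arccos_nonneg a
  · exact sin_arccos_nonneg a
  · exact Real.sqrt_nonneg a

theorem prod_normEntry_sinEntry (x : SrcIdx l κ → ℝ) :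
    ∏ j ∈ Finset.range l, (normEntry x j * ∏ p ∈ Finset.range (j + κ), sinEntry x p j) =
      ∏ i, srcFactor l κ i (x i) := by
  rw [prod_srcIdx l κ (sinEntry x) (normEntry x)]
  refine Finset.prod_congr rfl fun i _ => ?_
  rcases i with p | p | p
  · exact allEntry_perp (fun i => Real.sin (Real.arccos (x (Sum.inr (Sum.inl i)))))
      (fun i => Real.sin (Real.arccos (x (Sum.inl i)))) p
  · exact allEntry_lam (κ := κ) (fun i => Real.sin (Real.arccos (x (Sum.inr (Sum.inl i)))))
      (fun i => Real.sin (Real.arccos (x (Sum.inl i)))) p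
  · exact radEntry_val (fun i => Real.sqrt (x (Sum.inr (Sum.inr i)))) p

theorem ofReal_abs_det_coordMatrix (x : SrcIdx l κ → ℝ) :
    ENNReal.ofReal |(coordMatrix x).det| = ∏ i, ENNReal.ofReal (srcFactor l κ i (x i)) := by
  rw [abs_det_coordMatrix, prod_normEntry_sinEntry,
    abs_of_nonneg (Finset.prod_nonneg fun i _ => srcFactor_nonneg i _),
    ENNReal.ofReal_prod_of_nonneg fun i _ => srcFactor_nonneg i _]

theorem srcWeight_srcSplit_inl (i : SrcIdx l κ) (a : ℝ) :
    srcWeight (l + 1) κ (srcSplit l κ (Sum.inl i)) a =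
      srcWeight l κ i a * ENNReal.ofReal (srcFactor l κ i a) := by
  rcases i with ⟨k, j⟩ | p | i
  · have hj := j.2
    have hk := k.2
    have h : l + 1 + κ - 2 - ((k : ℕ) + j) = l + κ - 2 - (k + j) + 1 := by omega
    exact (congrArg (fun e => sinWeight e a) h).trans (sinWeight_succ _ _)
  · have h1 := p.1.2.2
    have h2 : (p.1.1 : ℕ) < p.1.2 := p.2
    have h : l + 1 + κ - 2 - (p.1.1 : ℕ) = l + κ - 2 - p.1.1 + 1 := by omega
    exact (congrArg (fun e => sinWeight e a) h).trans (sinWeight_succ _ _)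
  · have hi := i.2
    have h : l + 1 + κ - 1 = l + κ - 1 + 1 := by omega
    exact (congrArg (fun e => radWeight e a) h).trans (radWeight_succ _ _)

theorem srcDensity_glue (x : SrcIdx l κ → ℝ) (z : VecIdx l κ → ℝ) (t : ℝ) :
    srcDensity (glue (srcSplit l κ) x z t) =
      srcDensity x * ENNReal.ofReal |(coordMatrix x).det| *
        (radWeight (l + κ) t *
          ∏ b : Fin (l + κ), sinWeight (l + κ - 1 - b) (z ((rowEquiv l κ).symm b))) := by
  rw [srcDensity, ← (srcSplit l κ).prod_comp, Fintype.prod_sum_type,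
    Fintype.prod_sum_type (α₁ := VecIdx l κ)]
  congr 1
  · rw [ofReal_abs_det_coordMatrix, srcDensity, ← Finset.prod_mul_distrib]
    refine Finset.prod_congr rfl fun i _ => ?_
    rw [glue_inl, srcWeight_srcSplit_inl]
  · rw [mul_comm]
    congr 1
    · rw [Fintype.prod_unique, glue_inr_inr]
      show radWeight (l + 1 + κ - 1) t = _
      rw [show l + 1 + κ - 1 = l + κ by omega]
    · rw [← (rowEquiv l κ).prod_comp]
      refine Finset.prod_congr rfl fun v _ => ?_
      rw [glue_inr_inl, Equiv.symm_apply_apply]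
      rcases v with k | i
      · rw [rowEquiv_inl]
        show sinWeight (l + 1 + κ - 2 - ((k : ℕ) + l)) _ = _
        rw [show l + 1 + κ - 2 - ((k : ℕ) + l) = l + κ - 1 - (l + k) by omega]
      · rw [rowEquiv_inr]
        show sinWeight (l + 1 + κ - 2 - (i : ℕ)) _ = _
        rw [show l + 1 + κ - 2 - (i : ℕ) = l + κ - 1 - i by omega]

theorem srcDensity_ne_top (x : SrcIdx l κ → ℝ) : srcDensity x ≠ ⊤ := by
  refine ENNReal.prod_ne_top fun i _ => ?_
  rcases i with p | p | p
  · exact sinWeight_ne_top _ _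
  · exact sinWeight_ne_top _ _
  · exact radWeight_ne_top _ _

theorem mem_of_srcDensity_ne_zero {x : SrcIdx l κ → ℝ} (h : srcDensity x ≠ 0) :
    (∀ p, x (Sum.inl p) ∈ Set.Ioo (-1 : ℝ) 1) ∧
      (∀ p, x (Sum.inr (Sum.inl p)) ∈ Set.Ioo (-1 : ℝ) 1) ∧ ∀ i, 0 < x (Sum.inr (Sum.inr i)) := by
  have h' := Finset.prod_ne_zero_iff.1 h
  refine ⟨fun p => ?_, fun p => ?_, fun p => ?_⟩
  · have := h' (Sum.inl p) (Finset.mem_univ _)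
    by_contra hc
    exact this (if_neg hc)
  · have := h' (Sum.inr (Sum.inl p)) (Finset.mem_univ _)
    by_contra hc
    exact this (if_neg hc)
  · have := h' (Sum.inr (Sum.inr p)) (Finset.mem_univ _)
    by_contra hc
    exact this (if_neg hc)

theorem srcFactor_pos {x : SrcIdx l κ → ℝ} (h : srcDensity x ≠ 0) (i : SrcIdx l κ) :
    0 < srcFactor l κ i (x i) := by
  obtain ⟨h1, h2, h3⟩ := mem_of_srcDensity_ne_zero h
  rcases i with p | p | p
  · exact sin_arccos_pos (h1 p)
  · exact sin_arccos_pos (h2 p)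
  · exact Real.sqrt_pos.2 (h3 p)

theorem det_coordMatrix_ne_zero {x : SrcIdx l κ → ℝ} (h : srcDensity x ≠ 0) :
    (coordMatrix x).det ≠ 0 := by
  rw [← abs_ne_zero, abs_det_coordMatrix, prod_normEntry_sinEntry, abs_ne_zero]
  exact Finset.prod_ne_zero_iff.2 fun i _ => (srcFactor_pos h i).ne'

theorem measurable_srcDensity : Measurable (srcDensity : (SrcIdx l κ → ℝ) → ℝ≥0∞) := by
  refine Finset.measurable_prod _ fun i _ => ?_
  rcases i with p | p | p
  · exact (measurable_sinWeight _).comp (measurable_pi_apply _)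
  · exact (measurable_sinWeight _).comp (measurable_pi_apply _)
  · exact (measurable_radWeight _).comp (measurable_pi_apply _)

theorem measurable_eval {X σ : Type*} [Fintype σ] [MeasurableSpace X] (P : MvPolynomial σ ℝ)
    {g : X → σ → ℝ} (hg : ∀ i, Measurable fun x => g x i) :
    Measurable fun x => MvPolynomial.eval (g x) P :=
  (MvPolynomial.continuous_eval P).measurable.comp (measurable_pi_lambda _ hg)

theorem measurable_lamUpper (T : PolyMap l κ) :
    Measurable fun z : (Fin l → ℝ) × (LamIdx l → ℝ) => T.lamUpper z.1 (angles z.2) := by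
  have h := Real.continuous_arccos.measurable
  refine measurable_pi_lambda _ fun p => ?_
  unfold PolyMap.lamUpper
  split_ifs
  · refine measurable_eval _ fun i => ?_
    rcases i with i | i | i
    · simp only [lamPoint, Sum.elim_inl]; fun_prop
    · simp only [lamPoint, Sum.elim_inl, Sum.elim_inr, angles]; fun_prop
    · simp only [lamPoint, Sum.elim_inr, angles]; fun_prop
  · fun_prop

theorem measurable_perpComp (T : PolyMap l κ) (k : Fin κ) (j : Fin l) :
    Measurable fun z : (Fin l → ℝ) × (LamIdx l → ℝ) × (PerpIdx l κ → ℝ) =>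
      T.perpComp z.1 (angles z.2.1) (angles z.2.2) k j := by
  have h := Real.continuous_arccos.measurable
  unfold PolyMap.perpComp
  refine measurable_eval _ fun i => ?_
  rcases i with (i | i | i) | i | i
  · simp only [perpPoint, lamPoint, Sum.elim_inl]; fun_prop
  · simp only [perpPoint, lamPoint, Sum.elim_inl, Sum.elim_inr, angles]; fun_prop
  · simp only [perpPoint, lamPoint, Sum.elim_inl, Sum.elim_inr, angles]; fun_prop
  · simp only [perpPoint, Sum.elim_inl, Sum.elim_inr, angles]; fun_prop
  · simp only [perpPoint, Sum.elim_inr, angles]; fun_prop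

theorem measurable_bigMap : Measurable (bigMap : (SrcIdx l κ → ℝ) → TgtIdx l κ → ℝ) := by
  refine measurable_pi_lambda _ fun i => ?_
  rcases i with p | p
  · have := (measurable_perpComp (nestedMap l κ) p.1 p.2).comp (by fun_prop :
      Measurable fun x : SrcIdx l κ → ℝ => ((fun i => x (Sum.inr (Sum.inr i)) : Fin l → ℝ),
        (fun i => x (Sum.inr (Sum.inl i)) : LamIdx l → ℝ), (fun i => x (Sum.inl i) :
          PerpIdx l κ → ℝ)))
    exact this
  · have := (measurable_pi_apply p).comp ((measurable_lamUpper (nestedMap l κ)).comp (by fun_prop :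
      Measurable fun x : SrcIdx l κ → ℝ => ((fun i => x (Sum.inr (Sum.inr i)) : Fin l → ℝ),
        (fun i => x (Sum.inr (Sum.inl i)) : LamIdx l → ℝ))))
    exact this

theorem measurableSet_bigGram_posDef :
    MeasurableSet {y : TgtIdx l κ → ℝ | (bigGram y).PosDef} := by
  refine measurableSet_posDef fun v v' => ?_
  rcases v with k | i <;> rcases v' with k' | i' <;>
    simp only [bigGram, fromBlocks_apply₁₁, fromBlocks_apply₁₂, fromBlocks_apply₂₁,
      fromBlocks_apply₂₂, transpose_apply, of_apply, symMatrix] <;> fun_prop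

theorem bigGram_posDef_glue_iff (y : TgtIdx l κ → ℝ) (w : VecIdx l κ → ℝ) (t : ℝ) :
    (bigGram (glue (tgtSplit l κ) y w t)).PosDef ↔ (bordered (bigGram y) w t).PosDef := by
  rw [← bigGram_glue]
  constructor
  · exact fun h => h.submatrix (vecSplit l κ).injective
  · intro h
    have := h.submatrix (vecSplit l κ).symm.injective
    simpa using this

theorem posDef_of_empty {V : Type*} [Fintype V] [IsEmpty V] (M : Matrix V V ℝ) : M.PosDef :=
  PosDef.of_dotProduct_mulVec_pos (Matrix.ext fun i => isEmptyElim i)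
    fun x hx => absurd (Subsingleton.elim x 0) hx

theorem lintegral_reindex {ι ι' : Type} [Fintype ι] [Fintype ι'] (e : ι ≃ ι')
    (f : (ι → ℝ) → ℝ≥0∞) : ∫⁻ x, f x = ∫⁻ y : ι' → ℝ, f (y ∘ e) := by
  have h := volume_measurePreserving_piCongrLeft (fun _ : ι' => ℝ) e
  rw [← h.lintegral_comp_emb (MeasurableEquiv.measurableEmbedding _)]
  refine lintegral_congr fun x => ?_
  congr 1
  funext i
  exact (MeasurableEquiv.piCongrLeft_apply_apply (β := fun _ : ι' => ℝ) e x i).symm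

/-- Integration over one more vector: linear change of variables to the coordinates in the last
frame, followed by spherical coordinates. -/
theorem lintegral_new_vector {x : SrcIdx l κ → ℝ} (hx : srcDensity x ≠ 0)
    {F : (TgtIdx (l + 1) κ → ℝ) → ℝ≥0∞} (hF : Measurable F) (t : ℝ) :
    ∫⁻ w, {y | (bigGram y).PosDef}.indicator F (glue (tgtSplit l κ) (bigMap x) w t) =
      ∫⁻ z, ENNReal.ofReal |(coordMatrix x).det| * ((radWeight (l + κ) t *
        ∏ b : Fin (l + κ), sinWeight (l + κ - 1 - b) (z ((rowEquiv l κ).symm b))) *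
          F (bigMap (glue (srcSplit l κ) x z t))) := by
  have hdet := det_coordMatrix_ne_zero hx
  have hgl : Measurable fun w : VecIdx l κ → ℝ => glue (tgtSplit l κ) (bigMap x) w t :=
    (measurable_glue (tgtSplit l κ)).comp (by fun_prop :
      Measurable fun w : VecIdx l κ → ℝ => (bigMap x, w, t))
  have hmul : Measurable fun X : VecIdx l κ → ℝ => coordMatrix x *ᵥ X :=
    (LinearMap.continuous_on_pi (Matrix.mulVecLin (coordMatrix x))).measurable
  rw [lintegral_mulVec (G := fun w => {y | (bigGram y).PosDef}.indicator F
      (glue (tgtSplit l κ) (bigMap x) w t)) hdet ((hF.indicator measurableSet_bigGram_posDef).comp hgl),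
    lintegral_const_mul' _ _ ENNReal.ofReal_ne_top]
  congr 1
  have hpd : ∀ X : VecIdx l κ → ℝ,
      {y | (bigGram y).PosDef}.indicator F
        (glue (tgtSplit l κ) (bigMap x) (coordMatrix x *ᵥ X) t) =
      {X : VecIdx l κ → ℝ | ∑ i, X i ^ 2 < t}.indicator
        (fun X => F (glue (tgtSplit l κ) (bigMap x) (coordMatrix x *ᵥ X) t)) X := by
    intro X
    have hiff : glue (tgtSplit l κ) (bigMap x) (coordMatrix x *ᵥ X) t ∈
        {y : TgtIdx (l + 1) κ → ℝ | (bigGram y).PosDef} ↔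
        ∑ i, X i ^ 2 < t := by
      rw [Set.mem_ofPred_eq, bigGram_posDef_glue_iff, ← coordMatrix_mul_transpose x
        (fun i => ((mem_of_srcDensity_ne_zero hx).2.2 i).le), posDef_bordered_mul_transpose hdet]
    by_cases h : ∑ i, X i ^ 2 < t
    · rw [Set.indicator_of_mem (hiff.2 h), Set.indicator_of_mem
        (show X ∈ {X : VecIdx l κ → ℝ | ∑ i, X i ^ 2 < t} from h)]
    · rw [Set.indicator_of_notMem fun h' => h (hiff.1 h'),
        Set.indicator_of_notMem (show X ∉ {X : VecIdx l κ → ℝ | ∑ i, X i ^ 2 < t} from h)]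
  simp only [hpd]
  -- for `t ≤ 0` the ball is empty, and so is the support of the weight
  by_cases ht : 0 < t
  · rw [lintegral_reindex (rowEquiv l κ)]
    have hsum : ∀ X : Fin (l + κ) → ℝ, {X : VecIdx l κ → ℝ | ∑ i, X i ^ 2 < t}.indicator
        (fun X => F (glue (tgtSplit l κ) (bigMap x) (coordMatrix x *ᵥ X) t)) (X ∘ rowEquiv l κ) =
        {X : Fin (l + κ) → ℝ | ∑ i, X i ^ 2 < Real.sqrt t ^ 2}.indicator
        (fun X => F (glue (tgtSplit l κ) (bigMap x)
          (coordMatrix x *ᵥ (X ∘ rowEquiv l κ)) t)) X := by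
      intro X
      have := (rowEquiv l κ).sum_comp fun i => X i ^ 2
      simp only [Set.indicator_apply, Set.mem_ofPred_eq, Function.comp_apply, this,
        Real.sq_sqrt ht.le]
    simp only [hsum]
    have hre : Measurable fun X : Fin (l + κ) → ℝ => (X ∘ rowEquiv l κ : VecIdx l κ → ℝ) :=
      measurable_pi_lambda _ fun i => measurable_pi_apply _
    rw [lintegral_ball_eq (F := fun X => F (glue (tgtSplit l κ) (bigMap x)
      (coordMatrix x *ᵥ (X ∘ rowEquiv l κ)) t)) (hF.comp (hgl.comp (hmul.comp hre)))
      (Real.sqrt_pos.2 ht), lintegral_reindex (rowEquiv l κ).symm]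
    refine lintegral_congr fun z => ?_
    rw [bigMap_glue, radWeight, if_pos ht]
    rfl
  · have h0 : ∀ X : VecIdx l κ → ℝ, {X : VecIdx l κ → ℝ | ∑ i, X i ^ 2 < t}.indicator
        (fun X => F (glue (tgtSplit l κ) (bigMap x) (coordMatrix x *ᵥ X) t)) X = 0 := by
      intro X
      refine Set.indicator_of_notMem ?_ _
      have : 0 ≤ ∑ i, X i ^ 2 := Finset.sum_nonneg fun _ _ => sq_nonneg _
      simp only [Set.mem_ofPred_eq, not_lt]
      linarith
    simp only [h0, radWeight, if_neg ht, zero_mul]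

/-- The change of variables from the components `a_kj` and the scalar products `λ_ij` to norms and
nested angles. -/
theorem lintegral_bigMap (l κ : ℕ) {F : (TgtIdx l κ → ℝ) → ℝ≥0∞} (hF : Measurable F) :
    ∫⁻ y, {y | (bigGram y).PosDef}.indicator F y = ∫⁻ x, srcDensity x * F (bigMap x) := by
  induction l with
  | zero =>
    have : IsEmpty (LamIdx 0) := ⟨fun p => p.1.1.elim0⟩
    have : IsEmpty (SymIdx 0) := ⟨fun p => p.1.1.elim0⟩
    have h1 := Measure.volume_pi_eq_dirac (α := fun _ : TgtIdx 0 κ => ℝ) (fun _ => 0)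
    have h2 := Measure.volume_pi_eq_dirac (α := fun _ : SrcIdx 0 κ => ℝ) (fun _ => 0)
    have hpd : ∀ y : TgtIdx 0 κ → ℝ, (bigGram y).PosDef := fun y => by
      rw [bigGram, posDef_fromBlocks_one_iff]
      exact posDef_of_empty _
    simp only [Set.indicator_apply, Set.mem_ofPred_eq, hpd, if_true]
    rw [h1, h2, lintegral_dirac, lintegral_dirac]
    simp only [srcDensity, Finset.univ_eq_empty, Finset.prod_empty, one_mul]
    congr 1
    exact Subsingleton.elim _ _
  | succ l ih =>
    have hind := hF.indicator (measurableSet_bigGram_posDef (l := l + 1) (κ := κ))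
    have hgt := measurable_glue (tgtSplit l κ)
    have hgs := measurable_glue (srcSplit l κ)
    have hR : Measurable fun x : SrcIdx (l + 1) κ → ℝ => srcDensity x * F (bigMap x) :=
      measurable_srcDensity.mul (hF.comp measurable_bigMap)
    rw [lintegral_glue (tgtSplit l κ) hind, lintegral_glue (srcSplit l κ) hR]
    let F' : (TgtIdx l κ → ℝ) → ℝ≥0∞ := fun y => ∫⁻ w : VecIdx l κ → ℝ, ∫⁻ t : ℝ,
      {y | (bigGram y).PosDef}.indicator F (glue (tgtSplit l κ) y w t)
    have hF' : Measurable F' := by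
      refine Measurable.lintegral_prod_right' (f := fun z : (TgtIdx l κ → ℝ) × (VecIdx l κ → ℝ) =>
        ∫⁻ t : ℝ, {y | (bigGram y).PosDef}.indicator F (glue (tgtSplit l κ) z.1 z.2 t)) ?_
      refine Measurable.lintegral_prod_right' (f := fun z : ((TgtIdx l κ → ℝ) ×
        (VecIdx l κ → ℝ)) × ℝ =>
        {y | (bigGram y).PosDef}.indicator F (glue (tgtSplit l κ) z.1.1 z.1.2 z.2)) ?_
      exact hind.comp (hgt.comp (by fun_prop :
        Measurable fun z : ((TgtIdx l κ → ℝ) × (VecIdx l κ → ℝ)) × ℝ => (z.1.1, z.1.2, z.2)))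
    -- principal submatrices of positive definite matrices are positive definite, so the integral over the
    -- last column vanishes unless the Gram matrix of the earlier vectors is positive definite
    have hsupp : ∀ y, F' y = {y | (bigGram y).PosDef}.indicator F' y := by
      intro y
      by_cases hy : (bigGram y).PosDef
      · exact (Set.indicator_of_mem (show y ∈ {y | (bigGram y).PosDef} from hy) _).symm
      · rw [Set.indicator_of_notMem (show y ∉ {y | (bigGram y).PosDef} from hy)]
        have h0 : ∀ w t, {y | (bigGram y).PosDef}.indicator F (glue (tgtSplit l κ) y w t) = 0 := by
          intro w t
          refine Set.indicator_of_notMem (fun h => hy ?_) _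
          have h' := (bigGram_posDef_glue_iff y w t).1 h
          exact h'.submatrix (e := Sum.inl) Sum.inl_injective
        simp only [F', h0, lintegral_zero]
    calc ∫⁻ y, F' y = ∫⁻ y, {y | (bigGram y).PosDef}.indicator F' y := lintegral_congr hsupp
      _ = ∫⁻ x : SrcIdx l κ → ℝ, srcDensity x * F' (bigMap x) := ih hF'
      _ = _ := by
        refine lintegral_congr fun x => ?_
        by_cases hx : srcDensity x = 0
        · simp only [srcDensity_glue, hx, zero_mul, lintegral_zero]
        · have hmt : Measurable fun z : (VecIdx l κ → ℝ) × ℝ =>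
              {y | (bigGram y).PosDef}.indicator F (glue (tgtSplit l κ) (bigMap x) z.1 z.2) :=
            hind.comp (hgt.comp (by fun_prop :
              Measurable fun z : (VecIdx l κ → ℝ) × ℝ => (bigMap x, z.1, z.2)))
          have hms : Measurable fun z : (VecIdx l κ → ℝ) × ℝ =>
              srcDensity (glue (srcSplit l κ) x z.1 z.2) *
                F (bigMap (glue (srcSplit l κ) x z.1 z.2)) :=
            hR.comp (hgs.comp (by fun_prop :
              Measurable fun z : (VecIdx l κ → ℝ) × ℝ => (x, z.1, z.2)))
          simp only [F']
          rw [lintegral_lintegral_swap hmt.aemeasurable,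
            lintegral_lintegral_swap (f := fun w t => srcDensity (glue (srcSplit l κ) x w t) *
              F (bigMap (glue (srcSplit l κ) x w t))) hms.aemeasurable,
            ← lintegral_const_mul' _ _ (srcDensity_ne_top x)]
          refine lintegral_congr fun t => ?_
          rw [lintegral_new_vector hx hF t, ← lintegral_const_mul' _ _ (srcDensity_ne_top x)]
          refine lintegral_congr fun z => ?_
          rw [srcDensity_glue]
          ring

end ChangeOfVariables

/-! ### The change of variables as a statement about measures -/

section Pushforward

open Matrix
open scoped ENNReal

instance sigmaFinite_radialMeasure (l : ℕ) : SigmaFinite (radialMeasure l) := by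
  unfold radialMeasure; infer_instance

instance sigmaFinite_cosMeasure (ι : Type) [Fintype ι] : SigmaFinite (cosMeasure ι) := by
  unfold cosMeasure; infer_instance

instance sigmaFinite_gramMeasure (l : ℕ) : SigmaFinite (gramMeasure l) := by
  unfold gramMeasure; infer_instance

variable {l κ : ℕ}

/-- The variables `λ_ii`, `cos Θ_Λ`, `cos Θ_⊥`. -/
abbrev SrcSpace (l κ : ℕ) : Type := (Fin l → ℝ) × (LamIdx l → ℝ) × (PerpIdx l κ → ℝ)

/-- The measure `∏ dλ_ii ∏ d cos Θ_Λ ∏ d cos Θ_⊥`. -/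
def srcMeasure (l κ : ℕ) : Measure (SrcSpace l κ) :=
  (radialMeasure l).prod ((cosMeasure (LamIdx l)).prod (cosMeasure (PerpIdx l κ)))

instance sigmaFinite_srcMeasure (l κ : ℕ) : SigmaFinite (srcMeasure l κ) := by
  unfold srcMeasure; infer_instance

/-- The variables `λ_ii`, `cos Θ_Λ`, `cos Θ_⊥` as one family. -/
def srcPoint (z : SrcSpace l κ) : SrcIdx l κ → ℝ := Sum.elim z.2.2 (Sum.elim z.2.1 z.1)

theorem measurePreserving_srcPoint :
    MeasurePreserving (srcPoint : SrcSpace l κ → SrcIdx l κ → ℝ) volume volume := by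
  have h1 : MeasurePreserving (Prod.swap : (Fin l → ℝ) × ((LamIdx l → ℝ) × (PerpIdx l κ → ℝ)) → _)
      volume volume := Measure.measurePreserving_swap
  have h2 : MeasurePreserving (Prod.map Prod.swap id :
      ((LamIdx l → ℝ) × (PerpIdx l κ → ℝ)) × (Fin l → ℝ) → _) volume volume :=
    MeasurePreserving.prod (μa := volume) (μc := volume) Measure.measurePreserving_swap
      (MeasurePreserving.id _)
  have h3 : MeasurePreserving (MeasurableEquiv.prodAssoc :
      ((PerpIdx l κ → ℝ) × (LamIdx l → ℝ)) × (Fin l → ℝ) ≃ᵐ _) volume volume :=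
    measurePreserving_prodAssoc _ _ _
  have h4 := volume_measurePreserving_sumPiEquivProdPi_symm (fun _ : LamIdx l ⊕ Fin l => ℝ)
  have h5 : MeasurePreserving (Prod.map id
      (MeasurableEquiv.sumPiEquivProdPi fun _ : LamIdx l ⊕ Fin l => ℝ).symm :
      (PerpIdx l κ → ℝ) × _ → _) volume volume :=
    MeasurePreserving.prod (μa := volume) (μc := volume) (MeasurePreserving.id _) h4
  have h6 := volume_measurePreserving_sumPiEquivProdPi_symm (fun _ : SrcIdx l κ => ℝ)
  have h := h6.comp (h5.comp (h3.comp (h2.comp h1)))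
  convert! h using 1

theorem measurable_srcPoint : Measurable (srcPoint : SrcSpace l κ → SrcIdx l κ → ℝ) :=
  measurePreserving_srcPoint.measurable

theorem srcMeasure_eq_restrict :
    srcMeasure l κ = volume.restrict {z : SrcSpace l κ | (∀ i, 0 < z.1 i) ∧
      (∀ p, z.2.1 p ∈ Set.Icc (-1 : ℝ) 1) ∧ ∀ p, z.2.2 p ∈ Set.Icc (-1 : ℝ) 1} := by
  rw [srcMeasure, radialMeasure, cosMeasure, cosMeasure, Measure.prod_restrict,
    Measure.prod_restrict]
  rfl

theorem lintegral_srcPoint {F : (SrcIdx l κ → ℝ) → ℝ≥0∞} (hF : Measurable F) :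
    ∫⁻ z, srcDensity (srcPoint z) * F (srcPoint z) ∂(srcMeasure l κ) =
      ∫⁻ x, srcDensity x * F x := by
  have hm : Measurable fun x : SrcIdx l κ → ℝ => srcDensity x * F x := measurable_srcDensity.mul hF
  rw [← measurePreserving_srcPoint.lintegral_comp hm, srcMeasure_eq_restrict, ← lintegral_indicator]
  · refine lintegral_congr fun z => ?_
    by_cases hz : srcDensity (srcPoint z) = 0
    · rw [hz, zero_mul, Set.indicator_apply, hz, zero_mul, ite_self]
    · refine Set.indicator_of_mem ?_ _
      obtain ⟨h1, h2, h3⟩ := mem_of_srcDensity_ne_zero hz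
      exact ⟨h3, fun p => Set.Ioo_subset_Icc_self (h2 p), fun p => Set.Ioo_subset_Icc_self (h1 p)⟩
  · refine MeasurableSet.inter (?_ : MeasurableSet {z : SrcSpace l κ | ∀ i, 0 < z.1 i})
      (MeasurableSet.inter
        (?_ : MeasurableSet {z : SrcSpace l κ | ∀ p, z.2.1 p ∈ Set.Icc (-1 : ℝ) 1})
        (?_ : MeasurableSet {z : SrcSpace l κ | ∀ p, z.2.2 p ∈ Set.Icc (-1 : ℝ) 1}))
    · simp only [Set.ofPred_forall]
      exact MeasurableSet.iInter fun i => measurableSet_lt measurable_const (by fun_prop)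
    · simp only [Set.ofPred_forall]
      exact MeasurableSet.iInter fun i => measurableSet_Icc.preimage (by fun_prop)
    · simp only [Set.ofPred_forall]
      exact MeasurableSet.iInter fun i => measurableSet_Icc.preimage (by fun_prop)

/-- The part `∑_k a_ki a_kj` of `λ_i · λ_j` that comes from the components `a_kj`. -/
def compGram (a : PerpIdx l κ → ℝ) : SymIdx l → ℝ :=
  fun p => ∑ k, a (k, p.1.1) * a (k, p.1.2)

/-- The components `a_kj` and the remaining parts `μ_ij = λ_ij - ∑_k a_ki a_kj` of the scalar
products, as functions of `λ_ii`, `cos Θ_Λ`, `cos Θ_⊥`. -/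
def perpMap (z : SrcSpace l κ) : (PerpIdx l κ → ℝ) × (SymIdx l → ℝ) :=
  (fun p => bigMap (srcPoint z) (Sum.inl p),
    (fun p => bigMap (srcPoint z) (Sum.inr p)) -
      compGram fun p => bigMap (srcPoint z) (Sum.inl p))

theorem measurable_compGram : Measurable (compGram : (PerpIdx l κ → ℝ) → SymIdx l → ℝ) := by
  unfold compGram; fun_prop

theorem measurable_perpMap : Measurable (perpMap : SrcSpace l κ → _) := by
  have h : Measurable fun z : SrcSpace l κ => bigMap (srcPoint z) :=
    measurable_bigMap.comp measurable_srcPoint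
  have h1 : Measurable fun z : SrcSpace l κ => fun p => bigMap (srcPoint z) (Sum.inl p) :=
    measurable_pi_lambda _ fun p => (measurable_pi_apply _).comp h
  have h2 : Measurable fun z : SrcSpace l κ => fun p => bigMap (srcPoint z) (Sum.inr p) :=
    measurable_pi_lambda _ fun p => (measurable_pi_apply _).comp h
  exact h1.prodMk (h2.sub (measurable_compGram.comp h1))

theorem symMatrix_sub_compGram (a : PerpIdx l κ → ℝ) (u : SymIdx l → ℝ) :
    symMatrix (u - compGram a) =
      symMatrix u - (of fun k j => a (k, j))ᵀ * (of fun k j => a (k, j)) := by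
  ext i j
  simp only [symMatrix, Pi.sub_apply, Matrix.sub_apply, Matrix.mul_apply, compGram,
    transpose_apply, of_apply]
  congr 1
  refine Finset.sum_congr rfl fun k _ => ?_
  rcases le_total i j with h | h <;> simp [h, mul_comm]

theorem bigGram_posDef_iff (y : TgtIdx l κ → ℝ) :
    (bigGram y).PosDef ↔
      (symMatrix ((fun p => y (Sum.inr p)) - compGram fun p => y (Sum.inl p))).PosDef := by
  rw [bigGram, posDef_fromBlocks_one_iff, symMatrix_sub_compGram]

theorem det_bigGram (y : TgtIdx l κ → ℝ) :
    (bigGram y).det =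
      (symMatrix ((fun p => y (Sum.inr p)) - compGram fun p => y (Sum.inl p))).det := by
  rw [bigGram, det_fromBlocks_one₁₁, symMatrix_sub_compGram]

theorem gramMeasure_eq_restrict_posDef (l : ℕ) :
    gramMeasure l = volume.restrict {u | (symMatrix u).PosDef} :=
  Measure.restrict_congr_set (posSemidef_ae_eq_posDef l)

theorem measurableSet_symMatrix_posDef (l : ℕ) :
    MeasurableSet {u : SymIdx l → ℝ | (symMatrix u).PosDef} :=
  measurableSet_posDef fun i j => by unfold symMatrix; fun_prop

/-- The change of variables to norms and nested angles carries the measure weighted with the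
Jacobian to the product of Lebesgue measure in the components `a_kj` and the measure on Gram
matrices `μ_ij`. -/
theorem map_perpMap_withDensity :
    Measure.map perpMap ((srcMeasure l κ).withDensity fun z => srcDensity (srcPoint z)) =
      (volume : Measure (PerpIdx l κ → ℝ)).prod (gramMeasure l) := by
  refine Measure.ext_of_lintegral _ fun G hG => ?_
  have hdm : Measurable fun z : SrcSpace l κ => srcDensity (srcPoint z) :=
    measurable_srcDensity.comp measurable_srcPoint
  let shear : (TgtIdx l κ → ℝ) → (PerpIdx l κ → ℝ) × (SymIdx l → ℝ) := fun y =>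
    (fun p => y (Sum.inl p), (fun p => y (Sum.inr p)) - compGram fun p => y (Sum.inl p))
  have hsh : Measurable shear := by
    have h1 : Measurable fun y : TgtIdx l κ → ℝ => (fun p => y (Sum.inl p) : PerpIdx l κ → ℝ) := by
      fun_prop
    have h2 : Measurable fun y : TgtIdx l κ → ℝ => (fun p => y (Sum.inr p) : SymIdx l → ℝ) := by
      fun_prop
    exact h1.prodMk (h2.sub (measurable_compGram.comp h1))
  have hGp : Measurable fun z : SrcSpace l κ => G (perpMap z) := hG.comp measurable_perpMap
  rw [lintegral_map hG measurable_perpMap, lintegral_withDensity_eq_lintegral_mul _ hdm hGp]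
  have h1 := lintegral_srcPoint (l := l) (κ := κ) (F := fun x => G (shear (bigMap x)))
    (hG.comp (hsh.comp measurable_bigMap))
  have h2 := lintegral_bigMap l κ (hG.comp hsh)
  refine (h1.trans h2.symm).trans ?_
  have hGs : Measurable fun z : (PerpIdx l κ → ℝ) × (SymIdx l → ℝ) =>
      {u | (symMatrix u).PosDef}.indicator (fun u => G (z.1, u)) z.2 := by
    have : (fun z : (PerpIdx l κ → ℝ) × (SymIdx l → ℝ) =>
        {u | (symMatrix u).PosDef}.indicator (fun u => G (z.1, u)) z.2) =
        (Prod.snd ⁻¹' {u | (symMatrix u).PosDef}).indicator G := by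
      funext z
      rfl
    rw [this]
    exact hG.indicator ((measurableSet_symMatrix_posDef l).preimage measurable_snd)
  have hy : ∀ y, {y | (bigGram y).PosDef}.indicator (G ∘ shear) y =
      {u | (symMatrix u).PosDef}.indicator (fun u => G ((shear y).1, u)) (shear y).2 := by
    intro y
    by_cases h : (bigGram y).PosDef
    · rw [Set.indicator_of_mem (show y ∈ {y | (bigGram y).PosDef} from h),
        Set.indicator_of_mem (show (shear y).2 ∈ {u : SymIdx l → ℝ | (symMatrix u).PosDef} from
          (bigGram_posDef_iff y).1 h)]
      rfl
    · rw [Set.indicator_of_notMem (show y ∉ {y | (bigGram y).PosDef} from h),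
        Set.indicator_of_notMem (show (shear y).2 ∉ {u : SymIdx l → ℝ | (symMatrix u).PosDef} from
          fun h' => h ((bigGram_posDef_iff y).2 h'))]
  simp only [hy]
  have hmp := volume_measurePreserving_sumPiEquivProdPi_symm (fun _ : TgtIdx l κ => ℝ)
  have hGss : Measurable fun y => {u | (symMatrix u).PosDef}.indicator
      (fun u => G ((shear y).1, u)) (shear y).2 := hGs.comp hsh
  rw [← hmp.lintegral_comp_emb (MeasurableEquiv.measurableEmbedding _), Measure.volume_eq_prod,
    lintegral_prod _ (by exact (hGss.comp (MeasurableEquiv.measurable _)).aemeasurable),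
    lintegral_prod _ hG.aemeasurable]
  refine lintegral_congr fun a => ?_
  rw [gramMeasure_eq_restrict_posDef, ← lintegral_indicator (measurableSet_symMatrix_posDef l)]
  exact lintegral_sub_right_eq_self
    (fun u => {u | (symMatrix u).PosDef}.indicator (fun u => G (a, u)) u) (compGram a)

/-- Almost everywhere the Jacobian does not vanish. -/
theorem ae_srcDensity_ne_zero : ∀ᵐ z ∂(srcMeasure l κ), srcDensity (srcPoint z) ≠ 0 := by
  have hsin : ∀ e (c : ℝ), c ∈ Set.Ioo (-1 : ℝ) 1 → sinWeight e c ≠ 0 := by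
    intro e c hc
    rw [sinWeight, if_pos hc]
    exact (ENNReal.ofReal_pos.2 (pow_pos (sin_arccos_pos hc) e)).ne'
  have hrad : ∀ e (t : ℝ), 0 < t → radWeight e t ≠ 0 := by
    intro e t ht
    rw [radWeight, if_pos ht]
    exact (ENNReal.ofReal_pos.2 (pow_pos (Real.sqrt_pos.2 ht) e)).ne'
  have hcos : ∀ ι : Type, ∀ _ : Fintype ι, ∀ᵐ c ∂(cosMeasure ι), ∀ i, c i ∈ Set.Ioo (-1 : ℝ) 1 := by
    intro ι _
    rw [cosMeasure, ae_restrict_iff' (by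
      simp only [Set.ofPred_forall]
      exact MeasurableSet.iInter fun i => measurableSet_Icc.preimage (measurable_pi_apply i))]
    have h : ∀ᵐ c : ι → ℝ, ∀ i, c i ≠ -1 ∧ c i ≠ 1 := by
      rw [ae_all_iff]
      intro i
      exact (Measure.ae_eval_ne (μ := fun _ : ι => (volume : Measure ℝ)) i (-1)).and
        (Measure.ae_eval_ne (μ := fun _ : ι => (volume : Measure ℝ)) i 1)
    filter_upwards [h] with c hc hm i
    exact ⟨lt_of_le_of_ne (hm i).1 (hc i).1.symm, lt_of_le_of_ne (hm i).2 (hc i).2⟩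
  have h1 : ∀ᵐ t ∂(radialMeasure l), ∀ i, 0 < t i := by
    have hs : MeasurableSet {t : Fin l → ℝ | ∀ i, 0 < t i} := by
      simp only [Set.ofPred_forall]
      exact MeasurableSet.iInter fun i => measurableSet_lt measurable_const (measurable_pi_apply i)
    exact ae_restrict_mem hs
  have h1' : ∀ᵐ z ∂(srcMeasure l κ), ∀ i, 0 < z.1 i :=
    Measure.quasiMeasurePreserving_fst.ae h1
  have h2' : ∀ᵐ z ∂(srcMeasure l κ), ∀ p, z.2.1 p ∈ Set.Ioo (-1 : ℝ) 1 :=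
    (Measure.quasiMeasurePreserving_fst.comp Measure.quasiMeasurePreserving_snd).ae
      (hcos (LamIdx l) inferInstance)
  have h3' : ∀ᵐ z ∂(srcMeasure l κ), ∀ p, z.2.2 p ∈ Set.Ioo (-1 : ℝ) 1 :=
    (Measure.quasiMeasurePreserving_snd.comp Measure.quasiMeasurePreserving_snd).ae
      (hcos (PerpIdx l κ) inferInstance)
  filter_upwards [h1', h2', h3'] with z h1 h2 h3
  refine Finset.prod_ne_zero_iff.2 fun i _ => ?_
  rcases i with p | p | p
  · exact hsin _ _ (h3 p)
  · exact hsin _ _ (h2 p)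
  · exact hrad _ _ (h1 p)

/-- The complex weight, variable by variable. -/
theorem lamWeight_mul_perpWeight (D : ℂ) {z : SrcSpace l κ} (hz : srcDensity (srcPoint z) ≠ 0) :
    ((srcDensity (srcPoint z)).toReal : ℂ) * gramWeight D (perpMap z).2 =
      lamWeight (D + κ) z.1 (angles z.2.1) * perpWeight (D + κ) (angles z.2.2) := by
  obtain ⟨hP, hL, hR⟩ := mem_of_srcDensity_ne_zero hz
  set x := srcPoint z with hx
  have hdet : (symMatrix (perpMap z).2).det = ∏ i, srcFactor l κ i (x i) ^ 2 := by
    have h1 : (symMatrix (perpMap z).2).det = (bigGram (bigMap x)).det :=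
      (det_bigGram (bigMap x)).symm
    rw [h1, ← coordMatrix_mul_transpose x fun i => (hR i).le, det_mul, det_transpose, ← pow_two,
      ← sq_abs, abs_det_coordMatrix, prod_normEntry_sinEntry,
      sq_abs, Finset.prod_pow]
  let e : SrcIdx l κ → ℕ := Sum.elim (fun p => l + κ - 2 - (p.1 + p.2))
    (Sum.elim (fun p => l + κ - 2 - p.1.1) fun _ => l + κ - 1)
  have hdens : (srcDensity x).toReal = ∏ i, srcFactor l κ i (x i) ^ e i := by
    rw [srcDensity, ENNReal.toReal_prod]
    refine Finset.prod_congr rfl fun i _ => ?_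
    have hf := srcFactor_nonneg i (x i)
    rcases i with p | p | p
    · exact (congrArg ENNReal.toReal (if_pos (hP p))).trans (ENNReal.toReal_ofReal (pow_nonneg hf _))
    · exact (congrArg ENNReal.toReal (if_pos (hL p))).trans (ENNReal.toReal_ofReal (pow_nonneg hf _))
    · exact (congrArg ENNReal.toReal (if_pos (hR p))).trans (ENNReal.toReal_ofReal (pow_nonneg hf _))
  have hpow : ∀ i, ((srcFactor l κ i (x i) ^ 2 : ℝ) : ℂ) ^ ((D - 1 - (l : ℂ)) / 2) =
      ((srcFactor l κ i (x i) : ℝ) : ℂ) ^ (D - 1 - (l : ℂ)) := by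
    intro i
    have hpos := srcFactor_pos hz i
    have hne : ((srcFactor l κ i (x i) : ℝ) : ℂ) ≠ 0 := by exact_mod_cast hpos.ne'
    rw [pow_two, Complex.ofReal_mul, Complex.mul_cpow_ofReal_nonneg hpos.le hpos.le,
      ← Complex.cpow_add _ _ hne]
    congr 1
    ring
  have hprod : ∀ (s : Finset (SrcIdx l κ)) (E : ℂ),
      ((∏ i ∈ s, srcFactor l κ i (x i) ^ 2 : ℝ) : ℂ) ^ E =
        ∏ i ∈ s, ((srcFactor l κ i (x i) ^ 2 : ℝ) : ℂ) ^ E := by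
    intro s E
    induction s using Finset.induction_on with
    | empty => simp
    | insert i s hi ih =>
      rw [Finset.prod_insert hi, Finset.prod_insert hi, Complex.ofReal_mul,
        Complex.mul_cpow_ofReal_nonneg (sq_nonneg _)
          (Finset.prod_nonneg fun _ _ => sq_nonneg _), ih]
  rw [gramWeight, hdet, hprod, hdens, Complex.ofReal_prod, ← Finset.prod_mul_distrib]
  have hcomb : ∀ i, ((srcFactor l κ i (x i) ^ e i : ℝ) : ℂ) *
      ((srcFactor l κ i (x i) ^ 2 : ℝ) : ℂ) ^ ((D - 1 - (l : ℂ)) / 2) =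
      ((srcFactor l κ i (x i) : ℝ) : ℂ) ^ (D - 1 - (l : ℂ) + e i) := by
    intro i
    have hpos := srcFactor_pos hz i
    have hne : ((srcFactor l κ i (x i) : ℝ) : ℂ) ≠ 0 := by exact_mod_cast hpos.ne'
    rw [hpow, Complex.cpow_add _ _ hne, Complex.cpow_natCast, Complex.ofReal_pow, mul_comm]
  simp only [hcomb]
  rw [Fintype.prod_sum_type, Fintype.prod_sum_type, lamWeight, perpWeight]
  refine (mul_comm _ _).trans (congrArg₂ _ ((mul_comm _ _).trans (congrArg₂ _ ?_ ?_)) ?_)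
  · refine Finset.prod_congr rfl fun i _ => ?_
    have hi := hR i
    have hs : 0 < Real.sqrt (x (Sum.inr (Sum.inr i))) := Real.sqrt_pos.2 hi
    have hne : ((Real.sqrt (x (Sum.inr (Sum.inr i))) : ℝ) : ℂ) ≠ 0 := by exact_mod_cast hs.ne'
    have hlk : ((l + κ - 1 : ℕ) : ℂ) = (l : ℂ) + κ - 1 := by
      have := i.2
      rw [Nat.cast_sub (by omega)]; push_cast; ring
    have h1 : ((z.1 i : ℝ) : ℂ) = ((Real.sqrt (x (Sum.inr (Sum.inr i))) : ℝ) : ℂ) *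
        ((Real.sqrt (x (Sum.inr (Sum.inr i))) : ℝ) : ℂ) := by
      rw [← Complex.ofReal_mul, Real.mul_self_sqrt hi.le]; rfl
    show ((Real.sqrt (x (Sum.inr (Sum.inr i))) : ℝ) : ℂ) ^ (D - 1 - (l : ℂ) + (l + κ - 1 : ℕ)) = _
    rw [h1, Complex.mul_cpow_ofReal_nonneg hs.le hs.le, ← Complex.cpow_add _ _ hne, hlk]
    congr 1
    ring
  · refine Finset.prod_congr rfl fun p _ => ?_
    have hlk : ((l + κ - 2 - p.1.1 : ℕ) : ℂ) = (l : ℂ) + κ - 2 - (p.1.1 : ℕ) := by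
      have h1 := p.1.2.2
      have h2 : (p.1.1 : ℕ) < p.1.2 := p.2
      rw [Nat.cast_sub (by omega), Nat.cast_sub (by omega)]; push_cast; ring
    show ((Real.sin (angles z.2.1 p) : ℝ) : ℂ) ^
      (D - 1 - (l : ℂ) + (l + κ - 2 - p.1.1 : ℕ)) = _
    rw [hlk]
    congr 1
    ring
  · refine Finset.prod_congr rfl fun p _ => ?_
    have hlk : ((l + κ - 2 - (p.1 + p.2) : ℕ) : ℂ) = (l : ℂ) + κ - 2 - ((p.1 : ℕ) + (p.2 : ℕ)) := by
      have h1 := p.1.2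
      have h2 := p.2.2
      rw [Nat.cast_sub (by omega), Nat.cast_sub (by omega)]; push_cast; ring
    show ((Real.sin (angles z.2.2 p) : ℝ) : ℂ) ^
      (D - 1 - (l : ℂ) + (l + κ - 2 - (p.1 + p.2) : ℕ)) = _
    rw [hlk]
    congr 1
    ring

/-- Transfer of integrals along a map that carries a measure with density to a given measure. -/
theorem integrable_and_integral_of_map {X Y : Type*} [MeasurableSpace X] [MeasurableSpace Y]
    {μ : Measure X} {ν : Measure Y} {Ψ : X → Y} {J : X → ℝ≥0∞} (hΨ : Measurable Ψ)
    (hJ : Measurable J) (hJt : ∀ x, J x ≠ ⊤) (hmap : Measure.map Ψ (μ.withDensity J) = ν)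
    {H : Y → ℂ} (hH : Measurable H) {K : X → ℂ}
    (hK : ∀ᵐ x ∂μ, ((J x).toReal : ℂ) * H (Ψ x) = K x) :
    (Integrable H ν ↔ Integrable K μ) ∧ ∫ y, H y ∂ν = ∫ x, K x ∂μ := by
  have hlt : ∀ᵐ x ∂μ, J x < ⊤ := Filter.Eventually.of_forall fun x => (hJt x).lt_top
  have hK' : (fun x => (J x).toReal • H (Ψ x)) =ᵐ[μ] K := by
    filter_upwards [hK] with x hx
    rw [Complex.real_smul, hx]
  constructor
  · rw [← hmap, integrable_map_measure hH.aestronglyMeasurable hΨ.aemeasurable,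
      integrable_withDensity_iff_integrable_smul' hJ hlt]
    exact integrable_congr hK'
  · rw [← hmap, integral_map hΨ.aemeasurable hH.aestronglyMeasurable,
      integral_withDensity_eq_integral_toReal_smul hJ hlt]
    exact integral_congr_ae hK'

theorem measurable_symMatrix_det : Measurable fun u : SymIdx l → ℝ => (symMatrix u).det := by
  simp only [det_apply]
  refine Finset.measurable_sum _ fun σ _ =>
    (Finset.measurable_prod _ fun i _ => ?_).const_smul (Equiv.Perm.sign σ : ℤˣ)
  unfold symMatrix
  fun_prop

theorem measurable_gramWeight (D : ℂ) : Measurable (gramWeight D : (SymIdx l → ℝ) → ℂ) :=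
  (Complex.measurable_ofReal.comp measurable_symMatrix_det).pow_const _

/-- The two forms of the integral over the variables `Λ`. -/
theorem integral_gram_eq (D : ℂ) {g : (SymIdx l → ℝ) → ℂ} (hg : Measurable g) :
    (Integrable (fun u => gramWeight D u * g u) (gramMeasure l) ↔
      Integrable (fun z : (Fin l → ℝ) × (LamIdx l → ℝ) =>
          lamWeight D z.1 (angles z.2) * g ((nestedMap l κ).lamUpper z.1 (angles z.2)))
        ((radialMeasure l).prod (cosMeasure (LamIdx l)))) ∧
    ∫ u, gramWeight D u * g u ∂(gramMeasure l) =
      ∫ z : (Fin l → ℝ) × (LamIdx l → ℝ),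
        lamWeight D z.1 (angles z.2) * g ((nestedMap l κ).lamUpper z.1 (angles z.2))
          ∂((radialMeasure l).prod (cosMeasure (LamIdx l))) := by
  -- for `κ = 0` there are no components `a_kj` and no angles `Θ_⊥`
  let emb : (Fin l → ℝ) × (LamIdx l → ℝ) → SrcSpace l 0 := fun z => (z.1, z.2, isEmptyElim)
  have hcos0 : cosMeasure (PerpIdx l 0) = Measure.dirac isEmptyElim := by
    rw [cosMeasure, Measure.volume_pi_eq_dirac (α := fun _ : PerpIdx l 0 => ℝ) isEmptyElim]
    have : {c : PerpIdx l 0 → ℝ | ∀ i, c i ∈ Set.Icc (-1 : ℝ) 1} = Set.univ := by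
      ext c; simp
    rw [this, Measure.restrict_univ]
  have hemb : Measurable emb := by
    refine measurable_fst.prodMk (measurable_snd.prodMk measurable_const)
  have hmapemb : Measure.map emb ((radialMeasure l).prod (cosMeasure (LamIdx l))) =
      srcMeasure l 0 := by
    rw [srcMeasure, hcos0, Measure.prod_dirac]
    have h1 := Measure.map_prod_map (radialMeasure l) (cosMeasure (LamIdx l)) measurable_id
      (measurable_id.prodMk (measurable_const (a := (isEmptyElim : PerpIdx l 0 → ℝ))))
    rw [Measure.map_id] at h1
    exact h1.symm
  have hJm : Measurable fun z : SrcSpace l 0 => srcDensity (srcPoint z) :=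
    measurable_srcDensity.comp measurable_srcPoint
  have hpush : Measure.map (fun z => (perpMap (emb z)).2)
      (((radialMeasure l).prod (cosMeasure (LamIdx l))).withDensity
        fun z => srcDensity (srcPoint (emb z))) = gramMeasure l := by
    refine Measure.ext_of_lintegral _ fun G hG => ?_
    have h1 : Measurable fun z : SrcSpace l 0 => G (perpMap z).2 :=
      hG.comp (measurable_snd.comp measurable_perpMap)
    have hpe : Measurable fun z => (perpMap (emb z)).2 :=
      measurable_snd.comp (measurable_perpMap.comp hemb)
    have hJe : Measurable fun z => srcDensity (srcPoint (emb z)) := hJm.comp hemb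
    have h1e : Measurable fun z => G (perpMap (emb z)).2 := h1.comp hemb
    rw [lintegral_map hG hpe, lintegral_withDensity_eq_lintegral_mul _ hJe h1e]
    have h1m : Measurable fun z : SrcSpace l 0 =>
        srcDensity (srcPoint z) * G (perpMap z).2 := hJm.mul h1
    have hG2 : Measurable fun z : (PerpIdx l 0 → ℝ) × (SymIdx l → ℝ) => G z.2 :=
      hG.comp measurable_snd
    have h2 : ∫⁻ z, srcDensity (srcPoint z) * G (perpMap z).2 ∂(srcMeasure l 0) =
        ∫⁻ z, G z.2 ∂((volume : Measure (PerpIdx l 0 → ℝ)).prod (gramMeasure l)) := by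
      rw [← map_perpMap_withDensity, lintegral_map hG2 measurable_perpMap,
        lintegral_withDensity_eq_lintegral_mul _ hJm h1]
      rfl
    rw [← hmapemb, lintegral_map h1m hemb] at h2
    refine h2.trans ?_
    rw [Measure.volume_pi_eq_dirac (α := fun _ : PerpIdx l 0 => ℝ) isEmptyElim,
      lintegral_prod _ hG2.aemeasurable, lintegral_dirac]
  have hmat : ∀ z, (perpMap (emb z)).2 = (nestedMap l κ).lamUpper z.1 (angles z.2) := by
    intro z
    exact sub_zero _
  refine integrable_and_integral_of_map (measurable_snd.comp (measurable_perpMap.comp hemb))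
    (hJm.comp hemb) (fun z => srcDensity_ne_top _) hpush
    (H := fun u => gramWeight D u * g u) ((measurable_gramWeight D).mul hg) ?_
  have hae : ∀ᵐ z ∂((radialMeasure l).prod (cosMeasure (LamIdx l))),
      srcDensity (srcPoint (emb z)) ≠ 0 := by
    have := ae_srcDensity_ne_zero (l := l) (κ := 0)
    rw [← hmapemb] at this
    exact ae_of_ae_map hemb.aemeasurable this
  filter_upwards [hae] with z hz
  have hw := lamWeight_mul_perpWeight D hz
  rw [show perpWeight (D + ((0 : ℕ) : ℂ)) (angles (emb z).2.2) = 1 by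
    simp [perpWeight], mul_one, Nat.cast_zero, add_zero] at hw
  simp only [Function.comp_apply]
  rw [← hmat, ← mul_assoc, hw]

end Pushforward

/-! ### Denominators and numerators in the new variables -/

section Integrand

variable {dp l r : ℕ}

/-- Pythagoras for the argument of a propagator: the parts `w_i` of the loop momenta which are
orthogonal to the remaining parts and to the external momenta enter through their Gram matrix. -/
theorem norm_sq_sum_smul_add {E F : Type*} [NormedAddCommGroup E] [InnerProductSpace ℝ E]
    [NormedAddCommGroup F] [InnerProductSpace ℝ F] (f : E →ₗᵢ[ℝ] F) (a : Fin l → ℝ)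
    (b : Fin dp → ℝ) (Q : Fin l → E) (p : Fin dp → E) (w : Fin l → F)
    (hQ : ∀ i k, ⟪f (Q k), w i⟫ = 0) (hp : ∀ i k, ⟪f (p k), w i⟫ = 0) :
    ‖∑ i, a i • (f (Q i) + w i) + ∑ i, b i • f (p i)‖ ^ 2 =
      ‖∑ i, a i • Q i + ∑ i, b i • p i‖ ^ 2 + ∑ i, ∑ k, a i * a k * ⟪w i, w k⟫ := by
  have hsplit : ∑ i, a i • (f (Q i) + w i) + ∑ i, b i • f (p i) =
      f (∑ i, a i • Q i + ∑ i, b i • p i) + ∑ i, a i • w i := by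
    simp only [map_add, map_sum, map_smul, smul_add, Finset.sum_add_distrib]
    abel
  have horth : ⟪f (∑ i, a i • Q i + ∑ i, b i • p i), ∑ i, a i • w i⟫ = 0 := by
    rw [inner_sum]
    refine Finset.sum_eq_zero fun i _ => ?_
    simp only [map_add, map_sum, map_smul, inner_add_left, sum_inner, inner_smul_left,
      inner_smul_right, hQ, hp, mul_zero, Finset.sum_const_zero, add_zero]
  have hgram : ‖∑ i, a i • w i‖ ^ 2 = ∑ i, ∑ k, a i * a k * ⟪w i, w k⟫ := by
    rw [← real_inner_self_eq_norm_sq, sum_inner]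
    refine Finset.sum_congr rfl fun i _ => ?_
    rw [inner_sum]
    refine Finset.sum_congr rfl fun k _ => ?_
    rw [real_inner_smul_left, real_inner_smul_right]
    ring
  rw [hsplit, norm_add_sq_real, horth, f.norm_map, hgram]
  ring

namespace LoopIntegral

variable (I : LoopIntegral dp l r)

theorem inner_physPart {d : ℕ} (ι : Phys →ₗᵢ[ℝ] EuclideanSpace ℝ (Fin d)) (w : Phys)
    (x : EuclideanSpace ℝ (Fin d)) : ⟪w, physPart ι x⟫ = ⟪ι w, x⟫ :=
  ContinuousLinearMap.adjoint_inner_right ι.toContinuousLinearMap w x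

theorem inner_sub_physPart {d : ℕ} (ι : Phys →ₗᵢ[ℝ] EuclideanSpace ℝ (Fin d)) (w : Phys)
    (x : EuclideanSpace ℝ (Fin d)) : ⟪ι w, x - ι (physPart ι x)⟫ = 0 := by
  rw [inner_sub_right, ι.inner_map_map, inner_physPart, sub_self]

theorem inner_sub_parPart {d : ℕ} (ι : Phys →ₗᵢ[ℝ] EuclideanSpace ℝ (Fin d)) (w : I.par)
    (x : EuclideanSpace ℝ (Fin d)) : ⟪ι (w : Phys), x - ι (I.parPart ι x : Phys)⟫ = 0 := by
  rw [inner_sub_right, ι.inner_map_map, ← inner_physPart, ← inner_sub_right]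
  exact (I.par.mem_orthogonal _).1 (I.par.sub_starProjection_mem_orthogonal (physPart ι x)) _ w.2

theorem p_mem_par (i : Fin dp) : I.p i ∈ I.par := Submodule.subset_span ⟨i, rfl⟩

/-- The denominators depend only on the parallel components and on the `λ_ij`. -/
theorem denD_eq_den_parPart {d : ℕ} (ι : Phys →ₗᵢ[ℝ] EuclideanSpace ℝ (Fin d))
    (q : Fin l → EuclideanSpace ℝ (Fin d)) (j : Fin r) :
    I.denD ι q j = I.den (fun i => (I.parPart ι (q i) : Phys)) (I.lamGram ι q) j := by
  have h := norm_sq_sum_smul_add ι (fun i => ((I.α i j : SignType) : ℝ))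
    (fun i => ((I.β i j : SignType) : ℝ)) (fun i => (I.parPart ι (q i) : Phys)) I.p
    (fun i => q i - ι (I.parPart ι (q i) : Phys))
    (fun i k => I.inner_sub_parPart ι _ (q i))
    (fun i k => I.inner_sub_parPart ι ⟨I.p k, I.p_mem_par k⟩ (q i))
  simp only [add_sub_cancel] at h
  rw [denD, den, h]
  rfl

/-- The denominators in terms of the physical components and the `μ_ij`. -/
theorem denD_eq_den_physPart {d : ℕ} (ι : Phys →ₗᵢ[ℝ] EuclideanSpace ℝ (Fin d))
    (q : Fin l → EuclideanSpace ℝ (Fin d)) (j : Fin r) :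
    I.denD ι q j = I.den (fun i => physPart ι (q i)) (muGram ι q) j := by
  have h := norm_sq_sum_smul_add ι (fun i => ((I.α i j : SignType) : ℝ))
    (fun i => ((I.β i j : SignType) : ℝ)) (fun i => physPart ι (q i)) I.p
    (fun i => q i - ι (physPart ι (q i)))
    (fun i k => inner_sub_physPart ι _ (q i)) (fun i k => inner_sub_physPart ι _ (q i))
  simp only [add_sub_cancel] at h
  rw [denD, den, h]
  rfl

/-- Moving components orthogonal to the external momenta from the physical part into the Gram
matrix does not change the denominators. -/
theorem den_add (Q w : Fin l → Phys) (G : Matrix (Fin l) (Fin l) ℝ)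
    (hQ : ∀ i k, ⟪Q k, w i⟫ = 0) (hp : ∀ i k, ⟪I.p k, w i⟫ = 0) (j : Fin r) :
    I.den (fun i => Q i + w i) G j = I.den Q (fun i k => G i k + ⟪w i, w k⟫) j := by
  have h := norm_sq_sum_smul_add (LinearIsometry.id (R := ℝ) (E := Phys))
    (fun i => ((I.α i j : SignType) : ℝ)) (fun i => ((I.β i j : SignType) : ℝ)) Q I.p w hQ hp
  simp only [LinearIsometry.id_apply] at h
  simp only [den]
  rw [h]
  simp only [mul_add, Finset.sum_add_distrib]
  ring

end LoopIntegral

/-- The splitting of the labels of a basis of the physical space into parallel and transverse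
ones. -/
def splitFour (h : dp ≤ 4) : Fin dp ⊕ Fin (4 - dp) ≃ Fin 4 :=
  finSumFinEquiv.trans (finCongr (by omega))

theorem sum_splitFour {M : Type*} [AddCommMonoid M] (h : dp ≤ 4) (f : Fin 4 → M) :
    ∑ i, f i = (∑ j : Fin dp, f (Fin.castLE h j)) + ∑ k : Fin (4 - dp), f ⟨dp + k, by omega⟩ := by
  rw [← (splitFour h).sum_comp, Fintype.sum_sum_type]
  rfl

namespace LoopIntegral

variable {I : LoopIntegral dp l r} {e : Module.Basis (Fin 4) ℝ Phys}

theorem IsAdapted.inner_eq_zero (he : I.IsAdapted e) {k : Fin 4} (hk : dp ≤ (k : ℕ)) {x : Phys}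
    (hx : x ∈ I.par) : ⟪e k, x⟫ = 0 := by
  refine Submodule.span_induction (p := fun x _ => ⟪e k, x⟫ = 0) ?_ ?_ ?_ ?_ hx
  · rintro _ ⟨i, rfl⟩
    exact he.2.1 k hk i
  · exact inner_zero_right _
  · intro x y _ _ hx hy
    rw [inner_add_right, hx, hy, add_zero]
  · intro a x _ hx
    rw [inner_smul_right, hx, mul_zero]

theorem IsAdapted.repr_eq_zero (he : I.IsAdapted e) {k : Fin 4} (hk : dp ≤ (k : ℕ)) {x : Phys}
    (hx : x ∈ I.par) : e.repr x k = 0 := by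
  have h1 := he.inner_eq_zero hk hx
  rw [← e.sum_repr x, inner_sum, Finset.sum_eq_single k] at h1
  · rwa [inner_smul_right, he.2.2 k k hk hk, if_pos rfl, mul_one] at h1
  · intro j _ hj
    rw [inner_smul_right]
    rcases lt_or_ge (j : ℕ) dp with h | h
    · rw [he.inner_eq_zero hk (he.1 j h), mul_zero]
    · rw [he.2.2 k j hk h, if_neg hj.symm, mul_zero]
  · exact fun h => absurd (Finset.mem_univ k) h

theorem IsAdapted.sum_repr_par (he : I.IsAdapted e) (h4 : dp ≤ 4) (x : I.par) :
    ∑ j : Fin dp, e.repr (x : Phys) (Fin.castLE h4 j) • e (Fin.castLE h4 j) = (x : Phys) := by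
  conv_rhs => rw [← e.sum_repr (x : Phys), sum_splitFour h4]
  rw [Finset.sum_eq_zero (s := (Finset.univ : Finset (Fin (4 - dp)))), add_zero]
  intro k _
  rw [he.repr_eq_zero (show dp ≤ dp + (k : ℕ) by omega) x.2, zero_smul]

theorem IsAdapted.inner_transverse (he : I.IsAdapted e) (k k' : Fin (4 - dp)) :
    ⟪e ⟨dp + k, by omega⟩, e ⟨dp + k', by omega⟩⟫ = if k = k' then (1 : ℝ) else 0 := by
  rw [he.2.2 _ _ (by simp) (by simp)]
  simp [Fin.ext_iff]

end LoopIntegral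

/-- A real polynomial in the variables of the angular part, with complex coefficients and
additional variables. -/
def liftPoly {σ τ : Type} (P : MvPolynomial τ ℝ) : MvPolynomial (σ ⊕ τ) ℂ :=
  MvPolynomial.rename Sum.inr (MvPolynomial.map Complex.ofRealHom P)

theorem eval_liftPoly {σ τ : Type} (P : MvPolynomial τ ℝ) (u : σ → ℂ) (v : τ → ℝ) :
    MvPolynomial.eval (Sum.elim u fun x => ((v x : ℝ) : ℂ)) (liftPoly P) =
      ((MvPolynomial.eval v P : ℝ) : ℂ) := by
  rw [liftPoly, MvPolynomial.eval_rename, MvPolynomial.eval_map]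
  exact (MvPolynomial.eval₂_comp_left Complex.ofRealHom (RingHom.id ℝ) v P).symm

/-- The entry `λ_ij` as a polynomial; on the diagonal it is the square of `√λ_ii`. -/
def entryPoly {κ : ℕ} (T : PolyMap l κ) (i j : Fin l) : MvPolynomial (PerpVar l κ) ℝ :=
  if h : min i j < max i j then MvPolynomial.rename Sum.inl (T.offDiag ⟨(min i j, max i j), h⟩)
  else MvPolynomial.X (Sum.inl (Sum.inl (min i j))) ^ 2

theorem eval_entryPoly {κ : ℕ} (T : PolyMap l κ) (i j : Fin l) {t : Fin l → ℝ} (ht : ∀ i, 0 ≤ t i)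
    (θL : LamIdx l → ℝ) (θP : PerpIdx l κ → ℝ) :
    MvPolynomial.eval (perpPoint (fun i => Real.sqrt (t i)) θL θP) (entryPoly T i j) =
      T.lamMatrix t θL i j := by
  simp only [entryPoly, PolyMap.lamMatrix, symMatrix, PolyMap.lamUpper]
  split_ifs with h
  · rw [MvPolynomial.eval_rename]
    rfl
  · rw [map_pow, MvPolynomial.eval_X]
    exact Real.sq_sqrt (ht _)

/-- The numerator becomes a polynomial in the parallel components, the `√λ_ii`, and the sines and
cosines of the angles. -/
theorem exists_numPar_eq_eval (h4 : dp ≤ 4) {I : LoopIntegral dp l r}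
    {e : Module.Basis (Fin 4) ℝ Phys} (he : I.IsAdapted e) (T : PolyMap l (4 - dp)) :
    ∃ P : MvPolynomial ((Fin dp × Fin l) ⊕ PerpVar l (4 - dp)) ℂ,
      ∀ (Q : Fin l → I.par) (t : Fin l → ℝ) (θL : LamIdx l → ℝ)
        (θP : PerpIdx l (4 - dp) → ℝ), (∀ i, 0 ≤ t i) →
        I.numPar T e Q t θL θP =
          MvPolynomial.eval
            (Sum.elim
              (fun x : Fin dp × Fin l =>
                ((e.repr (Q x.2 : Phys) (Fin.castLE h4 x.1) : ℝ) : ℂ))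
              (fun x => ((perpPoint (fun i => Real.sqrt (t i)) θL θP x : ℝ) : ℂ))) P := by
  refine ⟨MvPolynomial.bind₁ (Sum.elim
    (fun x : Fin 4 × Fin l =>
      (∑ j : Fin dp, MvPolynomial.C (((e (Fin.castLE h4 j)) x.1 : ℝ) : ℂ) *
        MvPolynomial.X (Sum.inl (j, x.2))) +
      ∑ k : Fin (4 - dp), MvPolynomial.C (((e ⟨dp + k, by omega⟩) x.1 : ℝ) : ℂ) *
        liftPoly (T.comp (k, x.2)))
    (fun x : Fin l × Fin l => liftPoly (entryPoly T x.1 x.2) -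
      ∑ k : Fin (4 - dp), liftPoly (T.comp (k, x.1)) * liftPoly (T.comp (k, x.2)))) I.num, ?_⟩
  intro Q t θL θP ht
  set g : (Fin dp × Fin l) ⊕ PerpVar l (4 - dp) → ℂ := Sum.elim
    (fun x : Fin dp × Fin l => ((e.repr (Q x.2 : Phys) (Fin.castLE h4 x.1) : ℝ) : ℂ))
    (fun x => ((perpPoint (fun i => Real.sqrt (t i)) θL θP x : ℝ) : ℂ)) with hg
  rw [show MvPolynomial.eval g = MvPolynomial.eval₂Hom (RingHom.id ℂ) g from rfl,
    MvPolynomial.eval₂Hom_bind₁, LoopIntegral.numPar]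
  change MvPolynomial.eval _ I.num = MvPolynomial.eval _ I.num
  congr 2
  funext x
  change _ = MvPolynomial.eval g _
  rcases x with ⟨c, i⟩ | ⟨i, j⟩
  · simp only [Sum.elim_inl, map_add, map_sum, map_mul, MvPolynomial.eval_C,
      MvPolynomial.eval_X, hg, eval_liftPoly]
    rw [← he.sum_repr_par h4 (Q i)]
    simp only [PiLp.add_apply, WithLp.ofLp_sum, Finset.sum_apply, PiLp.smul_apply, smul_eq_mul,
      Complex.ofReal_add, Complex.ofReal_sum, Complex.ofReal_mul]
    refine congrArg₂ _ (Finset.sum_congr rfl fun k _ => ?_) (Finset.sum_congr rfl fun k _ => ?_)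
    · rw [he.sum_repr_par h4 (Q i), mul_comm]
    · rw [mul_comm]; rfl
  · simp only [Sum.elim_inr, map_sub, map_sum, map_mul, hg, eval_liftPoly, eval_entryPoly T i j ht]
    push_cast
    rfl

end Integrand

/-! ### Orthogonal decompositions of Lebesgue measure -/

section Orthogonal

/-- Two isometries onto orthogonal complements decompose Lebesgue measure as a product. -/
theorem measurePreserving_add_of_orthogonal {V₁ V₂ W : Type*}
    [NormedAddCommGroup V₁] [InnerProductSpace ℝ V₁] [FiniteDimensional ℝ V₁]
    [MeasurableSpace V₁] [BorelSpace V₁]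
    [NormedAddCommGroup V₂] [InnerProductSpace ℝ V₂] [FiniteDimensional ℝ V₂]
    [MeasurableSpace V₂] [BorelSpace V₂]
    [NormedAddCommGroup W] [InnerProductSpace ℝ W] [FiniteDimensional ℝ W]
    [MeasurableSpace W] [BorelSpace W]
    (f : V₁ →ₗᵢ[ℝ] W) (g : V₂ →ₗᵢ[ℝ] W) (horth : ∀ x y, ⟪f x, g y⟫ = 0)
    (hdim : Module.finrank ℝ V₁ + Module.finrank ℝ V₂ = Module.finrank ℝ W) :
    MeasurePreserving (fun z : V₁ × V₂ => f z.1 + g z.2) volume volume := by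
  let F : WithLp 2 (V₁ × V₂) →ₗᵢ[ℝ] W :=
    { toLinearMap := (f.toLinearMap.coprod g.toLinearMap).comp
        (WithLp.linearEquiv 2 ℝ (V₁ × V₂)).toLinearMap
      norm_map' := by
        intro z
        have h1 : ‖f z.fst + g z.snd‖ ^ 2 = ‖z‖ ^ 2 := by
          rw [norm_add_sq_real, horth, f.norm_map, g.norm_map, WithLp.prod_norm_sq_eq_of_L2]
          ring
        exact (sq_eq_sq₀ (norm_nonneg _) (norm_nonneg _)).1 h1 }
  have hfin : Module.finrank ℝ (WithLp 2 (V₁ × V₂)) = Module.finrank ℝ W := by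
    rw [(WithLp.linearEquiv 2 ℝ (V₁ × V₂)).finrank_eq, Module.finrank_prod, hdim]
  have h2 := (F.toLinearIsometryEquiv hfin).measurePreserving
  exact h2.comp (WithLp.volume_preserving_toLp V₁ V₂)

/-- The same decomposition for families of vectors. -/
theorem measurePreserving_pi_add_of_orthogonal {V₁ V₂ W : Type*} (l : ℕ)
    [NormedAddCommGroup V₁] [InnerProductSpace ℝ V₁] [FiniteDimensional ℝ V₁]
    [MeasurableSpace V₁] [BorelSpace V₁]
    [NormedAddCommGroup V₂] [InnerProductSpace ℝ V₂] [FiniteDimensional ℝ V₂]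
    [MeasurableSpace V₂] [BorelSpace V₂]
    [NormedAddCommGroup W] [InnerProductSpace ℝ W] [FiniteDimensional ℝ W]
    [MeasurableSpace W] [BorelSpace W]
    (f : V₁ →ₗᵢ[ℝ] W) (g : V₂ →ₗᵢ[ℝ] W) (horth : ∀ x y, ⟪f x, g y⟫ = 0)
    (hdim : Module.finrank ℝ V₁ + Module.finrank ℝ V₂ = Module.finrank ℝ W) :
    MeasurePreserving (fun (z : (Fin l → V₁) × (Fin l → V₂)) i => f (z.1 i) + g (z.2 i))
      volume volume := by
  have h1 := (volume_measurePreserving_arrowProdEquivProdArrow V₁ V₂ (Fin l)).symm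
  have h2 := volume_preserving_pi (ι := Fin l) (α' := fun _ => V₁ × V₂) (β' := fun _ => W)
    (f := fun _ z => f z.1 + g z.2) fun _ => measurePreserving_add_of_orthogonal f g horth hdim
  exact h2.comp h1

/-- Families of coordinates as families of vectors. -/
def vectorsEquiv (l κ : ℕ) : (Fin κ × Fin l → ℝ) ≃ᵐ (Fin l → EuclideanSpace ℝ (Fin κ)) where
  toFun a i := WithLp.toLp 2 fun k => a (k, i)
  invFun b p := b p.2 p.1
  left_inv _ := rfl
  right_inv _ := rfl
  measurable_toFun := by
    refine measurable_pi_lambda _ fun i => ?_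
    exact (PiLp.volume_preserving_toLp (Fin κ)).measurable.comp
      (measurable_pi_lambda _ fun k => measurable_pi_apply _)
  measurable_invFun := by
    refine measurable_pi_lambda _ fun p => ?_
    exact (measurable_pi_apply p.1).comp
      ((PiLp.volume_preserving_ofLp (Fin κ)).measurable.comp (measurable_pi_apply p.2))

theorem measurePreserving_vectorsEquiv (l κ : ℕ) :
    MeasurePreserving (vectorsEquiv l κ) volume volume := by
  refine MeasurePreserving.symm (vectorsEquiv l κ).symm
    ⟨(vectorsEquiv l κ).symm.measurable, (Measure.pi_eq fun s hs => ?_).symm⟩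
  rw [Measure.map_apply (vectorsEquiv l κ).symm.measurable (MeasurableSet.univ_pi hs)]
  have hpre : (vectorsEquiv l κ).symm ⁻¹' (Set.univ.pi s) =
      Set.univ.pi fun i => (@WithLp.ofLp 2 (Fin κ → ℝ)) ⁻¹' (Set.univ.pi fun k => s (k, i)) := by
    ext b
    simp only [Set.mem_preimage, Set.mem_univ_pi]
    exact ⟨fun h i k => h (k, i), fun h p => h p.2 p.1⟩
  rw [hpre, volume_pi_pi, Fintype.prod_prod_type_right]
  refine Finset.prod_congr rfl fun i _ => ?_
  rw [(PiLp.volume_preserving_ofLp (Fin κ)).measure_preimage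
    (MeasurableSet.univ_pi fun k => hs (k, i)).nullMeasurableSet, volume_pi_pi]

theorem subspaceVolume_eq_volume {N : ℕ} (S : Submodule ℝ (EuclideanSpace ℝ (Fin N))) :
    subspaceVolume S = volume :=
  (stdOrthonormalBasis ℝ S).addHaar_eq_volume

end Orthogonal

/-! ### The parametrization in a complex number of dimensions -/

namespace LoopIntegral

variable {dp l r : ℕ} {I : LoopIntegral dp l r} {e : Module.Basis (Fin 4) ℝ Phys}

theorem parMeasure_eq_volume (I : LoopIntegral dp l r) : I.parMeasure = volume := by
  simp only [parMeasure, subspaceVolume_eq_volume]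
  rfl

theorem finrank_par (I : LoopIntegral dp l r) : Module.finrank ℝ I.par = dp := by
  rw [finrank_span_eq_card I.indep, Fintype.card_fin]

/-- The isometry of `ℝ^κ` onto the span of the transverse basis vectors. -/
def IsAdapted.transverse (he : I.IsAdapted e) : EuclideanSpace ℝ (Fin (4 - dp)) →ₗᵢ[ℝ] Phys where
  toFun a := ∑ k : Fin (4 - dp), a k • e ⟨dp + k, by omega⟩
  map_add' a b := by simp only [PiLp.add_apply, add_smul, Finset.sum_add_distrib]
  map_smul' c a := by
    simp only [PiLp.smul_apply, smul_eq_mul, mul_smul, Finset.smul_sum, RingHom.id_apply]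
  norm_map' a := by
    refine (sq_eq_sq₀ (norm_nonneg _) (norm_nonneg _)).1 ?_
    change ‖∑ k : Fin (4 - dp), a k • e ⟨dp + k, by omega⟩‖ ^ 2 = _
    rw [← real_inner_self_eq_norm_sq, sum_inner, EuclideanSpace.norm_sq_eq]
    refine Finset.sum_congr rfl fun k _ => ?_
    rw [inner_sum, Finset.sum_eq_single k]
    · rw [real_inner_smul_left, real_inner_smul_right, he.inner_transverse, if_pos rfl, mul_one,
        Real.norm_eq_abs, sq_abs, pow_two]
    · intro k' _ hk
      rw [real_inner_smul_left, real_inner_smul_right, he.inner_transverse, if_neg hk.symm,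
        mul_zero, mul_zero]
    · exact fun h => absurd (Finset.mem_univ k) h

theorem IsAdapted.transverse_apply (he : I.IsAdapted e) (a : EuclideanSpace ℝ (Fin (4 - dp))) :
    he.transverse a = ∑ k : Fin (4 - dp), a k • e ⟨dp + k, by omega⟩ := rfl

theorem IsAdapted.inner_par_transverse (he : I.IsAdapted e) {x : Phys} (hx : x ∈ I.par)
    (a : EuclideanSpace ℝ (Fin (4 - dp))) : ⟪x, he.transverse a⟫ = 0 := by
  rw [he.transverse_apply, inner_sum]
  refine Finset.sum_eq_zero fun k _ => ?_
  rw [real_inner_smul_right, real_inner_comm, he.inner_eq_zero (by simp) hx, mul_zero]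

/-- The physical components assembled from parallel and transverse ones, next to the `μ_ij`. -/
def IsAdapted.physMap (he : I.IsAdapted e)
    (w : (Fin l → I.par) × (PerpIdx l (4 - dp) → ℝ) × (SymIdx l → ℝ)) :
    (Fin l → Phys) × (SymIdx l → ℝ) :=
  (fun i => (w.1 i : Phys) + he.transverse (vectorsEquiv l (4 - dp) w.2.1 i), w.2.2)

theorem IsAdapted.measurePreserving_physMap (he : I.IsAdapted e) (h4 : dp ≤ 4) :
    MeasurePreserving he.physMap
      (I.parMeasure.prod ((volume : Measure (PerpIdx l (4 - dp) → ℝ)).prod (gramMeasure l)))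
      (measureDimReg l) := by
  have h1 := measurePreserving_pi_add_of_orthogonal l I.par.subtypeₗᵢ he.transverse
    (fun x a => he.inner_par_transverse x.2 a) (by
      rw [I.finrank_par, finrank_euclideanSpace_fin, finrank_euclideanSpace_fin]; omega)
  have h2 : MeasurePreserving (Prod.map id (vectorsEquiv l (4 - dp)) :
      (Fin l → I.par) × (PerpIdx l (4 - dp) → ℝ) → _) volume volume :=
    MeasurePreserving.prod (μa := volume) (μc := volume) (MeasurePreserving.id _)
      (measurePreserving_vectorsEquiv l (4 - dp))
  have h3 := (h1.comp h2).prod (MeasurePreserving.id (gramMeasure l))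
  have h4 := (measurePreserving_prodAssoc (volume : Measure (Fin l → I.par))
    (volume : Measure (PerpIdx l (4 - dp) → ℝ)) (gramMeasure l)).symm
  rw [parMeasure_eq_volume]
  exact h3.comp h4

/-- The physical components and the `μ_ij` as functions of the new variables. -/
def IsAdapted.fullMap (he : I.IsAdapted e) (w : (Fin l → I.par) × SrcSpace l (4 - dp)) :
    (Fin l → Phys) × (SymIdx l → ℝ) :=
  he.physMap (w.1, perpMap w.2)

theorem sigmaFinite_parMeasure (I : LoopIntegral dp l r) : SigmaFinite I.parMeasure := by
  rw [parMeasure_eq_volume]; infer_instance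

theorem IsAdapted.measurable_fullMap (he : I.IsAdapted e) (h4 : dp ≤ 4) :
    Measurable he.fullMap :=
  (he.measurePreserving_physMap h4).measurable.comp
    (measurable_fst.prodMk (measurable_perpMap.comp measurable_snd))

theorem IsAdapted.map_fullMap (he : I.IsAdapted e) (h4 : dp ≤ 4) :
    Measure.map he.fullMap (I.measurePar.withDensity fun w => srcDensity (srcPoint w.2)) =
      measureDimReg l := by
  have := I.sigmaFinite_parMeasure
  have hJ : Measurable fun z : SrcSpace l (4 - dp) => srcDensity (srcPoint z) :=
    measurable_srcDensity.comp measurable_srcPoint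
  have h1 : I.measurePar.withDensity (fun w => srcDensity (srcPoint w.2)) =
      I.parMeasure.prod ((srcMeasure l (4 - dp)).withDensity fun z => srcDensity (srcPoint z)) :=
    (prod_withDensity_right hJ).symm
  have h2 : Measure.map (Prod.map id perpMap)
      (I.parMeasure.prod ((srcMeasure l (4 - dp)).withDensity fun z => srcDensity (srcPoint z))) =
      I.parMeasure.prod ((volume : Measure (PerpIdx l (4 - dp) → ℝ)).prod (gramMeasure l)) := by
    rw [← Measure.map_prod_map _ _ measurable_id measurable_perpMap, Measure.map_id,
      map_perpMap_withDensity]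
  rw [h1, ← (he.measurePreserving_physMap h4).map_eq, ← h2,
    Measure.map_map (he.measurePreserving_physMap h4).measurable
      (measurable_id.prodMap measurable_perpMap)]
  rfl

theorem IsAdapted.inner_transverse_vectors (he : I.IsAdapted e) (a : PerpIdx l (4 - dp) → ℝ)
    (i j : Fin l) :
    ⟪he.transverse (vectorsEquiv l (4 - dp) a i), he.transverse (vectorsEquiv l (4 - dp) a j)⟫ =
      ∑ k, a (k, i) * a (k, j) := by
  rw [he.transverse.inner_map_map, PiLp.inner_apply]
  refine Finset.sum_congr rfl fun k _ => ?_
  exact mul_comm _ _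

theorem measurable_numAt_comp (I : LoopIntegral dp l r) :
    Measurable fun z : (Fin l → Phys) × (SymIdx l → ℝ) => I.numAt z.1 (symMatrix z.2) := by
  have h : Continuous fun x : (Fin 4 × Fin l) ⊕ (Fin l × Fin l) → ℂ => MvPolynomial.eval x I.num :=
    MvPolynomial.continuous_eval _
  refine h.measurable.comp (measurable_pi_lambda _ fun x => ?_)
  rcases x with x | x
  · exact Complex.measurable_ofReal.comp (by fun_prop)
  · refine Complex.measurable_ofReal.comp ?_
    simp only [symMatrix]
    fun_prop

theorem measurable_den_comp (I : LoopIntegral dp l r) (j : Fin r) :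
    Measurable fun z : (Fin l → Phys) × (SymIdx l → ℝ) => I.den z.1 (symMatrix z.2) j := by
  simp only [den, symMatrix]
  fun_prop

theorem measurable_integrandDimReg (I : LoopIntegral dp l r) (d : ℂ) :
    Measurable (I.integrandDimReg d) := by
  refine ((measurable_gramWeight (d - 4)).comp measurable_snd).mul
    (I.measurable_numAt_comp.div (Finset.measurable_prod _ fun j _ => ?_))
  exact Complex.measurable_ofReal.comp (I.measurable_den_comp j)

theorem IsAdapted.numAt_fullMap (he : I.IsAdapted e) (w : (Fin l → I.par) × SrcSpace l (4 - dp)) :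
    I.numAt (he.fullMap w).1 (symMatrix (he.fullMap w).2) =
      I.numPar (nestedMap l (4 - dp)) e w.1 w.2.1 (angles w.2.2.1) (angles w.2.2.2) := by
  have h : symMatrix (he.fullMap w).2 = fun i j =>
      (nestedMap l (4 - dp)).lamMatrix w.2.1 (angles w.2.2.1) i j -
        ∑ k, (nestedMap l (4 - dp)).perpComp w.2.1 (angles w.2.2.1) (angles w.2.2.2) k i *
          (nestedMap l (4 - dp)).perpComp w.2.1 (angles w.2.2.1) (angles w.2.2.2) k j := by
    have h1 := symMatrix_sub_compGram (fun p => bigMap (srcPoint w.2) (Sum.inl p))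
      (fun p => bigMap (srcPoint w.2) (Sum.inr p))
    exact h1
  rw [h]
  rfl

theorem IsAdapted.den_fullMap (he : I.IsAdapted e) (w : (Fin l → I.par) × SrcSpace l (4 - dp))
    (j : Fin r) :
    I.den (he.fullMap w).1 (symMatrix (he.fullMap w).2) j =
      I.denPar (nestedMap l (4 - dp)) w.1 w.2.1 (angles w.2.2.1) j := by
  have h := I.den_add (fun i => (w.1 i : Phys))
    (fun i => he.transverse (vectorsEquiv l (4 - dp) (perpMap w.2).1 i))
    (symMatrix (he.fullMap w).2)
    (fun i k => he.inner_par_transverse (w.1 k).2 _)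
    (fun i k => he.inner_par_transverse (I.p_mem_par k) _) j
  refine h.trans ?_
  rw [denPar]
  congr 1
  funext i k
  rw [he.inner_transverse_vectors]
  have h1 := congrFun (congrFun (symMatrix_sub_compGram
    (fun p => bigMap (srcPoint w.2) (Sum.inl p))
    (fun p => bigMap (srcPoint w.2) (Sum.inr p))) i) k
  exact (congrArg (· + _) h1).trans (sub_add_cancel _ _)

/-- Absolute convergence and value of the dimensionally regularized integral, before the integral
over the new variables is written as an iterated one. -/
theorem IsAdapted.integrable_and_integral_fullMap (he : I.IsAdapted e) (h4 : dp ≤ 4) (d : ℂ) :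
    (Integrable (I.integrandDimReg d) (measureDimReg l) ↔
      I.IntegrablePar (nestedMap l (4 - dp)) e d) ∧
    ∫ z, I.integrandDimReg d z ∂(measureDimReg l) =
      ∫ w, I.integrandPar (nestedMap l (4 - dp)) e d w.1 w.2.1 w.2.2.1 w.2.2.2 ∂I.measurePar := by
  have := I.sigmaFinite_parMeasure
  refine integrable_and_integral_of_map (he.measurable_fullMap h4)
    (measurable_srcDensity.comp (measurable_srcPoint.comp measurable_snd))
    (fun w => srcDensity_ne_top _) (he.map_fullMap h4) (I.measurable_integrandDimReg d) ?_
  have hae : ∀ᵐ w ∂I.measurePar, srcDensity (srcPoint w.2) ≠ 0 :=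
    (Measure.quasiMeasurePreserving_snd (μ := I.parMeasure) (ν := srcMeasure l (4 - dp))).ae
      ae_srcDensity_ne_zero
  filter_upwards [hae] with w hw
  have hd : d - 4 + ((4 - dp : ℕ) : ℂ) = d - dp := by
    rw [Nat.cast_sub h4]; push_cast; ring
  have h1 := lamWeight_mul_perpWeight (d - 4) hw
  rw [hd] at h1
  simp only [integrandDimReg, he.numAt_fullMap, he.den_fullMap, integrandPar]
  rw [← mul_assoc]
  exact congrArg (· * _) h1

theorem integral_prod_four {A B C E : Type*} [MeasurableSpace A] [MeasurableSpace B]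
    [MeasurableSpace C] [MeasurableSpace E] {μ : Measure A} {ν : Measure B} {ρ : Measure C}
    {σ : Measure E} [SigmaFinite μ] [SigmaFinite ν] [SigmaFinite ρ] [SigmaFinite σ]
    {f : A × B × C × E → ℂ} (hf : Integrable f (μ.prod (ν.prod (ρ.prod σ)))) :
    ∫ z, f z ∂(μ.prod (ν.prod (ρ.prod σ))) =
      ∫ a, ∫ b, ∫ c, ∫ x, f (a, b, c, x) ∂σ ∂ρ ∂ν ∂μ := by
  rw [integral_prod _ hf]
  refine integral_congr_ae ?_
  filter_upwards [hf.prod_right_ae] with a ha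
  rw [integral_prod _ ha]
  refine integral_congr_ae ?_
  filter_upwards [ha.prod_right_ae] with b hb
  rw [integral_prod _ hb]

/-- The dimensionally regularized integral in the new variables. -/
theorem IsAdapted.dimReg (he : I.IsAdapted e) (h4 : dp ≤ 4) (d : ℂ) :
    (Integrable (I.integrandDimReg d) (measureDimReg l) ↔
      I.IntegrablePar (nestedMap l (4 - dp)) e d) ∧
    (Integrable (I.integrandDimReg d) (measureDimReg l) →
      I.integralDimReg d = I.integralPar (nestedMap l (4 - dp)) e d) := by
  have := I.sigmaFinite_parMeasure
  obtain ⟨h1, h2⟩ := he.integrable_and_integral_fullMap h4 d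
  refine ⟨h1, fun h => ?_⟩
  rw [integralDimReg, integralPar, h2]
  exact congrArg _ (integral_prod_four (h1.1 h))

end LoopIntegral

/-! ### Polar coordinates and the distribution of scalar products -/

section GramStep

open Matrix
open scoped ENNReal

/-- Half the area `π^{K/2} / Γ(K/2)` of the unit sphere in `ℝ^K`. -/
def halfArea (K : ℕ) : ℝ := Real.pi ^ ((K : ℝ) / 2) / Real.Gamma ((K : ℝ) / 2)

theorem halfArea_pos {K : ℕ} (hK : 0 < K) : 0 < halfArea K := by
  have : (0 : ℝ) < K := by exact_mod_cast hK
  exact div_pos (Real.rpow_pos_of_pos Real.pi_pos _) (Real.Gamma_pos_of_pos (by positivity))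

theorem toSphere_univ_eq {K : ℕ} (hK : 0 < K) :
    (volume : Measure (EuclideanSpace ℝ (Fin K))).toSphere Set.univ =
      ENNReal.ofReal (2 * halfArea K) := by
  have hK' : (0 : ℝ) < K := by exact_mod_cast hK
  have : Nonempty (Fin K) := ⟨⟨0, hK⟩⟩
  rw [Measure.toSphere_apply_univ, finrank_euclideanSpace_fin, EuclideanSpace.volume_ball,
    Fintype.card_fin, ENNReal.ofReal_one, one_pow, one_mul, ← ENNReal.ofReal_natCast,
    ← ENNReal.ofReal_mul hK'.le, halfArea, Real.Gamma_add_one (by positivity), Real.sqrt_eq_rpow,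
    ← Real.rpow_natCast, ← Real.rpow_mul Real.pi_pos.le]
  congr 1
  have hG : Real.Gamma ((K : ℝ) / 2) ≠ 0 := (Real.Gamma_pos_of_pos (by positivity)).ne'
  rw [show (1 / 2 * (K : ℝ)) = (K : ℝ) / 2 by ring]
  field_simp

/-- Polar coordinates for functions of the square of the norm. -/
theorem lintegral_norm_sq {K : ℕ} (hK : 0 < K) {h : ℝ → ℝ≥0∞} (hh : Measurable h) :
    ∫⁻ b : EuclideanSpace ℝ (Fin K), h (‖b‖ ^ 2) =
      ENNReal.ofReal (halfArea K) *
        ∫⁻ s in Set.Ioi (0 : ℝ), ENNReal.ofReal (s ^ ((K : ℝ) / 2 - 1)) * h s := by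
  have : Nonempty (Fin K) := ⟨⟨0, hK⟩⟩
  have hpolar : ∫⁻ b : EuclideanSpace ℝ (Fin K), h (‖b‖ ^ 2) =
      ENNReal.ofReal (2 * halfArea K) *
        ∫⁻ r in Set.Ioi (0 : ℝ), ENNReal.ofReal (r ^ (K - 1)) * h (r ^ 2) := by
    have h1 := (volume : Measure (EuclideanSpace ℝ (Fin K))).measurePreserving_homeomorphUnitSphereProd
    have h2 := h1.lintegral_comp_emb (Homeomorph.measurableEmbedding _)
      (fun z => h ((z.2 : ℝ) ^ 2))
    simp only [homeomorphUnitSphereProd_apply_snd_coe] at h2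
    have hm : Measurable fun r : Set.Ioi (0 : ℝ) => h ((r : ℝ) ^ 2) := by fun_prop
    have hm' : Measurable fun r : Set.Ioi (0 : ℝ) => ENNReal.ofReal ((r : ℝ) ^ (K - 1)) := by
      fun_prop
    have hm2 : Measurable fun z : Metric.sphere (0 : EuclideanSpace ℝ (Fin K)) 1 × Set.Ioi (0 : ℝ) =>
        h ((z.2 : ℝ) ^ 2) := hm.comp measurable_snd
    rw [lintegral_prod _ hm2.aemeasurable] at h2
    simp only [lintegral_const] at h2
    rw [toSphere_univ_eq hK, finrank_euclideanSpace_fin, Measure.volumeIoiPow,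
      lintegral_withDensity_eq_lintegral_mul _ hm' hm] at h2
    have h3 := lintegral_subtype_comap (μ := (volume : Measure (EuclideanSpace ℝ (Fin K))))
      (measurableSet_singleton 0).compl fun b => h (‖b‖ ^ 2)
    rw [restrict_compl_singleton] at h3
    rw [← h3, h2, mul_comm]
    congr 1
    exact lintegral_subtype_comap (μ := (volume : Measure ℝ)) measurableSet_Ioi
      fun r => ENNReal.ofReal (r ^ (K - 1)) * h (r ^ 2)
  have himage : (fun r : ℝ => r ^ 2) '' Set.Ioi 0 = Set.Ioi 0 := by
    ext s
    constructor
    · rintro ⟨r, hr, rfl⟩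
      exact pow_pos (Set.mem_Ioi.1 hr) 2
    · intro hs
      exact ⟨Real.sqrt s, Real.sqrt_pos.2 hs, Real.sq_sqrt (le_of_lt hs)⟩
  have hsub := lintegral_image_eq_lintegral_abs_deriv_mul (s := Set.Ioi (0 : ℝ))
    (f := fun r : ℝ => r ^ 2) (f' := fun r => 2 * r) measurableSet_Ioi
    (fun r _ => by simpa using (hasDerivAt_pow 2 r).hasDerivWithinAt)
    (fun r hr r' hr' hrr => (sq_eq_sq₀ (le_of_lt hr) (le_of_lt hr')).1 hrr)
    (fun s => ENNReal.ofReal (s ^ ((K : ℝ) / 2 - 1)) * h s)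
  rw [himage] at hsub
  rw [hpolar, hsub, mul_comm 2, ENNReal.ofReal_mul (halfArea_pos hK).le, mul_assoc,
    ← lintegral_const_mul' _ _ ENNReal.ofReal_ne_top]
  congr 1
  refine setLIntegral_congr_fun measurableSet_Ioi fun r hr => ?_
  have hr0 : (0 : ℝ) < r := hr
  rw [← mul_assoc, ← mul_assoc, ← ENNReal.ofReal_mul (by norm_num),
    ← ENNReal.ofReal_mul (abs_nonneg _), abs_of_pos (by positivity)]
  congr 2
  rw [← Real.rpow_natCast r 2, ← Real.rpow_mul hr0.le, mul_assoc]
  congr 1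
  have h1 : r * r ^ (((2 : ℕ) : ℝ) * ((K : ℝ) / 2 - 1)) =
      r ^ (1 + ((2 : ℕ) : ℝ) * ((K : ℝ) / 2 - 1)) := by
    rw [Real.rpow_add hr0, Real.rpow_one]
  rw [h1, ← Real.rpow_natCast, Nat.cast_sub hK]
  congr 1
  push_cast
  ring

/-- A subspace of dimension `|ι|` is the range of an isometry of `ℝ^ι`. -/
theorem exists_linearIsometry_range_eq {E ι : Type*} [NormedAddCommGroup E] [InnerProductSpace ℝ E]
    [Fintype ι] (S : Submodule ℝ E) [FiniteDimensional ℝ S]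
    (h : Module.finrank ℝ S = Fintype.card ι) :
    ∃ f : EuclideanSpace ℝ ι →ₗᵢ[ℝ] E, (∀ a, f a ∈ S) ∧ ∀ x ∈ S, ∃ a, f a = x := by
  let b := (stdOrthonormalBasis ℝ S).reindex
    (Fintype.equivOfCardEq (by rw [Fintype.card_fin, h]) : Fin (Module.finrank ℝ S) ≃ ι)
  refine ⟨S.subtypeₗᵢ.comp b.repr.symm.toLinearIsometry, fun a => (b.repr.symm a).2, fun x hx => ?_⟩
  refine ⟨b.repr ⟨x, hx⟩, ?_⟩
  change ((b.repr.symm (b.repr ⟨x, hx⟩) : S) : E) = x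
  rw [LinearIsometryEquiv.symm_apply_apply]

variable {V : Type} [Fintype V] [DecidableEq V] {M : ℕ}

theorem measurable_bordered_det (B : Matrix V V ℝ) :
    Measurable fun z : (V → ℝ) × ℝ => (bordered B z.1 z.2).det := by
  simp only [det_apply]
  refine Finset.measurable_sum _ fun σ _ =>
    (Finset.measurable_prod _ fun i _ => ?_).const_smul (Equiv.Perm.sign σ : ℤˣ)
  generalize σ i = i'
  rcases i with i | i <;> rcases i' with i' | i' <;> simp only [bordered, fromBlocks_apply₁₁,
    fromBlocks_apply₁₂, fromBlocks_apply₂₁, fromBlocks_apply₂₂, of_apply, replicateCol_apply,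
    replicateRow_apply] <;> fun_prop

theorem measurableSet_bordered_posDef (B : Matrix V V ℝ) :
    MeasurableSet {z : (V → ℝ) × ℝ | (bordered B z.1 z.2).PosDef} := by
  refine measurableSet_posDef fun i i' => ?_
  rcases i with i | i <;> rcases i' with i' | i' <;> simp only [bordered, fromBlocks_apply₁₁,
    fromBlocks_apply₁₂, fromBlocks_apply₂₁, fromBlocks_apply₂₂, of_apply, replicateCol_apply,
    replicateRow_apply] <;> fun_prop

/-- Integration over one vector `x` of a function of its scalar products with given linearly
independent vectors and of its square. The component of `x` in the span of the given vectors is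
subject to a linear change of variables, and polar coordinates are used in the orthogonal
complement. -/
theorem lintegral_inner_norm_sq (y : V → EuclideanSpace ℝ (Fin M)) (hy : (gram ℝ y).PosDef)
    (hV : Fintype.card V < M) {F : (V → ℝ) × ℝ → ℝ≥0∞} (hF : Measurable F) :
    ∫⁻ x : EuclideanSpace ℝ (Fin M), F (fun v => ⟪y v, x⟫, ‖x‖ ^ 2) =
      ENNReal.ofReal (halfArea (M - Fintype.card V)) *
        (ENNReal.ofReal ((gram ℝ y).det ^ (-(((M : ℝ) - 1 - Fintype.card V) / 2))) *
          ∫⁻ w : V → ℝ, ∫⁻ t : ℝ,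
            {z : (V → ℝ) × ℝ | (bordered (gram ℝ y) z.1 z.2).PosDef}.indicator
              (fun z => ENNReal.ofReal ((bordered (gram ℝ y) z.1 z.2).det ^
                (((M : ℝ) - 1 - (Fintype.card V + 1 : ℕ)) / 2)) * F z) (w, t)) := by
  have hli := linearIndependent_of_posDef_gram hy
  generalize hK : M - Fintype.card V = K
  set S := Submodule.span ℝ (Set.range y) with hS
  have hdim : Module.finrank ℝ S = Fintype.card V := finrank_span_eq_card hli
  have hdim' : Module.finrank ℝ Sᗮ = Fintype.card (Fin K) := by
    have := S.finrank_add_finrank_orthogonal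
    rw [finrank_euclideanSpace_fin, hdim] at this
    rw [Fintype.card_fin]; omega
  obtain ⟨f, hf, hf'⟩ := exists_linearIsometry_range_eq (ι := V) S hdim
  obtain ⟨g, hg, -⟩ := exists_linearIsometry_range_eq (ι := Fin K) Sᗮ hdim'
  have horth : ∀ a b, ⟪f a, g b⟫ = 0 := fun a b => (S.mem_orthogonal _).1 (hg b) _ (hf a)
  -- coordinates of the given vectors in an orthonormal basis of their span
  choose η hη using fun v => hf' (y v) (Submodule.subset_span ⟨v, rfl⟩)
  let A : Matrix V V ℝ := of fun v k => η v k
  have hA : A * Aᵀ = gram ℝ y := by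
    ext v v'
    rw [gram_apply, ← hη v, ← hη v', f.inner_map_map, PiLp.inner_apply, Matrix.mul_apply]
    refine Finset.sum_congr rfl fun k _ => ?_
    exact mul_comm _ _
  have hdetsq : A.det ^ 2 = (gram ℝ y).det := by
    rw [← hA, det_mul, det_transpose, pow_two]
  have hdet : A.det ≠ 0 := by
    intro h0
    have := hy.det_pos
    rw [← hdetsq, h0] at this
    simp at this
  have hK0 : 0 < K := by omega
  have hKcast : (K : ℝ) = M - Fintype.card V := by rw [← hK, Nat.cast_sub hV.le]
  set p : ℝ := ((M : ℝ) - 1 - (Fintype.card V + 1 : ℕ)) / 2 with hp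
  have hpK : (K : ℝ) / 2 - 1 = p := by rw [hp, hKcast]; push_cast; ring
  set G : (V → ℝ) × ℝ → ℝ≥0∞ :=
    {z : (V → ℝ) × ℝ | (bordered (gram ℝ y) z.1 z.2).PosDef}.indicator
      (fun z => ENNReal.ofReal ((bordered (gram ℝ y) z.1 z.2).det ^ p) * F z) with hG
  have hGm : Measurable G := by
    refine Measurable.indicator ?_ (measurableSet_bordered_posDef _)
    exact ((measurable_bordered_det _).pow_const p).ennreal_ofReal.mul hF
  have hFx : Measurable fun x : EuclideanSpace ℝ (Fin M) =>
      F (fun v => ⟪y v, x⟫, ‖x‖ ^ 2) := by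
    refine hF.comp (Measurable.prodMk (measurable_pi_lambda _ fun v => ?_) (by fun_prop))
    exact (continuous_const.inner continuous_id).measurable
  have hmp := measurePreserving_add_of_orthogonal f g horth (by
    rw [finrank_euclideanSpace, finrank_euclideanSpace_fin, finrank_euclideanSpace_fin]; omega)
  have hval : ∀ a b, F (fun v => ⟪y v, f a + g b⟫, ‖f a + g b‖ ^ 2) =
      F (A *ᵥ a.ofLp, ∑ k, a k ^ 2 + ‖b‖ ^ 2) := by
    intro a b
    congr 2
    · funext v
      rw [← hη v, inner_add_right, horth, add_zero, f.inner_map_map, PiLp.inner_apply]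
      refine Finset.sum_congr rfl fun k _ => ?_
      exact mul_comm _ _
    · rw [norm_add_sq_real, horth, f.norm_map, g.norm_map, EuclideanSpace.norm_sq_eq]
      simp
  have hsq : (0 : ℝ) < A.det ^ 2 := by positivity
  have hmul : Measurable fun a : V → ℝ => A *ᵥ a :=
    (LinearMap.continuous_on_pi (Matrix.mulVecLin A)).measurable
  have hinner : ∀ a : V → ℝ, ∫⁻ b : EuclideanSpace ℝ (Fin K), F (A *ᵥ a, ∑ k, a k ^ 2 + ‖b‖ ^ 2) =
      ENNReal.ofReal (halfArea K) * (ENNReal.ofReal ((A.det ^ 2) ^ (-p)) *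
        ∫⁻ t, G (A *ᵥ a, t)) := by
    intro a
    set c := ∑ k, a k ^ 2 with hc
    have hm : Measurable fun s : ℝ => F (A *ᵥ a, c + s) := by fun_prop
    rw [lintegral_norm_sq hK0 hm]
    congr 1
    rw [← lintegral_const_mul' _ _ ENNReal.ofReal_ne_top, ← lintegral_indicator measurableSet_Ioi,
      ← lintegral_add_left_eq_self
        (fun t => ENNReal.ofReal ((A.det ^ 2) ^ (-p)) * G (A *ᵥ a, t)) c]
    refine lintegral_congr fun s => ?_
    -- after the shift by `c = |a|²` the new diagonal entry is `s`, the square of the orthogonal part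
    have hdetb : (bordered (gram ℝ y) (A *ᵥ a) (c + s)).det = A.det ^ 2 * s := by
      rw [← hA, det_bordered_mul_transpose, ← hc]; ring
    have hiff : (bordered (gram ℝ y) (A *ᵥ a) (c + s)).PosDef ↔ 0 < s := by
      rw [← hA, posDef_bordered_mul_transpose hdet, ← hc]
      exact lt_add_iff_pos_right c
    by_cases hs : 0 < s
    · rw [Set.indicator_of_mem (show s ∈ Set.Ioi 0 from hs), hG, Set.indicator_of_mem
        (show (A *ᵥ a, c + s) ∈ {z : (V → ℝ) × ℝ | (bordered (gram ℝ y) z.1 z.2).PosDef}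
          from hiff.2 hs), hdetb, hpK, ← mul_assoc,
        ← ENNReal.ofReal_mul (Real.rpow_nonneg hsq.le _), Real.mul_rpow hsq.le hs.le, ← mul_assoc,
        ← Real.rpow_add hsq, neg_add_cancel, Real.rpow_zero, one_mul]
    · rw [Set.indicator_of_notMem (show s ∉ Set.Ioi 0 from hs), hG, Set.indicator_of_notMem
        (show (A *ᵥ a, c + s) ∉ {z : (V → ℝ) × ℝ | (bordered (gram ℝ y) z.1 z.2).PosDef}
          from fun h => hs (hiff.1 h)), mul_zero]
  have hGt : Measurable fun w : V → ℝ => ∫⁻ t, G (w, t) := hGm.lintegral_prod_right'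
  rw [← hmp.lintegral_comp hFx]
  simp only [hval]
  have hFab : Measurable fun z : EuclideanSpace ℝ V × EuclideanSpace ℝ (Fin K) =>
      F (A *ᵥ z.1.ofLp, ∑ k, z.1 k ^ 2 + ‖z.2‖ ^ 2) := by
    refine hF.comp (Measurable.prodMk ?_ (by fun_prop))
    exact hmul.comp ((PiLp.volume_preserving_ofLp V).measurable.comp measurable_fst)
  rw [Measure.volume_eq_prod, lintegral_prod _ hFab.aemeasurable]
  have hof := (PiLp.volume_preserving_ofLp V).lintegral_comp
    (f := fun a : V → ℝ => ENNReal.ofReal (halfArea K) * (ENNReal.ofReal ((A.det ^ 2) ^ (-p)) *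
        ∫⁻ t, G (A *ᵥ a, t))) (by
      exact ((hGt.comp hmul).const_mul _).const_mul _)
  have hstep : ∀ a : EuclideanSpace ℝ V,
      ∫⁻ b : EuclideanSpace ℝ (Fin K), F (A *ᵥ a.ofLp, ∑ k, a k ^ 2 + ‖b‖ ^ 2) =
      ENNReal.ofReal (halfArea K) * (ENNReal.ofReal ((A.det ^ 2) ^ (-p)) *
        ∫⁻ t, G (A *ᵥ a.ofLp, t)) := fun a => hinner a.ofLp
  simp only [hstep]
  rw [hof, lintegral_const_mul' _ _ ENNReal.ofReal_ne_top,
    lintegral_const_mul' _ _ ENNReal.ofReal_ne_top]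
  congr 1
  rw [lintegral_mulVec hdet hGt, ← mul_assoc, ← hdetsq,
    ← ENNReal.ofReal_mul (Real.rpow_nonneg hsq.le _)]
  congr 2
  -- the Jacobian `|det A|⁻¹` shifts the exponent of the Gram determinant by `-1/2`
  have habs : |A.det| = (A.det ^ 2) ^ (1 / 2 : ℝ) := by
    rw [← Real.sqrt_eq_rpow, Real.sqrt_sq_eq_abs]
  rw [habs, ← Real.rpow_add hsq]
  congr 1
  rw [hp]
  push_cast
  ring

end GramStep

section GramDistribution

open Matrix
open scoped ENNReal

variable {l M : ℕ}

/-- The scalar products `y_i · y_j`, `i ≤ j`, of a family of vectors. -/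
def gramUpper (y : Fin l → EuclideanSpace ℝ (Fin M)) : SymIdx l → ℝ :=
  fun p => ⟪y p.1.1, y p.1.2⟫

/-- The scalar products of a family of vectors as target variables without components `a_kj`. -/
def gramPoint (y : Fin l → EuclideanSpace ℝ (Fin M)) : TgtIdx l 0 → ℝ :=
  Sum.elim (fun _ => 0) (gramUpper y)

theorem measurable_gramUpper :
    Measurable (gramUpper : (Fin l → EuclideanSpace ℝ (Fin M)) → SymIdx l → ℝ) := by
  refine measurable_pi_lambda _ fun p => ?_
  exact ((continuous_apply p.1.1).inner (continuous_apply p.1.2)).measurable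

theorem measurable_gramPoint :
    Measurable (gramPoint : (Fin l → EuclideanSpace ℝ (Fin M)) → TgtIdx l 0 → ℝ) := by
  refine measurable_pi_lambda _ fun i => ?_
  rcases i with p | p
  · exact measurable_const
  · exact (measurable_pi_apply p).comp measurable_gramUpper

theorem symMatrix_gramUpper (y : Fin l → EuclideanSpace ℝ (Fin M)) (i j : Fin l) :
    symMatrix (gramUpper y) i j = ⟪y i, y j⟫ := by
  simp only [symMatrix, gramUpper]
  rcases le_total i j with h | h
  · rw [min_eq_left h, max_eq_right h]
  · rw [min_eq_right h, max_eq_left h, real_inner_comm]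

/-- A family of vectors with labels in `VecIdx l 0`. -/
def vecFamily (y : Fin l → EuclideanSpace ℝ (Fin M)) : VecIdx l 0 → EuclideanSpace ℝ (Fin M) :=
  Sum.elim (fun _ => 0) y

theorem bigGram_gramPoint (y : Fin l → EuclideanSpace ℝ (Fin M)) :
    bigGram (gramPoint y) = gram ℝ (vecFamily y) := by
  ext v v'
  rcases v with k | i
  · exact k.elim0
  rcases v' with k | j
  · exact k.elim0
  · exact symMatrix_gramUpper y i j

theorem gramPoint_eq_glue (y : Fin (l + 1) → EuclideanSpace ℝ (Fin M)) :
    gramPoint y = glue (tgtSplit l 0) (gramPoint fun i => y i.castSucc)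
      (fun v => ⟪vecFamily (fun i => y i.castSucc) v, y (Fin.last l)⟫) (‖y (Fin.last l)‖ ^ 2) := by
  funext i
  obtain ⟨j, rfl⟩ := (tgtSplit l 0).surjective i
  rcases j with (p | p) | (k | i) | u
  · exact p.1.elim0
  · rw [glue_inl]; rfl
  · exact k.elim0
  · rw [glue_inr_inl]; rfl
  · rw [glue_inr_inr, ← real_inner_self_eq_norm_sq]; rfl

theorem det_bigGram_glue {κ : ℕ} (y : TgtIdx l κ → ℝ) (w : VecIdx l κ → ℝ) (t : ℝ) :
    (bigGram (glue (tgtSplit l κ) y w t)).det = (bordered (bigGram y) w t).det := by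
  rw [← bigGram_glue, det_submatrix_equiv_self]

theorem measurable_det_bigGram {κ : ℕ} :
    Measurable fun y : TgtIdx l κ → ℝ => (bigGram y).det := by
  simp only [det_apply]
  refine Finset.measurable_sum _ fun σ _ =>
    (Finset.measurable_prod _ fun v _ => ?_).const_smul (Equiv.Perm.sign σ : ℤˣ)
  generalize σ v = v'
  rcases v with k | i <;> rcases v' with k' | i' <;>
    simp only [bigGram, fromBlocks_apply₁₁, fromBlocks_apply₁₂, fromBlocks_apply₂₁,
      fromBlocks_apply₂₂, transpose_apply, of_apply, symMatrix] <;> fun_prop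

/-- The normalisation `∏_{j<l} |S^{M-1-j}| / 2` of the distribution of scalar products. -/
def gramConst (l M : ℕ) : ℝ := ∏ j ∈ Finset.range l, halfArea (M - j)

/-- The weight `det^{(M-1-l)/2}` on positive definite Gram matrices. -/
def gramDensity {l : ℕ} (M : ℕ) (u : TgtIdx l 0 → ℝ) : ℝ≥0∞ :=
  {u | (bigGram u).PosDef}.indicator
    (fun u => ENNReal.ofReal ((bigGram u).det ^ (((M : ℝ) - 1 - l) / 2))) u

theorem measurable_gramDensity (M : ℕ) : Measurable (gramDensity (l := l) M) :=
  (measurable_det_bigGram.pow_const _).ennreal_ofReal.indicator measurableSet_bigGram_posDef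

/-- The distribution of the scalar products of `l ≤ M` vectors of `ℝ^M`. -/
theorem lintegral_gramPoint (h : l ≤ M) {F : (TgtIdx l 0 → ℝ) → ℝ≥0∞} (hF : Measurable F) :
    ∫⁻ y : Fin l → EuclideanSpace ℝ (Fin M), F (gramPoint y) =
      ENNReal.ofReal (gramConst l M) * ∫⁻ u, gramDensity M u * F u := by
  induction l with
  | zero =>
    have : IsEmpty (SymIdx 0) := ⟨fun p => p.1.1.elim0⟩
    have h1 := Measure.volume_pi_eq_dirac (α := fun _ : TgtIdx 0 0 => ℝ) (fun _ => 0)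
    have h2 := Measure.volume_pi_eq_dirac (α := fun _ : Fin 0 => EuclideanSpace ℝ (Fin M))
      (fun _ => 0)
    have hpd : ∀ y : TgtIdx 0 0 → ℝ, (bigGram y).PosDef := fun y => posDef_of_empty _
    rw [h1, h2, lintegral_dirac, lintegral_dirac, gramDensity,
      Set.indicator_of_mem (show _ ∈ {u | (bigGram u).PosDef} from hpd _), det_isEmpty,
      Real.one_rpow, gramConst, Finset.range_zero, Finset.prod_empty, ENNReal.ofReal_one, one_mul,
      one_mul]
    congr 1
    exact Subsingleton.elim _ _
  | succ l ih =>
    have ih' := fun {F : (TgtIdx l 0 → ℝ) → ℝ≥0∞} (hF : Measurable F) => ih (by omega) hF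
    -- almost every family of `l` vectors is linearly independent
    have hae : ∀ᵐ y : Fin l → EuclideanSpace ℝ (Fin M), (bigGram (gramPoint y)).PosDef := by
      have hN : MeasurableSet {u : TgtIdx l 0 → ℝ | (bigGram u).PosDef}ᶜ :=
        measurableSet_bigGram_posDef.compl
      have h0 := ih' (F := {u : TgtIdx l 0 → ℝ | (bigGram u).PosDef}ᶜ.indicator fun _ => 1)
        (measurable_const.indicator hN)
      have hz : ∀ u : TgtIdx l 0 → ℝ,
          gramDensity M u * ({u | (bigGram u).PosDef}ᶜ.indicator (fun _ => 1) u : ℝ≥0∞) = 0 := by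
        intro u
        by_cases hu : (bigGram u).PosDef
        · rw [Set.indicator_of_notMem (show u ∉ {u : TgtIdx l 0 → ℝ | (bigGram u).PosDef}ᶜ from
            fun h => h hu), mul_zero]
        · rw [gramDensity, Set.indicator_of_notMem
            (show u ∉ {u : TgtIdx l 0 → ℝ | (bigGram u).PosDef} from hu), zero_mul]
      simp only [hz, lintegral_zero, mul_zero] at h0
      have hm : Measurable ({u : TgtIdx l 0 → ℝ | (bigGram u).PosDef}ᶜ.indicator
          fun _ => (1 : ℝ≥0∞)) := measurable_const.indicator hN
      have hmg : Measurable fun y : Fin l → EuclideanSpace ℝ (Fin M) =>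
          {u : TgtIdx l 0 → ℝ | (bigGram u).PosDef}ᶜ.indicator (fun _ => (1 : ℝ≥0∞))
            (gramPoint y) := hm.comp measurable_gramPoint
      rw [lintegral_eq_zero_iff hmg] at h0
      filter_upwards [h0] with y hy
      by_contra hcon
      have h1 : ({u : TgtIdx l 0 → ℝ | (bigGram u).PosDef}ᶜ.indicator (fun _ => 1)
        (gramPoint y) : ℝ≥0∞) = 1 := Set.indicator_of_mem
          (show gramPoint y ∈ {u : TgtIdx l 0 → ℝ | (bigGram u).PosDef}ᶜ from hcon) _
      exact one_ne_zero (h1.symm.trans hy)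
    have hmp := (volume_preserving_piFinSuccAbove
      (fun _ : Fin (l + 1) => EuclideanSpace ℝ (Fin M)) (Fin.last l)).symm
    have hFg : Measurable fun y : Fin (l + 1) → EuclideanSpace ℝ (Fin M) => F (gramPoint y) :=
      hF.comp measurable_gramPoint
    have hgt := measurable_glue (tgtSplit l 0)
    have hW : Measurable fun z => gramDensity M z * F z := (measurable_gramDensity (l := l + 1) M).mul hF
    let Φ : (TgtIdx l 0 → ℝ) → ℝ≥0∞ := fun u => ∫⁻ w : VecIdx l 0 → ℝ, ∫⁻ t : ℝ,
      gramDensity M (glue (tgtSplit l 0) u w t) * F (glue (tgtSplit l 0) u w t)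
    have hΦ : Measurable Φ := by
      refine Measurable.lintegral_prod_right' (f := fun z : (TgtIdx l 0 → ℝ) × (VecIdx l 0 → ℝ) =>
        ∫⁻ t : ℝ, gramDensity M (glue (tgtSplit l 0) z.1 z.2 t) *
          F (glue (tgtSplit l 0) z.1 z.2 t)) ?_
      refine Measurable.lintegral_prod_right' (f := fun z : ((TgtIdx l 0 → ℝ) ×
        (VecIdx l 0 → ℝ)) × ℝ => gramDensity M (glue (tgtSplit l 0) z.1.1 z.1.2 z.2) *
          F (glue (tgtSplit l 0) z.1.1 z.1.2 z.2)) ?_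
      exact hW.comp (hgt.comp (by fun_prop :
        Measurable fun z : ((TgtIdx l 0 → ℝ) × (VecIdx l 0 → ℝ)) × ℝ => (z.1.1, z.1.2, z.2)))
    -- the integral over the last vector, which depends on the earlier ones through their scalar
    -- products; its power of the determinant cancels against the density for `l` vectors
    let Ψ : (TgtIdx l 0 → ℝ) → ℝ≥0∞ := fun u => ENNReal.ofReal (halfArea (M - l)) *
      (ENNReal.ofReal ((bigGram u).det ^ (-(((M : ℝ) - 1 - l) / 2))) * Φ u)
    have hΨ : Measurable Ψ :=
      ((measurable_det_bigGram.pow_const _).ennreal_ofReal.mul hΦ).const_mul _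
    have hcard : Fintype.card (VecIdx l 0) = l := by simp
    have hstep : ∀ y : Fin l → EuclideanSpace ℝ (Fin M), (bigGram (gramPoint y)).PosDef →
        ∫⁻ x : EuclideanSpace ℝ (Fin M), F (glue (tgtSplit l 0) (gramPoint y)
          (fun v => ⟪vecFamily y v, x⟫) (‖x‖ ^ 2)) = Ψ (gramPoint y) := by
      intro y hy
      have hFgl : Measurable fun z : (VecIdx l 0 → ℝ) × ℝ =>
          F (glue (tgtSplit l 0) (gramPoint y) z.1 z.2) :=
        hF.comp (hgt.comp (by fun_prop :
          Measurable fun z : (VecIdx l 0 → ℝ) × ℝ => (gramPoint y, z.1, z.2)))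
      have h1 := lintegral_inner_norm_sq (vecFamily y) (by rwa [← bigGram_gramPoint])
        (by rw [hcard]; omega) hFgl
      refine h1.trans ?_
      simp only [Ψ, Φ, hcard, ← bigGram_gramPoint]
      congr 2
      refine lintegral_congr fun w => lintegral_congr fun t => ?_
      by_cases hpd : (bordered (bigGram (gramPoint y)) w t).PosDef
      · rw [Set.indicator_of_mem (show (w, t) ∈ {z : (VecIdx l 0 → ℝ) × ℝ |
          (bordered (bigGram (gramPoint y)) z.1 z.2).PosDef} from hpd), gramDensity,
          Set.indicator_of_mem (show _ ∈ {u | (bigGram u).PosDef} from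
            (bigGram_posDef_glue_iff _ w t).2 hpd), det_bigGram_glue]
      · rw [Set.indicator_of_notMem (show (w, t) ∉ {z : (VecIdx l 0 → ℝ) × ℝ |
          (bordered (bigGram (gramPoint y)) z.1 z.2).PosDef} from hpd), gramDensity,
          Set.indicator_of_notMem (show _ ∉ {u | (bigGram u).PosDef} from
            fun h => hpd ((bigGram_posDef_glue_iff _ w t).1 h)), zero_mul]
    have hsplit : ∀ z : EuclideanSpace ℝ (Fin M) × (Fin l → EuclideanSpace ℝ (Fin M)),
        F (gramPoint ((MeasurableEquiv.piFinSuccAbove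
          (fun _ : Fin (l + 1) => EuclideanSpace ℝ (Fin M)) (Fin.last l)).symm z)) =
        F (glue (tgtSplit l 0) (gramPoint z.2) (fun v => ⟪vecFamily z.2 v, z.1⟫) (‖z.1‖ ^ 2)) := by
      intro z
      set y := (MeasurableEquiv.piFinSuccAbove
          (fun _ : Fin (l + 1) => EuclideanSpace ℝ (Fin M)) (Fin.last l)).symm z with hy
      have hz : z = (MeasurableEquiv.piFinSuccAbove
          (fun _ : Fin (l + 1) => EuclideanSpace ℝ (Fin M)) (Fin.last l)) y := by
        rw [hy, MeasurableEquiv.apply_symm_apply]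
      have hz1 : z.1 = y (Fin.last l) := by rw [hz]; rfl
      have hz2 : z.2 = fun i => y i.castSucc := by
        rw [hz]
        funext i
        exact congrArg y (Fin.succAbove_last_apply i)
      rw [gramPoint_eq_glue, hz1, hz2]
    have hm2 : Measurable fun z : EuclideanSpace ℝ (Fin M) × (Fin l → EuclideanSpace ℝ (Fin M)) =>
        F (glue (tgtSplit l 0) (gramPoint z.2) (fun v => ⟪vecFamily z.2 v, z.1⟫) (‖z.1‖ ^ 2)) := by
      simp only [← hsplit]
      exact hFg.comp (MeasurableEquiv.measurable _)
    rw [← hmp.lintegral_comp hFg]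
    simp only [hsplit]
    rw [Measure.volume_eq_prod, lintegral_prod_symm _ hm2.aemeasurable,
      lintegral_congr_ae (hae.mono fun y hy => hstep y hy), ih' hΨ,
      lintegral_glue (tgtSplit l 0) hW, gramConst, gramConst, Finset.prod_range_succ,
      ENNReal.ofReal_mul (Finset.prod_nonneg fun j hj =>
        (halfArea_pos (by have := Finset.mem_range.1 hj; omega)).le), mul_assoc]
    congr 1
    rw [← lintegral_const_mul' _ _ ENNReal.ofReal_ne_top]
    refine lintegral_congr fun u => ?_
    by_cases hu : (bigGram u).PosDef
    · rw [gramDensity, Set.indicator_of_mem (show u ∈ {u | (bigGram u).PosDef} from hu)]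
      simp only [Ψ]
      rw [mul_left_comm, ← mul_assoc (ENNReal.ofReal _) (ENNReal.ofReal _) (Φ u),
        ← ENNReal.ofReal_mul (Real.rpow_nonneg hu.det_pos.le _), ← Real.rpow_add hu.det_pos,
        add_neg_cancel, Real.rpow_zero, ENNReal.ofReal_one, one_mul]
    · have h0 : ∀ w t, gramDensity M (glue (tgtSplit l 0) u w t) = 0 := by
        intro w t
        refine Set.indicator_of_notMem (fun h => hu ?_) _
        exact ((bigGram_posDef_glue_iff u w t).1 h).submatrix (e := Sum.inl) Sum.inl_injective
      rw [gramDensity, Set.indicator_of_notMem (show u ∉ {u | (bigGram u).PosDef} from hu)]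
      simp only [h0, zero_mul, lintegral_zero, mul_zero]

/-- The density of the distribution of scalar products with respect to the measure on Gram
matrices. -/
def gramJacobian (l M : ℕ) (u : SymIdx l → ℝ) : ℝ≥0∞ :=
  ENNReal.ofReal (gramConst l M * (symMatrix u).det ^ (((M : ℝ) - 1 - l) / 2))

theorem gramConst_pos (h : l ≤ M) : 0 < gramConst l M :=
  Finset.prod_pos fun j hj => halfArea_pos (by have := Finset.mem_range.1 hj; omega)

theorem measurable_gramJacobian (M : ℕ) : Measurable (gramJacobian l M) :=
  ((measurable_symMatrix_det.pow_const _).const_mul _).ennreal_ofReal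

theorem map_gramUpper (h : l ≤ M) :
    Measure.map (gramUpper : (Fin l → EuclideanSpace ℝ (Fin M)) → SymIdx l → ℝ) volume =
      (gramMeasure l).withDensity (gramJacobian l M) := by
  refine Measure.ext_of_lintegral _ fun G hG => ?_
  have hG' : Measurable fun u : TgtIdx l 0 → ℝ => G fun p => u (Sum.inr p) :=
    hG.comp (by fun_prop)
  have h1 := lintegral_gramPoint h hG'
  rw [lintegral_map hG measurable_gramUpper,
    lintegral_withDensity_eq_lintegral_mul _ (measurable_gramJacobian M) hG,
    gramMeasure_eq_restrict_posDef, ← lintegral_indicator (measurableSet_symMatrix_posDef l)]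
  refine h1.trans ?_
  rw [lintegral_reindex (Equiv.emptySum (PerpIdx l 0) (SymIdx l)),
    ← lintegral_const_mul' _ _ ENNReal.ofReal_ne_top]
  refine lintegral_congr fun u => ?_
  have hu : (fun p => (u ∘ Equiv.emptySum (PerpIdx l 0) (SymIdx l)) (Sum.inr p)) = u := rfl
  have hsub : u - compGram (κ := 0) (fun p => (u ∘ Equiv.emptySum (PerpIdx l 0) (SymIdx l))
      (Sum.inl p)) = u := sub_zero u
  have hpd := bigGram_posDef_iff (u ∘ Equiv.emptySum (PerpIdx l 0) (SymIdx l))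
  have hdet := det_bigGram (u ∘ Equiv.emptySum (PerpIdx l 0) (SymIdx l))
  rw [hu, hsub] at hpd hdet
  rw [hu, gramDensity]
  by_cases hp : (symMatrix u).PosDef
  · rw [Set.indicator_of_mem (show _ ∈ {u | (bigGram u).PosDef} from hpd.2 hp),
      Set.indicator_of_mem (show u ∈ {u | (symMatrix u).PosDef} from hp), hdet, ← mul_assoc,
      ← ENNReal.ofReal_mul (gramConst_pos h).le]
    rfl
  · rw [Set.indicator_of_notMem (show _ ∉ {u | (bigGram u).PosDef} from fun h => hp (hpd.1 h)),
      Set.indicator_of_notMem (show u ∉ {u | (symMatrix u).PosDef} from hp), zero_mul, mul_zero]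

end GramDistribution

/-! ### The integral in an integer number of dimensions -/

section IntegerDimension

open Matrix
open scoped ENNReal

namespace LoopIntegral

variable {dp l r d : ℕ}

/-- The physical components and the `μ_ij` as functions of the loop momenta in `ℝ^d`. -/
def momentumMap (ι : Phys →ₗᵢ[ℝ] EuclideanSpace ℝ (Fin d)) (q : Fin l → EuclideanSpace ℝ (Fin d)) :
    (Fin l → Phys) × (SymIdx l → ℝ) :=
  (fun i => physPart ι (q i), gramUpper fun i => q i - ι (physPart ι (q i)))

theorem symMatrix_momentumMap (ι : Phys →ₗᵢ[ℝ] EuclideanSpace ℝ (Fin d))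
    (q : Fin l → EuclideanSpace ℝ (Fin d)) : symMatrix (momentumMap ι q).2 = muGram ι q := by
  ext i j
  exact symMatrix_gramUpper (fun i => q i - ι (physPart ι (q i))) i j

theorem measurable_momentumMap (ι : Phys →ₗᵢ[ℝ] EuclideanSpace ℝ (Fin d)) :
    Measurable (momentumMap (l := l) ι) := by
  have h : Continuous (physPart ι) :=
    (ContinuousLinearMap.adjoint ι.toContinuousLinearMap).continuous
  have h1 : Continuous fun (q : Fin l → EuclideanSpace ℝ (Fin d)) i => physPart ι (q i) :=
    continuous_pi fun i => h.comp (continuous_apply i)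
  have h2 : Continuous fun (q : Fin l → EuclideanSpace ℝ (Fin d)) i =>
      q i - ι (physPart ι (q i)) :=
    continuous_pi fun i => (continuous_apply i).sub
      (ι.continuous.comp (h.comp (continuous_apply i)))
  exact h1.measurable.prodMk (measurable_gramUpper.comp h2.measurable)

/-- The loop momenta of `ℝ^d` are distributed in the variables `q_[4]i`, `μ_ij` with the density of
the dimensionally regularized integral. -/
theorem map_momentumMap (ι : Phys →ₗᵢ[ℝ] EuclideanSpace ℝ (Fin d)) (hd : l + 4 ≤ d) :
    Measure.map (momentumMap (l := l) ι) volume =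
      (measureDimReg l).withDensity fun z => gramJacobian l (d - 4) z.2 := by
  have hrange : Module.finrank ℝ (LinearMap.range ι.toLinearMap) = 4 := by
    rw [LinearMap.finrank_range_of_inj ι.injective, finrank_euclideanSpace_fin]
  have hperp : Module.finrank ℝ (LinearMap.range ι.toLinearMap)ᗮ = Fintype.card (Fin (d - 4)) := by
    have := (LinearMap.range ι.toLinearMap).finrank_add_finrank_orthogonal
    rw [finrank_euclideanSpace_fin, hrange] at this
    rw [Fintype.card_fin]; omega
  obtain ⟨g, hg, -⟩ := exists_linearIsometry_range_eq (ι := Fin (d - 4)) _ hperp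
  have horth : ∀ a b, ⟪ι a, g b⟫ = 0 := fun a b => (Submodule.mem_orthogonal _ _).1 (hg b) _ ⟨a, rfl⟩
  have hmp := measurePreserving_pi_add_of_orthogonal l ι g horth (by
    rw [finrank_euclideanSpace_fin, finrank_euclideanSpace_fin, finrank_euclideanSpace_fin]; omega)
  have hphys : ∀ Q y, physPart ι (ι Q + g y) = Q := by
    intro Q y
    refine ext_inner_left ℝ fun w => ?_
    rw [inner_physPart, inner_add_right, horth, add_zero, ι.inner_map_map]
  have hcomp : (momentumMap (l := l) ι) ∘
      (fun (z : (Fin l → Phys) × (Fin l → EuclideanSpace ℝ (Fin (d - 4)))) i =>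
        ι (z.1 i) + g (z.2 i)) = Prod.map id gramUpper := by
    funext z
    refine Prod.ext ?_ ?_
    · funext i
      exact hphys _ _
    · funext p
      simp only [Function.comp_apply, momentumMap, gramUpper, hphys, add_sub_cancel_left,
        g.inner_map_map, Prod.map_snd]
  rw [← hmp.map_eq, Measure.map_map (measurable_momentumMap ι) hmp.measurable, hcomp,
    Measure.volume_eq_prod, ← Measure.map_prod_map _ _ measurable_id measurable_gramUpper,
    Measure.map_id, map_gramUpper (by omega), prod_withDensity_right (measurable_gramJacobian _)]
  rfl

theorem halfArea_eq_solidAngle (K : ℕ) :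
    ((halfArea K : ℝ) : ℂ) = solidAngle ((K : ℂ) - 1) / 2 := by
  rw [halfArea, solidAngle, sub_add_cancel, Complex.ofReal_div,
    Complex.ofReal_cpow Real.pi_pos.le, ← Complex.Gamma_ofReal]
  push_cast
  ring

theorem prefactor_eq (hd : l + 4 ≤ d) :
    prefactor l d = (∏ _i : Fin l, 1 / (Real.pi : ℂ) ^ ((d : ℂ) / 2)) *
      ((gramConst l (d - 4) : ℝ) : ℂ) := by
  rw [prefactor, gramConst, ← Fin.prod_univ_eq_prod_range (fun j => halfArea (d - 4 - j)),
    Complex.ofReal_prod, ← Finset.prod_mul_distrib]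
  refine Finset.prod_congr rfl fun i _ => ?_
  have hi := i.2
  rw [halfArea_eq_solidAngle, Nat.cast_sub (by omega), Nat.cast_sub (by omega)]
  rw [show (d : ℂ) - 4 - (((i : ℕ) : ℂ) + 1) = (d : ℂ) - (4 : ℕ) - ((i : ℕ) : ℂ) - 1 by
    push_cast; ring]
  have hpi : (Real.pi : ℂ) ^ ((d : ℂ) / 2) ≠ 0 := by
    rw [Complex.cpow_ne_zero_iff]
    exact Or.inl (by exact_mod_cast Real.pi_ne_zero)
  field_simp

/-- In an integer number of dimensions the Feynman integral agrees with the dimensionally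
regularized one. -/
theorem integrable_and_integral_integer (I : LoopIntegral dp l r) (hd : l + 4 ≤ d)
    (ι : Phys →ₗᵢ[ℝ] EuclideanSpace ℝ (Fin d)) :
    (Integrable (fun q => I.integrandD ι q) volume ↔
      Integrable (I.integrandDimReg d) (measureDimReg l)) ∧
    I.integralD ι = I.integralDimReg d := by
  let H : (Fin l → Phys) × (SymIdx l → ℝ) → ℂ := fun z =>
    I.numAt z.1 (symMatrix z.2) / ∏ j, ((I.den z.1 (symMatrix z.2) j : ℝ) : ℂ)
  have hH : Measurable H := by
    refine I.measurable_numAt_comp.div (Finset.measurable_prod _ fun j _ => ?_)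
    exact Complex.measurable_ofReal.comp (I.measurable_den_comp j)
  set c : ℂ := ∏ _i : Fin l, 1 / (Real.pi : ℂ) ^ ((d : ℂ) / 2) with hc
  have hc0 : c ≠ 0 := by
    refine Finset.prod_ne_zero_iff.2 fun i _ => one_div_ne_zero ?_
    rw [Complex.cpow_ne_zero_iff]
    exact Or.inl (by exact_mod_cast Real.pi_ne_zero)
  have hγ : ((gramConst l (d - 4) : ℝ) : ℂ) ≠ 0 := by
    exact_mod_cast (gramConst_pos (l := l) (M := d - 4) (by omega)).ne'
  have hint : (fun q => I.integrandD ι q) = fun q => c * H (momentumMap ι q) := by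
    funext q
    simp only [integrandD, H, symMatrix_momentumMap, denD_eq_den_physPart]
    rfl
  have hJ : Measurable fun z : (Fin l → Phys) × (SymIdx l → ℝ) => gramJacobian l (d - 4) z.2 :=
    (measurable_gramJacobian _).comp measurable_snd
  -- the density of the distribution of the `μ_ij` is the complex weight
  have hK : ∀ᵐ z ∂(measureDimReg l), ((gramJacobian l (d - 4) z.2).toReal : ℂ) * H z =
      ((gramConst l (d - 4) : ℝ) : ℂ) * I.integrandDimReg d z := by
    have hpd : ∀ᵐ u ∂(gramMeasure l), (symMatrix u).PosDef := by
      rw [gramMeasure_eq_restrict_posDef]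
      exact ae_restrict_mem (measurableSet_symMatrix_posDef l)
    have hpd' : ∀ᵐ z ∂(measureDimReg l), (symMatrix z.2).PosDef :=
      Measure.quasiMeasurePreserving_snd.ae hpd
    filter_upwards [hpd'] with z hz
    have hdet := hz.det_pos
    rw [gramJacobian, ENNReal.toReal_ofReal (mul_nonneg
      (gramConst_pos (l := l) (M := d - 4) (by omega)).le (Real.rpow_nonneg hdet.le _)),
      Complex.ofReal_mul, Complex.ofReal_cpow hdet.le, mul_assoc, integrandDimReg, gramWeight]
    congr 4
    rw [Nat.cast_sub (by omega : 4 ≤ d)]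
    push_cast
    ring
  obtain ⟨h1, h2⟩ := integrable_and_integral_of_map (Ψ := id) measurable_id hJ
    (fun z => ENNReal.ofReal_ne_top) Measure.map_id hH hK
  rw [← map_momentumMap ι hd] at h1 h2
  rw [integrable_map_measure hH.aestronglyMeasurable (measurable_momentumMap ι).aemeasurable] at h1
  rw [integral_map (measurable_momentumMap ι).aemeasurable hH.aestronglyMeasurable,
    integral_const_mul] at h2
  constructor
  · rw [hint, integrable_const_mul_iff (IsUnit.mk0 c hc0)]
    exact h1.trans (integrable_const_mul_iff (IsUnit.mk0 _ hγ) _)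
  · rw [integralD, hint, integral_const_mul, h2, integralDimReg, prefactor_eq hd, mul_assoc]

end LoopIntegral

end IntegerDimension

end FeynmanPar

end

open FeynmanPar in
theorem mainTheorem1 (l n : ℕ) (hn1 : 1 ≤ n) (hn4 : n ≤ 4) :
    ∃ T : PolyMap l (4 - (n - 1)),
      -- the change of variables is iterated Gram–Schmidt plus nested spherical coordinates
      T.IsNestedSpherical ∧
      -- the two forms of the integral over the variables `Λ`
      (∀ (D : ℂ), (l : ℝ) - 1 < D.re → ∀ g : (SymIdx l → ℝ) → ℂ, Measurable g →
        (Integrable (fun u => gramWeight D u * g u) (gramMeasure l) ↔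
          Integrable (fun z : (Fin l → ℝ) × (LamIdx l → ℝ) =>
              lamWeight D z.1 (angles z.2) * g (T.lamUpper z.1 (angles z.2)))
            ((radialMeasure l).prod (cosMeasure (LamIdx l)))) ∧
        (Integrable (fun u => gramWeight D u * g u) (gramMeasure l) →
          ∫ u, gramWeight D u * g u ∂(gramMeasure l) =
            ∫ t, ∫ c, lamWeight D t (angles c) * g (T.lamUpper t (angles c))
              ∂(cosMeasure (LamIdx l)) ∂(radialMeasure l))) ∧
      ∀ (r : ℕ) (I : LoopIntegral (n - 1) l r) (e : Module.Basis (Fin 4) ℝ Phys), I.IsAdapted e →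
        -- the denominators depend only on the parallel components and on the `λ_ij`
        (∀ (d : ℕ) (ι : Phys →ₗᵢ[ℝ] EuclideanSpace ℝ (Fin d))
            (q : Fin l → EuclideanSpace ℝ (Fin d)) (j : Fin r),
          I.denD ι q j = I.den (fun i => (I.parPart ι (q i) : Phys)) (I.lamGram ι q) j) ∧
        -- the numerator becomes a polynomial in the sines and cosines of the angles
        (∃ P : MvPolynomial ((Fin (n - 1) × Fin l) ⊕ PerpVar l (4 - (n - 1))) ℂ,
          ∀ (Q : Fin l → I.par) (t : Fin l → ℝ) (θL : LamIdx l → ℝ)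
            (θP : PerpIdx l (4 - (n - 1)) → ℝ), (∀ i, 0 ≤ t i) →
            I.numPar T e Q t θL θP =
              MvPolynomial.eval
                (Sum.elim
                  (fun x : Fin (n - 1) × Fin l =>
                    ((e.repr (Q x.2 : Phys) (Fin.castLE (by omega) x.1) : ℝ) : ℂ))
                  (fun x => ((perpPoint (fun i => Real.sqrt (t i)) θL θP x : ℝ) : ℂ))) P) ∧
        -- the integral in an integer number of dimensions
        (∀ d : ℕ, l + 4 ≤ d → ∀ ι : Phys →ₗᵢ[ℝ] EuclideanSpace ℝ (Fin d),
          (Integrable (fun q => I.integrandD ι q) volume ↔ I.IntegrablePar T e d) ∧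
          (Integrable (fun q => I.integrandD ι q) volume →
            I.integralD ι = I.integralPar T e d)) ∧
        -- the integral in a complex number of dimensions
        (∀ d : ℂ, (l : ℝ) + 3 < d.re →
          (Integrable (I.integrandDimReg d) (LoopIntegral.measureDimReg l) ↔ I.IntegrablePar T e d) ∧
          (Integrable (I.integrandDimReg d) (LoopIntegral.measureDimReg l) →
            I.integralDimReg d = I.integralPar T e d)) := by
  refine ⟨nestedMap l (4 - (n - 1)), nestedMap_isNestedSpherical l _ (by omega), ?_, ?_⟩
  · intro D _ g hg
    obtain ⟨h1, h2⟩ := integral_gram_eq (l := l) (κ := 4 - (n - 1)) D hg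
    exact ⟨h1, fun h => h2.trans (integral_prod _ (h1.1 h))⟩
  · intro r I e he
    have h4 : n - 1 ≤ 4 := by omega
    refine ⟨fun d ι q j => I.denD_eq_den_parPart ι q j, exists_numPar_eq_eval h4 he _, ?_,
      fun d _ => he.dimReg h4 d⟩
    intro d hd ι
    obtain ⟨h1, h2⟩ := I.integrable_and_integral_integer hd ι
    obtain ⟨h3, h5⟩ := he.dimReg h4 (d : ℂ)
    exact ⟨h1.trans h3, fun h => h2.trans (h5 (h1.1 h))⟩
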